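/- **Proposition 3.1 (Dilation Principle).** Let $R$ be a commutative ring with identity and let $A$ be an associative $R$-algebra with identity which is finite as an $R$-module. Let $P$ be a finitely generated projective left $A$-module. For a commutative $R$-algebra $B$ put $A_B=B\otimes_R A$ and $P_B=B\otimes_R P$; write $A[X],P[X]$, $A_s,P_s$ and $A_s[X],P_s[X]$ for $B=R[X]$, $R_s$ and $R_s[X]$, and similarly for $Q$ below. We consider three cases. *Linear case.* $Q=P\oplus A$, $\mathrm G(Q[X])$ is the group of $A[X]$-automorphisms of $Q[X]$, and $\mathrm{ET}(Q[X])$ is its subgroup generated by the maps $(p,a)\mapsto(p+ax,a)$ and $(p,a)\mapsto(p,a+\psi(p))$ with $x\in P[X]$, $\psi\in P[X]^*$. Let $n\ge 2$. *Symplectic ($\varepsilon=-1$) and orthogonal ($\varepsilon=1$) cases.* Here $2$ is invertible in $R$, $A$ has an involution $a\mapsto\bar a$ (an $R$-linear anti-automorphism of order dividing $2$), and $P$ carries a non-singular biadditive form $\langle\,,\rangle:P\times P\to A$ with $\langle ap,bq\rangle=a\langle p,q\rangle\bar b$ and $\langle q,p\rangle=\varepsilon\,\overline{\langle p,q\rangle}$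 (for $A$ commutative with trivial involution: an alternating, resp. symmetric, bilinear form). $Q=P\perp A^2$, where $A^2$ has the form $\langle(b,a),(b',a')\rangle=b\bar a'+\varepsilon a\bar b'$; $\mathrm G(Q[X])$ is the group of isometries of $Q[X]$, and $\mathrm{ET}(Q[X])$ is the subgroup generated, for $q\in P[X]$ with $\langle q,q\rangle=0$, by the maps $$(p,b,a)\mapsto(p+aq,\,b-\langle p,q\rangle+a,\,a),\qquad (p,b,a)\mapsto(p+bq,\,b,\,a+\langle p,q\rangle-b)$$ in the symplectic case, and $$(p,b,a)\mapsto(p-aq,\,b+\langle p,q\rangle,\,a),\qquad (p,b,a)\mapsto(p-bq,\,b,\,a+\langle p,q\rangle)$$ in the orthogonal case. Let $n=2r\ge 6$, and assume **(H2)** for every non-nilpotent $t\in R$ such that $Q_t$ is a free $A_t$-module, $Q_t$ is isometric to $A_t^{2r+2}$ with the standard hyperbolic form, the orthogonal sum of $r+1$ copies of the hyperbolic plane $A_t^2$ with the form above. Let $s\in R$ be non-nilpotent such that $P_s$ is a free $A_s$-module of rank $n$. Identify $Q_s$ with $A_s^{n+1}$ through an isomorphism $P_s\cong A_s^n$ in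 the linear case, and with the standard hyperbolic module $A_s^{2r+2}$ through an isometry in the other cases. Let $\sigma(X)\in\mathrm G(Q[X])$ with $\sigma(0)=\mathrm{Id}$, and suppose that $\sigma_s(X)$ lies in the elementary group of $A_s[X]$, that is, * in the linear case, in the group $\mathrm E(n+1,A_s[X])$ generated by the matrices $1+c\,e_{ij}$, $i\ne j$, $c\in A_s[X]$; * in the other cases, in the group of isometries of $A_s[X]^{2r+2}$ generated by the matrices $1+c\,e_{kl}-\eta_k\eta_l\bar c\,e_{l'k'}$ for $l\ne k,k'$ and $c\in A_s[X]$, and $1+c\,e_{kk'}$ for $c\in A_s[X]$ with $\bar c=-\varepsilon c$. Here $k\mapsto k'$ exchanges the two indices of each hyperbolic plane, $\eta_k$ is $1$ for the first and $\varepsilon$ for the second of them, and matrices act on row vectors from the right. Then there exists an integer $l>0$ such that for every $b\in(s^l)=s^lR$ there is $\hat\tau(X)\in\mathrm{ET}(Q[X])$ with $\hat\tau(0)=\mathrm{Id}$ which localizes to $\sigma(bX)$, i.e. $\hat\tau_s(X)=\sigma_s(bX)$ in $\mathrm G(Q_s[X])$. -/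

import Mathlib

open scoped TensorProduct Polynomial

noncomputable section

namespace Dilation

/-! ### Elementary groups over an arbitrary ring `A`

Modules are left modules and automorphisms are `A`-linear equivalences. An element of `A^m` is a
row, so that an elementary matrix acts on it by multiplication from the right. -/

section Groups

variable {A : Type*} [Ring A]

/-- The group `E(m, A)`, generated by the elementary matrices `1 + c e_{ij}` with `i ≠ j`. -/
def elementaryGroup (A : Type*) [Ring A] (m : ℕ) :
    Subgroup ((Fin m → A) ≃ₗ[A] (Fin m → A)) :=
  Subgroup.closure {τ | ∃ i j : Fin m, i ≠ j ∧ ∃ c : A,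
    ∀ v, τ v = v + Pi.single j (v i * c)}

/-- `ETrans(P ⊕ A)`: generated by the elementary transvections `(p, a) ↦ (p + a x, a)` and
`(p, a) ↦ (p, a + ψ(p))` with `x ∈ P` and `ψ ∈ P^*`. -/
def eTrans (A P : Type*) [Ring A] [AddCommGroup P] [Module A P] :
    Subgroup ((P × A) ≃ₗ[A] (P × A)) :=
  Subgroup.closure
    ({τ | ∃ x : P, ∀ p a, τ (p, a) = (p + a • x, a)} ∪
     {τ | ∃ ψ : P →ₗ[A] A, ∀ p a, τ (p, a) = (p, a + ψ p)})

/-- The two kinds of modules with a form. -/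
inductive Kind
  | symplectic
  | orthogonal

/-- The sign `ε` in `⟨q, p⟩ = ε * conj ⟨p, q⟩`. -/
def Kind.sign : Kind → ℤ
  | .symplectic => -1
  | .orthogonal => 1

/-- The form of `P ⊥ A²`, where `j` is the involution of `A`, `h` is the form of `P`, and `A²` is
the hyperbolic plane with `⟨(b, a), (b', a')⟩ = b * conj a' + ε * a * conj b'`. -/
def formQ {P : Type*} (κ : Kind) (j : A → A) (h : P → P → A) (x y : P × A × A) : A :=
  h x.1 y.1 + (x.2.1 * j y.2.2 + κ.sign • (x.2.2 * j y.2.1))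

/-- The standard hyperbolic form on `A^{2m} = A^m ⊕ A^m`, the orthogonal sum of `m` hyperbolic
planes: `⟨v, w⟩ = ∑ i, (v_i * conj w_{i'} + ε * v_{i'} * conj w_i)`, where `i` and `i'` are the
`i`-th indices of the two summands. -/
def hypForm (κ : Kind) (j : A → A) (m : ℕ) (v w : Fin m ⊕ Fin m → A) : A :=
  ∑ i : Fin m, (v (.inl i) * j (w (.inr i)) + κ.sign • (v (.inr i) * j (w (.inl i))))

/-- The sign attached to an index of `A^{2m}`. -/
def Kind.eta (κ : Kind) {m : ℕ} : Fin m ⊕ Fin m → ℤ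
  | .inl _ => 1
  | .inr _ => κ.sign

/-- The elementary group `ESp(2m, A)` or `EO(2m, A)` of the standard hyperbolic form. With `k'`
the index paired with `k` (`Sum.swap k`), it is generated by
* `1 + c e_{kl} - η_k η_l (conj c) e_{l'k'}` for `l ≠ k, k'` and `c ∈ A`,
* `1 + c e_{kk'}` for `c ∈ A` with `conj c = - ε c`.

For a commutative ring with trivial involution in which `2` is invertible the second generators
are all `1 + c e_{kk'}` in the symplectic case and only the identity in the orthogonal case. -/
def hypElementaryGroup (κ : Kind) (j : A → A) (m : ℕ) :
    Subgroup ((Fin m ⊕ Fin m → A) ≃ₗ[A] (Fin m ⊕ Fin m → A)) :=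
  Subgroup.closure
    ({τ | ∃ k l : Fin m ⊕ Fin m, l ≠ k ∧ l ≠ k.swap ∧ ∃ c : A, ∀ v,
        τ v = v + Pi.single l (v k * c)
          - Pi.single k.swap ((κ.eta k * κ.eta l) • (v l.swap * j c))} ∪
     {τ | ∃ (k : Fin m ⊕ Fin m) (c : A), j c = -(κ.sign • c) ∧
        ∀ v, τ v = v + Pi.single k.swap (v k * c)})

/-- `ETrans_Sp(P ⊥ A²)` or `ETrans_O(P ⊥ A²)`: generated by the elementary symplectic
(orthogonal) transvections. The vector `q` is isotropic, which is what makes the displayed maps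
isometries of `formQ`; if the form is alternating, then every `q` is isotropic. -/
def eTransForm {P : Type*} [AddCommGroup P] [Module A P] (κ : Kind) (h : P → P → A) :
    Subgroup ((P × A × A) ≃ₗ[A] (P × A × A)) :=
  match κ with
  | .symplectic => Subgroup.closure
      ({τ | ∃ q : P, h q q = 0 ∧
          ∀ p b a, τ (p, b, a) = (p + a • q, b - h p q + a, a)} ∪
       {τ | ∃ q : P, h q q = 0 ∧
          ∀ p b a, τ (p, b, a) = (p + b • q, b, a + h p q - b)})
  | .orthogonal => Subgroup.closure
      ({τ | ∃ q : P, h q q = 0 ∧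
          ∀ p b a, τ (p, b, a) = (p - a • q, b + h p q, a)} ∪
       {τ | ∃ q : P, h q q = 0 ∧
          ∀ p b a, τ (p, b, a) = (p - b • q, b, a + h p q)})

end Groups

/-! ### Involutions and forms on a module over an `R`-algebra -/

section Forms

variable {R A P : Type*} [CommRing R] [Ring A] [Algebra R A]
  [AddCommGroup P] [Module R P] [Module A P]

/-- `j` is an involution of the `R`-algebra `A` which is trivial on `R`: an `R`-linear
antiautomorphism with square the identity. -/
structure IsInvolution (j : A →ₗ[R] A) : Prop where
  map_one : j 1 = 1
  map_mul : ∀ x y, j (x * y) = j y * j x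
  invol : ∀ x, j (j x) = x

/-- `h` is a non-singular form on the left module `P`, linear in the first variable,
conjugate-linear in the second, and skew-Hermitian (symplectic case) or Hermitian (orthogonal
case) for the involution `j`. If `A` is commutative, `2` is invertible and `j` is the identity,
this is a non-singular alternating (symmetric) bilinear form. -/
structure IsForm (κ : Kind) (j : A →ₗ[R] A) (h : P →ₗ[R] P →ₗ[R] A) : Prop where
  smul_left : ∀ (a : A) p q, h (a • p) q = a * h p q
  smul_right : ∀ (a : A) p q, h p (a • q) = h p q * j a
  symm : ∀ p q, h q p = κ.sign • j (h p q)
  nonsingular : ∀ φ : P →ₗ[A] A, ∃! q, ∀ p, φ p = h p q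

end Forms

/-! ### Extension of scalars

For a commutative `R`-algebra `B` the `R`-algebra `A`, its involution, a left `A`-module `P` and
a form on `P` are extended to `A_B = B ⊗ A`, `P_B = B ⊗ P` and so on. With `B = R[X]`, the
localization `R_s`, and `R_s[X]` this gives `A[X]`, `A_s`, `A_s[X]` and `P[X]`, `P_s`, `P_s[X]`. -/

section Extension

variable (R : Type*) [CommRing R]

/-- The module `P_B = B ⊗ P`, with the scalar action of `A_B = B ⊗ A` defined below. -/
def Extn (B P : Type*) [CommRing B] [Algebra R B] [AddCommGroup P] [Module R P] : Type _ :=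
  B ⊗[R] P

variable (B B' A P : Type*) [CommRing B] [Algebra R B] [CommRing B'] [Algebra R B']
  [Ring A] [Algebra R A] [AddCommGroup P] [Module R P]

instance : AddCommGroup (Extn R B P) := inferInstanceAs (AddCommGroup (B ⊗[R] P))

instance : Module B (Extn R B P) := inferInstanceAs (Module B (B ⊗[R] P))

variable {R A P} in
/-- The pure tensor `b ⊗ p` as an element of `P_B`. -/
def Extn.tmul {B : Type*} [CommRing B] [Algebra R B] (b : B) (p : P) : Extn R B P := b ⊗ₜ[R] p

variable [Module A P] [IsScalarTower R A P]

/-- The action of `B ⊗ A` on `B ⊗ P` as a ring homomorphism. -/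
def Extn.action : B ⊗[R] A →ₐ[B] Module.End B (B ⊗[R] P) :=
  Algebra.TensorProduct.lift (Algebra.ofId B _)
    ((Module.End.baseChangeHom R B P).comp (Algebra.lsmul R R P))
    (fun b _ => show Commute _ _ from Algebra.commutes b _)

instance : Module (B ⊗[R] A) (Extn R B P) :=
  Module.compHom (B ⊗[R] P) (Extn.action R B A P).toRingHom

/-- The action of `B ⊗ A` on `B ⊗ P` is `(b ⊗ a) (c ⊗ p) = b c ⊗ a p`. -/
theorem Extn.tmul_smul_tmul (b c : B) (a : A) (p : P) :
    (b ⊗ₜ[R] a : B ⊗[R] A) • (Extn.tmul c p : Extn R B P) = Extn.tmul (b * c) (a • p) := by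
  change (Extn.action R B A P (b ⊗ₜ[R] a)) (c ⊗ₜ[R] p) = (b * c) ⊗ₜ[R] (a • p)
  rw [Extn.action, Algebra.TensorProduct.lift_tmul]
  change b • (c ⊗ₜ[R] (a • p)) = (b * c) ⊗ₜ[R] (a • p)
  rw [TensorProduct.smul_tmul', smul_eq_mul]

variable {R B B' A P}

/-- The map `P_B → P_{B'}` induced by a homomorphism `f : B → B'`. -/
def Extn.map (f : B →ₐ[R] B') (x : Extn R B P) : Extn R B' P :=
  LinearMap.rTensor P f.toLinearMap (show B ⊗[R] P from x)

/-- The map `A_B → A_{B'}` induced by a homomorphism `f : B → B'`. -/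
def ringMap (f : B →ₐ[R] B') (a : B ⊗[R] A) : B' ⊗[R] A :=
  LinearMap.rTensor A f.toLinearMap a

/-- The induced map `P_B ⊕ A_B → P_{B'} ⊕ A_{B'}`. -/
def mapLin (f : B →ₐ[R] B') (x : Extn R B P × (B ⊗[R] A)) : Extn R B' P × (B' ⊗[R] A) :=
  (Extn.map f x.1, ringMap f x.2)

/-- The induced map `P_B ⊥ A_B² → P_{B'} ⊥ A_{B'}²`. -/
def mapForm (f : B →ₐ[R] B') (x : Extn R B P × (B ⊗[R] A) × (B ⊗[R] A)) :
    Extn R B' P × (B' ⊗[R] A) × (B' ⊗[R] A) :=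
  (Extn.map f x.1, ringMap f x.2.1, ringMap f x.2.2)

variable (B) in
/-- The extended involution `b ⊗ a ↦ b ⊗ conj a` of `A_B`. -/
def extInv (j : A →ₗ[R] A) (a : B ⊗[R] A) : B ⊗[R] A := j.baseChange B a

variable (B) in
/-- The extended form `⟨b ⊗ p, c ⊗ q⟩ = b c ⊗ ⟨p, q⟩` of `P_B`. -/
def extForm (h : P →ₗ[R] P →ₗ[R] A) (x y : Extn R B P) : B ⊗[R] A :=
  LinearMap.BilinMap.baseChange B h (show B ⊗[R] P from x) (show B ⊗[R] P from y)

end Extension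

/-- `φ'` extends `φ` along the comparison maps `i` and `k`. It is used when `φ` is linear over
some `A_B`, `φ'` is linear over some `A_{B'}`, and `i` and `k` are the maps induced by a
homomorphism `B → B'`. The image of `i` then generates the domain of `φ'`, so that this says that
`φ'` is the base change of `φ` along `B → B'`. -/
def Extends {M N M' N' : Type*} (i : M → M') (k : N → N') (φ : M → N) (φ' : M' → N') : Prop :=
  ∀ x, φ' (i x) = k (φ x)

section Maps

variable {R : Type*} [CommRing R]

/-- The specialization `X ↦ 0`, as a map `R[X] → R`. -/
def evalZero : R[X] →ₐ[R] R := Polynomial.aeval 0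

/-- The substitution `X ↦ b X`, as a map `R[X] → R[X]`. -/
def scale (b : R) : R[X] →ₐ[R] R[X] := Polynomial.aeval (Polynomial.C b * Polynomial.X)

/-- The localization `R[X] → R_s[X]`. -/
def loc (s : R) : R[X] →ₐ[R] (Localization.Away s)[X] :=
  Polynomial.mapAlgHom (Algebra.ofId R (Localization.Away s))

/-- The inclusion of the constants `R_s → R_s[X]`. -/
def const (s : R) : Localization.Away s →ₐ[R] (Localization.Away s)[X] :=
  (Polynomial.CAlgHom : Localization.Away s →ₐ[Localization.Away s] _).restrictScalars R

end Maps

section Statement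

variable {R A P : Type*} [CommRing R] [Ring A] [Algebra R A]
  [AddCommGroup P] [Module R P] [Module A P] [IsScalarTower R A P]

/-- The module `Q_B = P_B ⊕ A_B` of the linear case. -/
abbrev QLin (R A P B : Type*) [CommRing R] [Ring A] [Algebra R A] [AddCommGroup P] [Module R P]
    [CommRing B] [Algebra R B] : Type _ :=
  Extn R B P × (B ⊗[R] A)

/-- The module `Q_B = P_B ⊥ A_B²` of the symplectic and orthogonal cases. -/
abbrev QForm (R A P B : Type*) [CommRing R] [Ring A] [Algebra R A] [AddCommGroup P] [Module R P]
    [CommRing B] [Algebra R B] : Type _ :=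
  Extn R B P × (B ⊗[R] A) × (B ⊗[R] A)

/-- `σ` preserves the form of `Q_B`, that is, `σ ∈ Sp(Q_B)` or `σ ∈ O(Q_B)`. -/
def IsIsometry {B : Type*} [CommRing B] [Algebra R B] (κ : Kind) (j : A →ₗ[R] A)
    (h : P →ₗ[R] P →ₗ[R] A) (σ : QForm R A P B ≃ₗ[B ⊗[R] A] QForm R A P B) : Prop :=
  ∀ x y, formQ κ (extInv B j) (extForm B h) (σ x) (σ y) = formQ κ (extInv B j) (extForm B h) x y

/-- `θ` is an isometry from `Q_B` onto `A_B^{2m}` with the standard hyperbolic form. -/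
def IsHyperbolicIsometry {B : Type*} [CommRing B] [Algebra R B] (κ : Kind) (j : A →ₗ[R] A)
    (h : P →ₗ[R] P →ₗ[R] A) (m : ℕ)
    (θ : QForm R A P B ≃ₗ[B ⊗[R] A] (Fin m ⊕ Fin m → B ⊗[R] A)) : Prop :=
  ∀ x y, hypForm κ (extInv B j) m (θ x) (θ y) = formQ κ (extInv B j) (extForm B h) x y

/-- Condition (H2) for a module with form `P` of rank `2 r`: for every non-nilpotent `s ∈ R`, if
the `A_s`-module `Q_s` is free, then `Q_s` is isometric to `A_s^{2r+2}` with the standard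
hyperbolic form. -/
def H2 (κ : Kind) (j : A →ₗ[R] A) (h : P →ₗ[R] P →ₗ[R] A) (r : ℕ) : Prop :=
  ∀ s : R, ¬ IsNilpotent s →
    Module.Free (Localization.Away s ⊗[R] A) (QForm R A P (Localization.Away s)) →
    ∃ θ : QForm R A P (Localization.Away s) ≃ₗ[Localization.Away s ⊗[R] A]
      (Fin (r + 1) ⊕ Fin (r + 1) → Localization.Away s ⊗[R] A),
      IsHyperbolicIsometry κ j h (r + 1) θ

/-- Linear case: `σ_s(X)` lies in `E(n+1, A_s[X])`, where `Q_s = P_s ⊕ A_s` is identified with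
`A_s^{n+1}` by the isomorphism `e : P_s ≃ A_s^n` and the identity of `A_s`. Here `σs` is
`σ_s(X)` and `θ` is the resulting isomorphism `Q_s[X] ≃ A_s[X]^{n+1}`. -/
def LocElementaryLin (s : R) (n : ℕ)
    (e : Extn R (Localization.Away s) P ≃ₗ[Localization.Away s ⊗[R] A]
      (Fin n → Localization.Away s ⊗[R] A))
    (σ : QLin R A P R[X] ≃ₗ[R[X] ⊗[R] A] QLin R A P R[X]) : Prop :=
  ∃ (σs : QLin R A P (Localization.Away s)[X] ≃ₗ[(Localization.Away s)[X] ⊗[R] A]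
      QLin R A P (Localization.Away s)[X])
    (θ : QLin R A P (Localization.Away s)[X] ≃ₗ[(Localization.Away s)[X] ⊗[R] A]
      (Fin (n + 1) → (Localization.Away s)[X] ⊗[R] A)),
    Extends (mapLin (loc s)) (mapLin (loc s)) σ σs ∧
    Extends (mapLin (const s)) (fun v k => ringMap (const s) (v k))
      (fun x => (Fin.snoc (e x.1) x.2 : Fin (n + 1) → Localization.Away s ⊗[R] A)) θ ∧
    θ.symm ≪≫ₗ σs ≪≫ₗ θ ∈ elementaryGroup ((Localization.Away s)[X] ⊗[R] A) (n + 1)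

/-- Symplectic and orthogonal cases: `σ_s(X)` lies in the elementary group of
`A_s[X]^{2r+2}`, where `Q_s` is identified with `A_s^{2r+2}` by an isometry `θ₀`. Here `σs` is
`σ_s(X)` and `θ` is the resulting isometry `Q_s[X] ≃ A_s[X]^{2r+2}`. -/
def LocElementaryForm (κ : Kind) (j : A →ₗ[R] A) (s : R) (r : ℕ)
    (θ₀ : QForm R A P (Localization.Away s) ≃ₗ[Localization.Away s ⊗[R] A]
      (Fin (r + 1) ⊕ Fin (r + 1) → Localization.Away s ⊗[R] A))
    (σ : QForm R A P R[X] ≃ₗ[R[X] ⊗[R] A] QForm R A P R[X]) : Prop :=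
  ∃ (σs : QForm R A P (Localization.Away s)[X] ≃ₗ[(Localization.Away s)[X] ⊗[R] A]
      QForm R A P (Localization.Away s)[X])
    (θ : QForm R A P (Localization.Away s)[X] ≃ₗ[(Localization.Away s)[X] ⊗[R] A]
      (Fin (r + 1) ⊕ Fin (r + 1) → (Localization.Away s)[X] ⊗[R] A)),
    Extends (mapForm (loc s)) (mapForm (loc s)) σ σs ∧
    Extends (mapForm (const s)) (fun v k => ringMap (const s) (v k)) θ₀ θ ∧
    θ.symm ≪≫ₗ σs ≪≫ₗ θ ∈
      hypElementaryGroup κ (extInv (Localization.Away s)[X] j) (r + 1)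

/-- Linear case: `τ(X)` and `σ(bX)` have the same localization over `A_s[X]`, with
`ρ = σ(bX)`. -/
def LocalizesToScaleLin (s b : R)
    (τ σ : QLin R A P R[X] ≃ₗ[R[X] ⊗[R] A] QLin R A P R[X]) : Prop :=
  ∃ ρ : QLin R A P R[X] ≃ₗ[R[X] ⊗[R] A] QLin R A P R[X],
    Extends (mapLin (scale b)) (mapLin (scale b)) σ ρ ∧
    ∀ x, mapLin (loc s) (τ x) = mapLin (loc s) (ρ x)

/-- Symplectic and orthogonal cases: `τ(X)` and `σ(bX)` have the same localization over
`A_s[X]`, with `ρ = σ(bX)`. -/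
def LocalizesToScaleForm (s b : R)
    (τ σ : QForm R A P R[X] ≃ₗ[R[X] ⊗[R] A] QForm R A P R[X]) : Prop :=
  ∃ ρ : QForm R A P R[X] ≃ₗ[R[X] ⊗[R] A] QForm R A P R[X],
    Extends (mapForm (scale b)) (mapForm (scale b)) σ ρ ∧
    ∀ x, mapForm (loc s) (τ x) = mapForm (loc s) (ρ x)

/-- Linear case: `σ(0) = Id`. -/
def IsIdAtZeroLin (σ : QLin R A P R[X] ≃ₗ[R[X] ⊗[R] A] QLin R A P R[X]) : Prop :=
  Extends (mapLin evalZero) (mapLin evalZero) σ (fun x : QLin R A P R => x)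

/-- Symplectic and orthogonal cases: `σ(0) = Id`. -/
def IsIdAtZeroForm (σ : QForm R A P R[X] ≃ₗ[R[X] ⊗[R] A] QForm R A P R[X]) : Prop :=
  Extends (mapForm evalZero) (mapForm evalZero) σ (fun x : QForm R A P R => x)

end Statement

end Dilation

end

open Dilation

/-!
# The dilation principle

Both cases rest on two facts about elementary automorphisms over `A_s[X]`. Say that a coefficient
is small if it is a multiple of a high power of `s` in the image of `A[X]`.

* *Conjugation.* If `γ` is a product of elementary automorphisms over `A_s[X]`, then `γ g γ⁻¹` is a
  product of elementary automorphisms with small coefficients as soon as `g` is one with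
  sufficiently small coefficients (`elemGroup_conj`, `IsFrame.rootGroup_conj`). For elementary
  factors that are not opposite this is the commutator formula; an opposite one is first written as
  a commutator by means of a third index.
* *Lifting.* Elementary automorphisms with sufficiently small coefficients are extended from
  elements of `ET(Q[X])` (`IsCoordExt.exists_elemGroup_le`, `IsFrame.exists_rootGroup_le_liftable`).

Now write `σ_s(X)` as a product of elementary automorphisms. If `b` is divisible by a high power of
`s`, the coefficients of the factors of `σ_s(bX)` differ from those of `σ_s(0)` by small ones, so
that by conjugation `σ_s(bX) σ_s(0)⁻¹ = σ_s(bX)` is a product of elementary automorphisms with small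
coefficients (`exists_extends_near`). It therefore lifts to some `τ` in `ET(Q[X])`, and division of
`τ` by `τ(0)` gives `τ(0) = Id` (`exists_reduction_eq_id_of_extends`).

In the linear case lifting is direct: a matrix which involves the last index is a transvection whose
vector or linear form has its denominators cancelled by the power of `s`, and the remaining ones are
commutators of such matrices.

In the cases with a form, lifting is the main difficulty, because the hyperbolic basis of `Q_s` has
nothing to do with the hyperbolic pair `(0, 1, 0), (0, 0, 1)` of `Q = P ⊥ A²`. All elementary
automorphisms are regarded as Eichler transvections `T(u, w) : x ↦ x + ⟨x, u⟩ w - ε ⟨x, w⟩ u` for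
`u`, `w` spanning a totally isotropic submodule, which makes them independent of coordinates and
compatible with conjugation by isometries.

* If the basis contains that hyperbolic pair, transvections with one vector in the pair and one
  orthogonal to it are generators of `ET`, and the others are obtained as commutators
  (`IsFrame.exists_rootGroup_le`). By conjugation, the same holds if the elementary group of the
  basis moves the pair into the basis.
* This can be achieved near every maximal ideal `𝔪` of `R_s`. In a finite-dimensional semisimple
  algebra, `a + b c` generates the right ideal of `a` and `b` for some `c`
  (`exists_right_generator`); as `A` is finite over `R`, this can be used modulo `𝔪` and the
  radical to make a coordinate of the first vector of the pair invertible (`exists_right_unit`), and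
  Nakayama's lemma makes it invertible after inverting one element outside `𝔪`. The pair is then
  moved into the basis with elementary transvections (`IsFrame.exists_move_pair`).
* For vectors `v`, `w` of `Q` which span a totally isotropic submodule and a fixed `a ∈ A`, the
  elements `d ∈ R` such that `T(v, d y a w)` is in `ET(Q[X])` for all `y ∈ R[X]` form an ideal. By
  the above, its extension to `R_s` is in no maximal ideal, so it contains a power of `s`
  (`exists_transv_mem_of_maximal`). Membership in `ET(Q[X])` is
  deduced from membership of the localization at `u` by means of a substitution of a multiple of
  `u^n` for `X`, after which two automorphisms that agree over `R_u[X]` and at `X = 0` become equal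
  (`exists_aeval_extends_eq`).
-/

namespace Dilation

open scoped commutatorElement

/-! ### Transvections of a module with form -/

section HermForm

variable {Λ M M' : Type*} [Ring Λ] [AddCommGroup M] [Module Λ M]

/-- `F` is an `ε`-Hermitian form on the left `Λ`-module `M`, with respect to the involution `J`
of `Λ`: linear in the first variable and conjugate-linear in the second. -/
structure HermForm (ε : ℤ) (J : Λ → Λ) (F : M → M → Λ) : Prop where
  eps : ε = 1 ∨ ε = -1
  J_add : ∀ a b, J (a + b) = J a + J b
  J_mul : ∀ a b, J (a * b) = J b * J a
  J_J : ∀ a, J (J a) = a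
  add_left : ∀ x y z, F (x + y) z = F x z + F y z
  smul_left : ∀ a x y, F (a • x) y = a * F x y
  symm : ∀ x y, F y x = ε • J (F x y)

/-- The vectors `u` and `w` span a totally isotropic submodule. -/
structure IsoPair (F : M → M → Λ) (u w : M) : Prop where
  left : F u u = 0
  right : F w w = 0
  orth : F u w = 0

namespace HermForm

variable {ε : ℤ} {J : Λ → Λ} {F : M → M → Λ} (H : HermForm ε J F)
include H

theorem eps_mul : ε * ε = 1 := by rcases H.eps with h | h <;> simp [h]

theorem eps_smul_smul {N : Type*} [AddCommGroup N] (x : N) : ε • ε • x = x := by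
  rw [smul_smul, H.eps_mul, one_smul]

theorem J_zero : J 0 = 0 := by simpa using H.J_add 0 0

theorem J_neg (a : Λ) : J (-a) = -J a := by
  have := H.J_add a (-a)
  rw [add_neg_cancel, H.J_zero] at this
  exact (neg_eq_of_add_eq_zero_right this.symm).symm

theorem J_one : J 1 = 1 := by
  have := H.J_mul 1 (J 1)
  rwa [one_mul, H.J_J, one_mul, eq_comm] at this

theorem J_eps (a : Λ) : J (ε • a) = ε • J a := by
  rcases H.eps with h | h <;> simp [h, H.J_neg]

theorem zero_left (y : M) : F 0 y = 0 := by simpa using H.add_left 0 0 y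

theorem neg_left (x y : M) : F (-x) y = -F x y := by
  simpa using H.smul_left (-1) x y

theorem sub_left (x y z : M) : F (x - y) z = F x z - F y z := by
  rw [sub_eq_add_neg, H.add_left, H.neg_left, sub_eq_add_neg]

theorem eps_left (x y : M) : F (ε • x) y = ε • F x y := by
  rcases H.eps with h | h <;> simp [h, H.neg_left]

theorem add_right (x y z : M) : F x (y + z) = F x y + F x z := by
  rw [H.symm (y + z) x, H.symm y x, H.symm z x, H.add_left, H.J_add, smul_add]

theorem smul_right (a : Λ) (x y : M) : F x (a • y) = F x y * J a := by
  rw [H.symm (a • y) x, H.symm y x, H.smul_left, H.J_mul, smul_mul_assoc]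

theorem zero_right (y : M) : F y 0 = 0 := by simpa using H.add_right y 0 0

theorem neg_right (x y : M) : F x (-y) = -F x y := by
  rw [← neg_one_smul Λ, H.smul_right, H.J_neg, H.J_one]; simp

theorem sub_right (x y z : M) : F x (y - z) = F x y - F x z := by
  rw [sub_eq_add_neg, H.add_right, H.neg_right, sub_eq_add_neg]

theorem orth_symm {x y : M} (h : F x y = 0) : F y x = 0 := by
  rw [H.symm x y, h, H.J_zero, smul_zero]

theorem isoPair_symm {u w : M} (h : IsoPair F u w) : IsoPair F w u :=
  ⟨h.right, h.left, H.orth_symm h.orth⟩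

theorem isoPair_smul_right {u w : M} (h : IsoPair F u w) (a : Λ) : IsoPair F u (a • w) :=
  ⟨h.left, by rw [H.smul_left, H.smul_right, h.right]; simp,
    by rw [H.smul_right, h.orth, zero_mul]⟩

theorem isoPair_smul_left {u w : M} (h : IsoPair F u w) (a : Λ) : IsoPair F (a • u) w :=
  H.isoPair_symm (H.isoPair_smul_right (H.isoPair_symm h) a)

end HermForm

/-- The map `x ↦ x + ⟨x, u⟩ w - ε ⟨x, w⟩ u`. -/
def transvFun (ε : ℤ) (F : M → M → Λ) (u w x : M) : M := x + F x u • w - ε • (F x w • u)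

open Classical in
/-- The Eichler transvection `x ↦ x + ⟨x, u⟩ w - ε ⟨x, w⟩ u`. It is an automorphism if `u` and `w`
span a totally isotropic submodule; the identity is used as a default value if there is no such
automorphism. -/
noncomputable def transv (ε : ℤ) (F : M → M → Λ) (u w : M) : M ≃ₗ[Λ] M :=
  if h : ∃ τ : M ≃ₗ[Λ] M, ∀ x, τ x = transvFun ε F u w x then h.choose else 1

namespace HermForm

variable {ε : ℤ} {J : Λ → Λ} {F : M → M → Λ} (H : HermForm ε J F)
include H

theorem transvFun_transvFun {u w w' : M} (h : IsoPair F u w) (h' : IsoPair F u w')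
    (hw : F w w' = 0) (x : M) :
    transvFun ε F u w (transvFun ε F u w' x) = transvFun ε F u (w + w') x := by
  have e1 := H.orth_symm h.orth
  have e2 := H.orth_symm h'.orth
  have e3 := H.orth_symm hw
  rcases H.eps with rfl | rfl <;>
  simp only [transvFun, one_smul, neg_smul, H.add_left, H.sub_left, H.smul_left, h.orth,
    h.left, e2, e3, H.add_right, sub_neg_eq_add, mul_zero, add_zero, sub_zero] <;>
  (simp only [add_smul, smul_add]; abel)

theorem transv_apply {u w : M} (h : IsoPair F u w) (x : M) :
    transv ε F u w x = transvFun ε F u w x := by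
  have h' : IsoPair F u (-w) := by
    simpa using H.isoPair_smul_right h (-1)
  have hz : ∀ x, transvFun ε F u 0 x = x := fun x => by
    simp [transvFun, H.zero_right]
  have ex : ∃ τ : M ≃ₗ[Λ] M, ∀ x, τ x = transvFun ε F u w x := by
    refine ⟨{ toFun := transvFun ε F u w
              invFun := transvFun ε F u (-w)
              map_add' := fun x y => ?_
              map_smul' := fun a x => ?_
              left_inv := fun x => ?_
              right_inv := fun x => ?_ }, fun x => rfl⟩
    · rcases H.eps with rfl | rfl <;> simp only [transvFun, H.add_left] <;>
  (simp only [add_smul, smul_add, neg_smul]; abel)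
    · rcases H.eps with rfl | rfl <;>
        simp [transvFun, H.smul_left, mul_smul, smul_add, smul_sub]
    · rw [H.transvFun_transvFun h' h (by rw [H.neg_left, h.right, neg_zero]), neg_add_cancel, hz]
    · rw [H.transvFun_transvFun h h' (by rw [H.neg_right, h.right, neg_zero]), add_neg_cancel, hz]
  rw [transv, dif_pos ex]
  exact ex.choose_spec x

theorem transv_eq {u w : M} (h : IsoPair F u w) (x : M) :
    transv ε F u w x = x + F x u • w - ε • (F x w • u) := H.transv_apply h x

theorem transv_isometry {u w : M} (h : IsoPair F u w) (x y : M) :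
    F (transv ε F u w x) (transv ε F u w y) = F x y := by
  have e1 := H.orth_symm h.orth
  rw [H.transv_eq h, H.transv_eq h]
  have e2 := H.symm y u
  have e3 := H.symm y w
  rcases H.eps with rfl | rfl <;>
  simp only [one_smul, neg_smul, H.add_left, H.sub_left, H.neg_left, H.smul_left, h.orth,
    h.left, h.right, e1, H.add_right, H.sub_right, H.neg_right, H.smul_right, e2, e3] <;>
  noncomm_ring

theorem transv_mul {u w w' : M} (h : IsoPair F u w) (h' : IsoPair F u w')
    (hw : F w w' = 0) : transv ε F u w * transv ε F u w' = transv ε F u (w + w') := by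
  have h'' : IsoPair F u (w + w') := ⟨h.left, by
    rw [H.add_left, H.add_right, H.add_right, h.right, h'.right, hw, H.orth_symm hw]; simp, by
    rw [H.add_right, h.orth, h'.orth, add_zero]⟩
  ext x
  rw [LinearEquiv.mul_apply, H.transv_apply h, H.transv_apply h', H.transv_apply h'',
    H.transvFun_transvFun h h' hw]

theorem transv_zero_right {u : M} (h : F u u = 0) : transv ε F u 0 = 1 := by
  ext x
  rw [H.transv_eq ⟨h, H.zero_left 0, H.zero_right u⟩, H.zero_right]
  simp

theorem transv_smul_mul {u w : M} (h : IsoPair F u w) (c c' : Λ) :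
    transv ε F u (c • w) * transv ε F u (c' • w) = transv ε F u ((c + c') • w) := by
  rw [H.transv_mul (H.isoPair_smul_right h c) (H.isoPair_smul_right h c')
    (by rw [H.smul_left, H.smul_right, h.right]; simp), add_smul]

theorem transv_inv {u w : M} (h : IsoPair F u w) :
    (transv ε F u w)⁻¹ = transv ε F u (-w) := by
  rw [inv_eq_iff_mul_eq_one]
  have := H.transv_smul_mul h 1 (-1)
  simpa [H.transv_zero_right h.left] using this

theorem transv_smul_left {u w : M} (h : IsoPair F u w) (a : Λ) :
    transv ε F (a • u) w = transv ε F u (J a • w) := by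
  ext x
  rw [H.transv_eq (H.isoPair_smul_left h a), H.transv_eq (H.isoPair_smul_right h _),
    H.smul_right, H.smul_right, H.J_J, mul_smul, mul_smul]

theorem transv_swap {u w : M} (h : IsoPair F u w) :
    transv ε F u w = transv ε F w ((-ε : ℤ) • u) := by
  have h' : IsoPair F w ((-ε : ℤ) • u) := by
    rcases H.eps with rfl | rfl
    · simpa using H.isoPair_smul_right (H.isoPair_symm h) (-1)
    · simpa using H.isoPair_symm h
  ext x
  rw [H.transv_eq h, H.transv_eq h']
  rcases H.eps with rfl | rfl <;> simp [H.neg_right] <;> abel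

theorem transv_smul_swap {u w : M} (h : IsoPair F u w) (c : Λ) :
    transv ε F u (c • w) = transv ε F w ((-ε • J c) • u) := by
  have hw := H.isoPair_symm h
  rw [H.transv_swap (H.isoPair_smul_right h c)]
  rcases H.eps with rfl | rfl
  · have := H.transv_smul_left (H.isoPair_smul_right hw (-1)) c
    simpa using this
  · simpa using H.transv_smul_left hw c

theorem conj_transv {g : M ≃ₗ[Λ] M} (hg : ∀ x y, F (g x) (g y) = F x y) {u w : M}
    (h : IsoPair F u w) : g * transv ε F u w * g⁻¹ = transv ε F (g u) (g w) := by
  have h' : IsoPair F (g u) (g w) := ⟨by rw [hg, h.left], by rw [hg, h.right], by rw [hg, h.orth]⟩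
  rw [mul_inv_eq_iff_eq_mul]
  ext x
  rw [LinearEquiv.mul_apply, LinearEquiv.mul_apply, H.transv_eq h, H.transv_eq h', hg, hg]
  rw [map_sub, map_add, map_zsmul, map_smul, map_smul]

/-- Half of an element of `Λ` with `conj c = -ε c` yields the long root elements
`x ↦ x + ⟨x, u⟩ c u`. -/
theorem transv_self_apply {u : M} (hu : F u u = 0) {c d : Λ} (hd : d - ε • J d = c) (x : M) :
    transv ε F u (d • u) x = x + (F x u * c) • u := by
  rw [H.transv_eq (H.isoPair_smul_right ⟨hu, hu, hu⟩ d), H.smul_right, ← hd]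
  rcases H.eps with rfl | rfl <;> simp only [one_smul, neg_smul, mul_sub, mul_neg] <;>
  (simp only [sub_smul, mul_smul, neg_smul]; abel)

/-- The transvection is multiplicative in the first vector up to a long root element, which
appears if `⟨u', u⟩ ≠ 0`. -/
theorem transv_add_left {u u' w : M} (h : IsoPair F u w) (h' : IsoPair F u' w)
    (huu : F (u + u') (u + u') = 0) {half : Λ} (hh : half + half = 1)
    (hc : ∀ a, half * a = a * half) :
    transv ε F (u + u') w = transv ε F u w * transv ε F u' w *
      transv ε F w ((half * ε • F u' u) • w) := by
  have hJ : J half = half := by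
    have h1 : J half + J half = 1 := by rw [← H.J_add, hh, H.J_one]
    calc J half = (half + half) * J half := by rw [hh, one_mul]
      _ = half * (J half + J half) := by noncomm_ring
      _ = half := by rw [h1, mul_one]
  have hm : J (F u' u) = -(ε • F u' u) := by
    have : F u u' + F u' u = 0 := by
      rw [H.add_left, H.add_right, H.add_right, h.left, h'.left] at huu
      simpa using huu
    rw [H.symm u' u] at this
    have h2 := congrArg (fun y => ε • y) this
    simp only [smul_add, H.eps_smul_smul, smul_zero] at h2
    exact eq_neg_of_add_eq_zero_left h2
  have hk : (half * ε • F u' u) - ε • J (half * ε • F u' u) = ε • F u' u := by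
    rw [H.J_mul, hJ, H.J_eps, hm, smul_neg, H.eps_smul_smul, neg_mul, smul_neg, sub_neg_eq_add,
      ← hc, ← mul_smul_comm, ← add_mul, hh, one_mul]
  have e1 := H.orth_symm h.orth
  have e2 := H.orth_symm h'.orth
  ext x
  rw [LinearEquiv.mul_apply, LinearEquiv.mul_apply, H.transv_self_apply h.right hk,
    H.transv_eq h, H.transv_eq h',
    H.transv_eq ⟨huu, h.right, by rw [H.add_left, h.orth, h'.orth, add_zero]⟩]
  rcases H.eps with rfl | rfl <;>
  simp only [one_smul, neg_smul, H.add_left, H.sub_left, H.smul_left, H.add_right,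
    h'.orth, h.right, e1, e2, mul_zero, add_zero, sub_zero, sub_neg_eq_add] <;>
  (simp only [add_smul, sub_smul, smul_add, mul_smul, neg_smul, mul_neg]; abel)

/-- The commutator relation `[T(u, v), T(v', w)] = T(± u, w)` for a vector `v'` with
`⟨v', v⟩ = ± 1`. -/
theorem transv_commutator {u v v' w : M} {η : ℤ} (huv : IsoPair F u v) (hvw : IsoPair F v' w)
    (huw : F u w = 0) (huv' : F v' u = 0) (hvw' : F w v = 0) (hη : F v' v = η • (1 : Λ)) :
    transv ε F u v * transv ε F v' w * (transv ε F u v)⁻¹ * (transv ε F v' w)⁻¹ =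
      transv ε F ((-ε * η) • u) w := by
  have hvu := H.orth_symm huv.orth
  have hwu := H.orth_symm huw
  have huv'' := H.orth_symm huv'
  have hηu : ∀ {z : M}, F u z = 0 → F ((-ε * η) • u) z = 0 := fun {z} hz => by
    rw [← Int.cast_smul_eq_zsmul Λ, H.smul_left, hz, mul_zero]
  have hηu' : ∀ {z : M}, F z u = 0 → F z ((-ε * η) • u) = 0 := fun {z} hz =>
    H.orth_symm (hηu (H.orth_symm hz))
  have h1 : IsoPair F ((-ε * η) • u) w := ⟨hηu (hηu' huv.left), hvw.right, hηu huw⟩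
  have h2 : transv ε F u v v' = v' + (-ε * η) • u := by
    rw [H.transv_eq huv, huv', hη, zero_smul, add_zero, sub_eq_add_neg, smul_assoc, one_smul,
      mul_smul, neg_smul]
  have h3 : transv ε F u v w = w := by
    rw [H.transv_eq huv, hwu, hvw']; simp
  rw [H.conj_transv (H.transv_isometry huv) hvw, h2, h3, mul_inv_eq_iff_eq_mul]
  have h4 : IsoPair F (v' + (-ε * η) • u) w := ⟨by
    rw [H.add_left, H.add_right, H.add_right, hvw.left, hηu' huv', hηu huv'', hηu (hηu' huv.left)]
    simp, hvw.right, by rw [H.add_left, hvw.orth, hηu huw, add_zero]⟩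
  ext x
  rw [LinearEquiv.mul_apply, H.transv_eq h4, H.transv_eq h1, H.transv_eq hvw]
  rcases H.eps with rfl | rfl <;>
  simp only [one_smul, neg_smul, H.add_left, H.sub_left, H.smul_left, H.add_right,
    hvw.orth, hvw.right, hηu' huv', hηu' (H.orth_symm huw), mul_zero, add_zero,
    sub_zero, sub_neg_eq_add] <;>
  (simp only [add_smul, smul_add, mul_smul, neg_smul, smul_neg, neg_mul, neg_neg]; abel)

theorem transv_neg_neg {u w : M} (h : IsoPair F u w) :
    transv ε F (-u) (-w) = transv ε F u w := by
  have := H.transv_smul_left (H.isoPair_smul_right h (-1)) (-1)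
  simpa [H.J_neg, H.J_one] using this

end HermForm

end HermForm

/-! ### Frames and their elementary groups -/

section Frame

/-- The sign of an index of a hyperbolic basis: `1` for the first vector of a plane, `ε` for the
second. -/
def sgn (ε : ℤ) {m : ℕ} : Fin m ⊕ Fin m → ℤ
  | .inl _ => 1
  | .inr _ => ε

theorem sgn_mul {ε : ℤ} (h : ε * ε = 1) {m : ℕ} (k : Fin m ⊕ Fin m) :
    sgn ε k * sgn ε k = 1 := by cases k <;> simp [sgn, h]

theorem sgn_swap {ε : ℤ} (h : ε * ε = 1) {m : ℕ} (k : Fin m ⊕ Fin m) :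
    sgn ε k.swap = ε * sgn ε k := by cases k <;> simp [sgn, h]

theorem sum_swap_ne {m : ℕ} (k : Fin m ⊕ Fin m) : k.swap ≠ k := by cases k <;> simp

variable {Λ M M' : Type*} [Ring Λ] [AddCommGroup M] [Module Λ M] {m : ℕ}

/-- `b` is a hyperbolic basis of `M`: an orthogonal family of `m` hyperbolic pairs
`b (inl i), b (inr i)` which spans `M`. -/
structure IsFrame (ε : ℤ) (F : M → M → Λ) (b : Fin m ⊕ Fin m → M) : Prop where
  orth : ∀ k l, l ≠ k.swap → F (b k) (b l) = 0
  dual : ∀ k, F (b k) (b k.swap) = sgn ε k • (1 : Λ)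
  expand : ∀ x, x = ∑ k, sgn ε k • F x (b k.swap) • b k

/-- The elementary group of a family `b`, restricted to coefficients in `S`: generated by the
transvections `T(b k, c b l)` with `c ∈ S` and `l` not paired with `k`. -/
def rootGroup (ε : ℤ) (F : M → M → Λ) (b : Fin m ⊕ Fin m → M) (S : Set Λ) :
    Subgroup (M ≃ₗ[Λ] M) :=
  Subgroup.closure {τ | ∃ k l : Fin m ⊕ Fin m, l ≠ k.swap ∧ ∃ c ∈ S,
    τ = transv ε F (b k) (c • b l)}

theorem transv_mem_rootGroup {ε : ℤ} {F : M → M → Λ} {b : Fin m ⊕ Fin m → M} {S : Set Λ}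
    {k l : Fin m ⊕ Fin m} (h : l ≠ k.swap) {c : Λ} (hc : c ∈ S) :
    transv ε F (b k) (c • b l) ∈ rootGroup ε F b S :=
  Subgroup.subset_closure ⟨k, l, h, c, hc, rfl⟩

/-- The elementary group of `b` in terms of a family of root elements. -/
theorem rootGroup_eq_closure (ε : ℤ) (F : M → M → Λ) (b : Fin m ⊕ Fin m → M) (S : Set Λ) :
    rootGroup ε F b S = Subgroup.closure
      {g | ∃ α : {p : (Fin m ⊕ Fin m) × (Fin m ⊕ Fin m) // p.2 ≠ p.1.swap}, ∃ c ∈ S,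
        g = transv ε F (b α.1.1) (c • b α.1.2)} := by
  rw [rootGroup]
  congr 1
  ext g
  constructor
  · rintro ⟨k, l, h, c, hc, rfl⟩
    exact ⟨⟨(k, l), h⟩, c, hc, rfl⟩
  · rintro ⟨⟨⟨k, l⟩, h⟩, c, hc, rfl⟩
    exact ⟨k, l, h, c, hc, rfl⟩

/-- A decreasing sequence of additive subgroups of `Λ` that behaves like the sequence
`s ^ N • Λ₀`, where `Λ₀` is a subring of `Λ` whose localization at the central element `s` is `Λ`;
`σ N` takes the role of `s ^ N`. -/
structure IsFiltration (Φ : ℕ → AddSubgroup Λ) (σ : ℕ → Λ) : Prop where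
  anti : Antitone Φ
  mul_left : ∀ a N, ∃ N', ∀ c ∈ Φ N', a * c ∈ Φ N
  mul_right : ∀ a N, ∃ N', ∀ c ∈ Φ N', c * a ∈ Φ N
  mul_mem : ∀ N, ∀ c ∈ Φ N, ∀ d ∈ Φ N, c * d ∈ Φ N
  split : ∀ N, ∃ N', ∀ c ∈ Φ N', ∃ d ∈ Φ N, c = σ N * d
  sigma_mem : ∀ N, σ N ∈ Φ N

/-- Suppose that conjugation with a single root element maps all root elements of sufficiently
small coefficients to products of root elements of small coefficients. Then the same holds for
conjugation with a product of root elements. -/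
theorem exists_conj_mem {G ι : Type*} [Group G] [Finite ι] (x : ι → Λ → G)
    {Φ : ℕ → AddSubgroup Λ} (anti : Antitone Φ) (hinv : ∀ α a, (x α a)⁻¹ = x α (-a))
    (hconj : ∀ β a α N, ∃ N', ∀ c ∈ Φ N', x β a * x α c * (x β a)⁻¹ ∈
      Subgroup.closure {g | ∃ α, ∃ c ∈ Φ N, g = x α c})
    {γ : G} (hγ : γ ∈ Subgroup.closure {g | ∃ α, ∃ c ∈ (Set.univ : Set Λ), g = x α c}) :
    ∀ N, ∃ N', ∀ g ∈ Subgroup.closure {g | ∃ α, ∃ c ∈ Φ N', g = x α c},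
      γ * g * γ⁻¹ ∈ Subgroup.closure {g | ∃ α, ∃ c ∈ Φ N, g = x α c} := by
  have key : ∀ β a N, ∃ N', ∀ g ∈ Subgroup.closure {g | ∃ α, ∃ c ∈ Φ N', g = x α c},
      x β a * g * (x β a)⁻¹ ∈ Subgroup.closure {g | ∃ α, ∃ c ∈ Φ N, g = x α c} := by
    intro β a N
    choose f hf using fun α => hconj β a α N
    obtain ⟨K, hK⟩ : ∃ K, ∀ α, f α ≤ K := by
      have := Fintype.ofFinite ι
      exact ⟨Finset.univ.sup f, fun α => Finset.le_sup (Finset.mem_univ α)⟩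
    refine ⟨K, fun g hg => ?_⟩
    induction hg using Subgroup.closure_induction with
    | mem g h =>
      obtain ⟨α, c, hc, rfl⟩ := h
      exact hf α c (anti (hK α) hc)
    | one => simp
    | mul g g' _ _ h h' => simpa [mul_assoc] using mul_mem h h'
    | inv g _ h => simpa [mul_assoc] using inv_mem h
  induction hγ using Subgroup.closure_induction'' with
  | mem g h =>
    obtain ⟨β, a, -, rfl⟩ := h
    exact key β a
  | inv_mem g h =>
    obtain ⟨β, a, -, rfl⟩ := h
    rw [hinv]
    exact key β (-a)
  | one => exact fun N => ⟨N, fun g hg => by simpa using hg⟩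
  | mul g g' _ _ h h' =>
    intro N
    obtain ⟨N1, h1⟩ := h N
    obtain ⟨N2, h2⟩ := h' N1
    exact ⟨N2, fun k hk => by simpa [mul_assoc] using h1 _ (h2 k hk)⟩

namespace IsFrame

variable {ε : ℤ} {J : Λ → Λ} {F : M → M → Λ} {b : Fin m ⊕ Fin m → M}

theorem self (hb : IsFrame ε F b) (k : Fin m ⊕ Fin m) : F (b k) (b k) = 0 :=
  hb.orth k k (sum_swap_ne k).symm

theorem isoPair (hb : IsFrame ε F b) {k l : Fin m ⊕ Fin m} (h : l ≠ k.swap) :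
    IsoPair F (b k) (b l) :=
  ⟨hb.self k, hb.self l, hb.orth k l h⟩

variable (H : HermForm ε J F) (hb : IsFrame ε F b)
include H hb

theorem rootGroup_isometry {S : Set Λ} {g : M ≃ₗ[Λ] M} (hg : g ∈ rootGroup ε F b S) :
    ∀ x y, F (g x) (g y) = F x y := by
  induction hg using Subgroup.closure_induction with
  | mem g h =>
    obtain ⟨k, l, h, c, -, rfl⟩ := h
    exact H.transv_isometry (H.isoPair_smul_right (hb.isoPair h) c)
  | one => exact fun _ _ => rfl
  | mul g g' _ _ h h' =>
    exact fun x y => by rw [LinearEquiv.mul_apply, LinearEquiv.mul_apply, h, h']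
  | inv g _ h =>
      intro x y
      rw [← h, ← LinearEquiv.mul_apply, ← LinearEquiv.mul_apply, mul_inv_cancel]; rfl

/-- A transvection `T(u, σ c w)` is the commutator of two transvections that involve a hyperbolic
pair orthogonal to `u` and `w`. -/
theorem transv_eq_commutator {u w : M} (huw : IsoPair F u w) (i : Fin m ⊕ Fin m)
    (hui : F u (b i) = 0) (hui' : F u (b i.swap) = 0) (hwi : F w (b i) = 0)
    (hwi' : F w (b i.swap) = 0) {σ : Λ} (hσ : J σ = σ) (c : Λ) :
    transv ε F u ((σ * c) • w) =
      ⁅transv ε F u (σ • b i), transv ε F (b i.swap) (((-ε * sgn ε i.swap) • c) • w)⁆ := by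
  have h1 : IsoPair F u (b i) := ⟨huw.left, hb.self i, hui⟩
  have h2 : IsoPair F (b i.swap) w := ⟨hb.self _, huw.right, H.orth_symm hwi'⟩
  have hn : -ε * sgn ε i.swap = 1 ∨ -ε * sgn ε i.swap = -1 := by
    rcases H.eps with rfl | rfl <;> cases i <;> simp [sgn]
  set n := -ε * sgn ε i.swap with hndef
  have h3 := H.transv_commutator (u := σ • u) (v := b i) (v' := b i.swap) (w := (n • c) • w)
    (η := sgn ε i.swap) (H.isoPair_smul_left h1 σ) (H.isoPair_smul_right h2 _)
    (by rw [H.smul_left, H.smul_right, huw.orth]; simp)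
    (by rw [H.smul_right, H.orth_symm hui', zero_mul]) (by rw [H.smul_left, hwi, mul_zero])
    (by simpa using hb.dual i.swap)
  rw [← hndef, H.transv_smul_left h1, hσ] at h3
  rw [commutatorElement_def, h3, mul_smul]
  have h4 : IsoPair F u (c • w) := H.isoPair_smul_right huw c
  rcases hn with hn | hn
  · rw [hn, one_smul, one_smul, H.transv_smul_left h4, hσ]
  · rw [hn, neg_smul, neg_smul, one_smul, one_smul, neg_smul,
      H.transv_neg_neg (H.isoPair_smul_left h4 σ), H.transv_smul_left h4, hσ]

theorem root_add_mem {Φ : ℕ → AddSubgroup Λ} {σ : ℕ → Λ} (hΦ : IsFiltration Φ σ)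
    (hJ : ∀ N, ∀ c ∈ Φ N, J c ∈ Φ N) {half : Λ} (hh : half + half = 1)
    (hc : ∀ a, half * a = a * half) (k l r : Fin m ⊕ Fin m) (hkl : l ≠ k.swap) (hrl : l ≠ r.swap)
    (α : Λ) (N : ℕ) : ∃ N', ∀ c ∈ Φ N', F (b k + α • b r) (b k + α • b r) = 0 →
      transv ε F (b k + α • b r) (c • b l) ∈ rootGroup ε F b (Φ N : Set Λ) := by
  set κ := half * ε • F (α • b r) (b k) with hκ
  obtain ⟨N1, h1⟩ := hΦ.mul_left (J α) N
  obtain ⟨N2, h2⟩ := hΦ.mul_left κ N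
  refine ⟨N ⊔ N1 ⊔ N2, fun c hcΦ hiso => ?_⟩
  have m0 := hΦ.anti (le_sup_left.trans le_sup_left : N ≤ N ⊔ N1 ⊔ N2) hcΦ
  have m1 := hΦ.anti (le_sup_right.trans le_sup_left : N1 ≤ N ⊔ N1 ⊔ N2) hcΦ
  have m2 := hΦ.anti (le_sup_right : N2 ≤ N ⊔ N1 ⊔ N2) hcΦ
  have p1 := H.isoPair_smul_right (hb.isoPair hkl) c
  have p2 := H.isoPair_smul_right (hb.isoPair hrl) c
  have p3 := hb.isoPair (sum_swap_ne l).symm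
  rw [H.transv_add_left p1 (H.isoPair_smul_left p2 α) hiso hh hc, H.transv_smul_left p2, ← hκ,
    smul_smul, smul_smul, H.transv_smul_left (H.isoPair_smul_right p3 _), smul_smul]
  exact mul_mem (mul_mem (transv_mem_rootGroup hkl m0) (transv_mem_rootGroup hrl (h1 c m1)))
    (transv_mem_rootGroup (sum_swap_ne l).symm (hΦ.mul_mem _ _ (hJ _ _ m0) _ (h2 c m2)))

theorem root_conj_mem_of_ne {Φ : ℕ → AddSubgroup Λ} {σ : ℕ → Λ} (hΦ : IsFiltration Φ σ)
    (hJ : ∀ N, ∀ c ∈ Φ N, J c ∈ Φ N) {half : Λ} (hh : half + half = 1)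
    (hc : ∀ a, half * a = a * half) (p q k l : Fin m ⊕ Fin m) (hpq : q ≠ p.swap)
    (hkl : l ≠ k.swap) (hpl : l ≠ p.swap) (hql : l ≠ q.swap) (a : Λ) (N : ℕ) :
    ∃ N', ∀ c ∈ Φ N', transv ε F (b p) (a • b q) * transv ε F (b k) (c • b l) *
      (transv ε F (b p) (a • b q))⁻¹ ∈ rootGroup ε F b (Φ N : Set Λ) := by
  have hp := H.isoPair_smul_right (hb.isoPair hpq) a
  have hgl : transv ε F (b p) (a • b q) (b l) = b l := by
    rw [H.transv_eq hp, hb.orth l p (fun h => hpl (by simp [h])), H.smul_right,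
      hb.orth l q (fun h => hql (by simp [h]))]
    simp
  have hconj : ∀ c, transv ε F (b p) (a • b q) * transv ε F (b k) (c • b l) *
      (transv ε F (b p) (a • b q))⁻¹ =
        transv ε F (transv ε F (b p) (a • b q) (b k)) (c • b l) := fun c => by
    rw [H.conj_transv (H.transv_isometry hp) (H.isoPair_smul_right (hb.isoPair hkl) c), map_smul,
      hgl]
  obtain ⟨r, α, hr, hα⟩ : ∃ r α, l ≠ Sum.swap r ∧
      transv ε F (b p) (a • b q) (b k) = b k + α • b r := by
    rw [H.transv_eq hp, H.smul_right]
    by_cases h1 : p = k.swap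
    · by_cases h2 : q = p
      · refine ⟨p, F (b k) (b p) * a - ε • (F (b k) (b p) * J a), hpl, ?_⟩
        rw [h2, smul_smul, sub_smul, smul_assoc, add_sub_assoc]
      · refine ⟨q, F (b k) (b p) * a, hql, ?_⟩
        rw [hb.orth k q (fun h => h2 (h.trans h1.symm)), smul_smul]
        simp
    · refine ⟨p, -(ε • (F (b k) (b q) * J a)), hpl, ?_⟩
      rw [hb.orth k p h1, neg_smul, smul_assoc]
      simp [sub_eq_add_neg]
  obtain ⟨N', hN'⟩ := hb.root_add_mem H hΦ hJ hh hc k l r hkl hr α N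
  refine ⟨N', fun c hc => ?_⟩
  rw [hconj, hα]
  exact hN' c hc (by rw [← hα, H.transv_isometry hp, hb.self])

/-- Conjugation with an element of the elementary group of a hyperbolic basis of at least three
planes maps products of root elements of sufficiently small coefficients to products of root
elements of small coefficients. -/
theorem rootGroup_conj (hm : 3 ≤ m) {Φ : ℕ → AddSubgroup Λ} {σ : ℕ → Λ}
    (hΦ : IsFiltration Φ σ) (hJ : ∀ N, ∀ c ∈ Φ N, J c ∈ Φ N) (hJσ : ∀ N, J (σ N) = σ N)
    {half : Λ} (hh : half + half = 1) (hc : ∀ a, half * a = a * half)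
    {γ : M ≃ₗ[Λ] M} (hγ : γ ∈ rootGroup ε F b Set.univ) (N : ℕ) :
    ∃ N', ∀ g ∈ rootGroup ε F b (Φ N' : Set Λ), γ * g * γ⁻¹ ∈ rootGroup ε F b (Φ N : Set Λ) := by
  have hx := rootGroup_eq_closure ε F b
  -- If only `k` may be paired with `p` or `q`, or only `l`, conjugation is computed directly.
  have hdir : ∀ (p q k l : Fin m ⊕ Fin m), q ≠ p.swap → l ≠ k.swap →
      (l ≠ p.swap ∧ l ≠ q.swap ∨ k ≠ p.swap ∧ k ≠ q.swap) → ∀ (a : Λ) (N : ℕ), ∃ N', ∀ c ∈ Φ N',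
      transv ε F (b p) (a • b q) * transv ε F (b k) (c • b l) *
      (transv ε F (b p) (a • b q))⁻¹ ∈ rootGroup ε F b (Φ N : Set Λ) := by
    rintro p q k l hpq hkl (⟨h1, h2⟩ | ⟨h1, h2⟩) a N
    · exact hb.root_conj_mem_of_ne H hΦ hJ hh hc p q k l hpq hkl h1 h2 a N
    · have hlk : k ≠ l.swap := fun h => hkl (by simp [h])
      obtain ⟨N', h⟩ := hb.root_conj_mem_of_ne H hΦ hJ hh hc p q l k hpq hlk h1 h2 a N
      refine ⟨N', fun c hc => ?_⟩
      rw [H.transv_smul_swap (hb.isoPair hkl)]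
      refine h _ ?_
      have := hJ _ c hc
      exact zsmul_mem (hJ _ c hc) _
  simp only [hx] at hγ ⊢
  refine exists_conj_mem _ hΦ.anti (fun α a => ?_) ?_ hγ N
  · have := H.transv_inv (H.isoPair_smul_right (hb.isoPair α.2) a)
    simpa only [neg_smul] using this
  · rintro ⟨⟨p, q⟩, hpq⟩ a ⟨⟨k, l⟩, hkl⟩ N
    dsimp only at hpq hkl
    have hxN := hx (Φ N : Set Λ)
    simp only [SetLike.mem_coe] at hxN
    rw [← hxN]
    by_cases hopp : (l ≠ p.swap ∧ l ≠ q.swap ∨ k ≠ p.swap ∧ k ≠ q.swap)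
    · exact hdir p q k l hpq hkl hopp a N
    -- Otherwise the root element is written as a commutator by means of a third plane.
    obtain ⟨i, hi1, hi2, hi3, hi4⟩ : ∃ i : Fin m ⊕ Fin m,
        i ≠ p ∧ i ≠ p.swap ∧ i ≠ q ∧ i ≠ q.swap := by
      obtain ⟨i, hi⟩ : ∃ i : Fin m,
          i ∉ ({Sum.elim id id p, Sum.elim id id q} : Finset (Fin m)) := by
        apply Finset.exists_mem_notMem_of_card_lt_card (s := _) (t := Finset.univ) _ |>.imp
        · exact fun _ h => h.2
        · exact Finset.card_le_two.trans_lt (by rw [Finset.card_univ, Fintype.card_fin]; omega)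
      rw [Finset.mem_insert, Finset.mem_singleton, not_or] at hi
      have h1 : ∀ r : Fin m ⊕ Fin m, .inl i = r → i = Sum.elim id id r := by rintro _ rfl; rfl
      have h2 : ∀ r : Fin m ⊕ Fin m, .inl i = r.swap → i = Sum.elim id id r := by
        intro r h
        rw [← Sum.swap_swap r, ← h]
        rfl
      exact ⟨.inl i, fun h => hi.1 (h1 p h), fun h => hi.1 (h2 p h), fun h => hi.2 (h1 q h),
        fun h => hi.2 (h2 q h)⟩
    have hkk : k = p.swap ∨ k = q.swap := by tauto
    have hll : l = p.swap ∨ l = q.swap := by tauto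
    have e1 : i ≠ k.swap := by rcases hkk with rfl | rfl <;> simpa
    have e2 : i ≠ k := by rcases hkk with rfl | rfl <;> simpa
    have e3 : i ≠ l.swap := by rcases hll with rfl | rfl <;> simpa
    have e4 : i ≠ l := by rcases hll with rfl | rfl <;> simpa
    have sw : ∀ {i j : Fin m ⊕ Fin m}, i ≠ j.swap → i.swap ≠ j := fun h h' => h (by simp [← h'])
    have sw' : ∀ {i j : Fin m ⊕ Fin m}, i ≠ j → i.swap ≠ j.swap := fun h h' =>
      h (Sum.swap_leftInverse.injective h')
    obtain ⟨N1, h1⟩ := hdir p q k i hpq e1 (.inl ⟨hi2, hi4⟩) a N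
    obtain ⟨N2, h2⟩ := hdir p q i.swap l hpq (by simpa using e4.symm)
      (.inr ⟨sw' hi1, sw' hi3⟩) a N
    obtain ⟨N3, h3⟩ := hΦ.split (N1 ⊔ N2)
    refine ⟨N3, fun c hcΦ => ?_⟩
    obtain ⟨d, hd, rfl⟩ := h3 c hcΦ
    change transv ε F (b p) (a • b q) * transv ε F (b k) ((σ (N1 ⊔ N2) * d) • b l) *
      (transv ε F (b p) (a • b q))⁻¹ ∈ _
    rw [hb.transv_eq_commutator H (hb.isoPair hkl) i (hb.orth _ _ e1)
      (hb.orth _ _ (sw' e2)) (hb.orth _ _ e3) (hb.orth _ _ (sw' e4)) (hJσ _) d]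
    have g1 := h1 (σ (N1 ⊔ N2)) (hΦ.anti le_sup_left (hΦ.sigma_mem _))
    have g2 := h2 ((-ε * sgn ε i.swap) • d) (hΦ.anti le_sup_right (zsmul_mem hd _))
    rw [conjugate_commutatorElement]
    rw [commutatorElement_def]
    exact mul_mem (mul_mem (mul_mem g1 g2) (inv_mem g1)) (inv_mem g2)

end IsFrame

end Frame

/-! ### Principal ideals of semisimple algebras -/

section Semisimple

/-- Semisimple rings are von Neumann regular. -/
theorem exists_mul_self_mul {D : Type*} [Ring D] [IsSemisimpleRing D] (w : D) :
    ∃ y, w * y * w = w := by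
  obtain ⟨C, hC⟩ := exists_isCompl (Ideal.span {w})
  have h1 : (1 : D) ∈ Ideal.span {w} ⊔ C := by rw [hC.sup_eq_top]; trivial
  obtain ⟨e, he, f, hf, hef⟩ := Submodule.mem_sup.1 h1
  obtain ⟨y, rfl⟩ := Ideal.mem_span_singleton'.1 he
  refine ⟨y, ?_⟩
  have h2 : w * f = w - w * y * w := by
    rw [eq_sub_iff_add_eq, mul_assoc, ← mul_add, add_comm f, hef, mul_one]
  have h3 : w * f ∈ Ideal.span {w} ⊓ C :=
    ⟨Ideal.mem_span_singleton'.2 ⟨1 - w * y, by rw [h2, sub_mul, one_mul]⟩, C.smul_mem w hf⟩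
  rw [hC.inf_eq_bot, Submodule.mem_bot, h2, sub_eq_zero] at h3
  exact h3.symm

/-- If `b` is not in the left ideal generated by `w`, then this ideal can be enlarged by adding a
multiple of `b` to `w`. -/
theorem exists_span_lt (k : Type*) {D : Type*} [Field k] [Ring D] [Algebra k D]
    [Module.Finite k D] [IsSemisimpleRing D] (w b : D) (hb : b ∉ Ideal.span {w}) :
    ∃ c, Ideal.span {w} < Ideal.span {w + c * b} := by
  set W := Ideal.span {w}
  set B := Ideal.span {b}
  -- A nonzero left ideal `T` in `D b` which meets `D w` trivially.
  obtain ⟨C, hC⟩ := exists_isCompl (W ⊓ B)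
  set T := C ⊓ B with hT
  have hTW : Disjoint T W := by
    rw [disjoint_iff, eq_bot_iff, ← hC.inf_eq_bot]
    exact fun x hx => ⟨⟨hx.2, hx.1.2⟩, hx.1.1⟩
  have hT0 : T ≠ ⊥ := by
    intro h0
    have h1 : B ≤ (W ⊓ B) ⊔ C ⊓ B := by
      rw [← sup_inf_assoc_of_le C inf_le_right, hC.sup_eq_top, top_inf_eq]
    rw [← hT, h0, sup_bot_eq] at h1
    exact hb (h1 (Ideal.mem_span_singleton_self b)).1
  obtain ⟨y, hy⟩ := exists_mul_self_mul w
  have hwW : w ∈ W := Ideal.mem_span_singleton_self w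
  -- Multiplication with `w` is not injective on `T`, hence not surjective.
  obtain ⟨t₁, ht₁, ht₁'⟩ : ∃ t₁ ∈ T, ∀ t ∈ T, w * t ≠ t₁ := by
    by_contra! hsurj
    let f : T.restrictScalars k →ₗ[k] T.restrictScalars k :=
      (LinearMap.mulLeft k w).restrict (fun x hx => T.smul_mem w hx)
    have hf : Function.Surjective f := by
      rintro ⟨t, ht⟩
      obtain ⟨t', ht', h⟩ := hsurj t ht
      exact ⟨⟨t', ht'⟩, Subtype.ext h⟩
    have hf' := LinearMap.injective_iff_surjective.2 hf
    obtain ⟨Z, hWZ, hZ⟩ := hTW.symm.exists_isCompl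
    have h1 : (1 : D) ∈ Z ⊔ T := by rw [hZ.sup_eq_top]; trivial
    obtain ⟨z, hz, t, ht, hzt⟩ := Submodule.mem_sup.1 h1
    have h2 : w * t = w - w * z := by rw [eq_sub_iff_add_eq, ← mul_add, add_comm, hzt, mul_one]
    have h3 : w * t ∈ Z ⊓ T :=
      ⟨by rw [h2]; exact Z.sub_mem (hWZ hwW) (Z.smul_mem w hz), T.smul_mem w ht⟩
    rw [hZ.inf_eq_bot, Submodule.mem_bot] at h3
    have h4 : (⟨t, ht⟩ : T.restrictScalars k) = 0 :=
      hf' ((Subtype.ext h3 : f ⟨t, ht⟩ = 0).trans (map_zero f).symm)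
    have h5 : t = 0 := congrArg Subtype.val h4
    rw [h5, add_zero] at hzt
    have h6 : Z = ⊤ := (Ideal.eq_top_iff_one Z).2 (hzt ▸ hz)
    exact hT0 (by simpa [h6] using hZ.inf_eq_bot)
  -- Hence some element of the annihilator of `w` does not annihilate `t₁`.
  have hne : (1 - w * y) * t₁ ≠ 0 := by
    intro h0
    refine ht₁' (y * t₁) (T.smul_mem y ht₁) ?_
    rw [sub_mul, one_mul, sub_eq_zero] at h0
    rw [← mul_assoc, ← h0]
  have hk : (1 - w * y) * w = 0 := by rw [sub_mul, one_mul, hy, sub_self]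
  have heT : (1 - w * y) * t₁ ∈ T := T.smul_mem _ ht₁
  obtain ⟨c, hc⟩ := Ideal.mem_span_singleton'.1 heT.2
  refine ⟨c, lt_of_le_of_ne ?_ ?_⟩
  · rw [Ideal.span_singleton_le_iff_mem, Ideal.mem_span_singleton', hc]
    refine ⟨w * y, ?_⟩
    rw [mul_add, hy, ← mul_assoc, mul_sub, mul_one, ← mul_assoc (w * y), hy, sub_self, zero_mul,
      add_zero]
  · intro heq
    have h1 : (1 - w * y) * (w + c * b) ∈ W := by
      rw [heq]
      exact Ideal.mul_mem_left _ _ (Ideal.mem_span_singleton_self _)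
    have hidem : (1 - w * y) * (1 - w * y) = 1 - w * y := by
      rw [mul_sub, mul_one, ← mul_assoc, hk, zero_mul, sub_zero]
    rw [mul_add, hk, zero_add, hc, ← mul_assoc, hidem] at h1
    exact hne (by simpa using hTW.le_bot ⟨heT, h1⟩)

/-- In a finite-dimensional semisimple algebra, `a + c b` generates the left ideal generated by
`a` and `b`, for a suitable `c`. -/
theorem exists_left_generator (k : Type*) {D : Type*} [Field k] [Ring D] [Algebra k D]
    [Module.Finite k D] [IsSemisimpleRing D] (a b : D) :
    ∃ c d d', a = d * (a + c * b) ∧ b = d' * (a + c * b) := by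
  have hwf : WellFoundedGT (Ideal D) := inferInstanceAs (WellFoundedGT (Submodule D D))
  obtain ⟨I, ⟨c, rfl⟩, hI⟩ := hwf.wf.has_min (Set.range fun c => Ideal.span {a + c * b})
    ⟨_, 0, rfl⟩
  have hb : b ∈ Ideal.span {a + c * b} := by
    by_contra hb
    obtain ⟨c', hc'⟩ := exists_span_lt k _ _ hb
    refine hI _ ⟨c + c', rfl⟩ ?_
    simpa [add_mul, add_assoc] using hc'
  have ha : a ∈ Ideal.span {a + c * b} := by
    have := Ideal.sub_mem _ (Ideal.mem_span_singleton_self (a + c * b)) (Ideal.mul_mem_left _ c hb)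
    simpa using this
  obtain ⟨d, hd⟩ := Ideal.mem_span_singleton'.1 ha
  obtain ⟨d', hd'⟩ := Ideal.mem_span_singleton'.1 hb
  exact ⟨c, d, d', hd.symm, hd'.symm⟩

theorem exists_right_generator (k : Type*) {D : Type*} [Field k] [Ring D] [Algebra k D]
    [Module.Finite k D] [IsSemisimpleRing D] (a b : D) :
    ∃ c d d', a = (a + b * c) * d ∧ b = (a + b * c) * d' := by
  have : IsSemisimpleRing Dᵐᵒᵖ := isSemisimpleRing_mulOpposite_iff.2 inferInstance
  have : Module.Finite k Dᵐᵒᵖ := Module.Finite.equiv (MulOpposite.opLinearEquiv k)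
  obtain ⟨c, d, d', h, h'⟩ := exists_left_generator k (MulOpposite.op a) (MulOpposite.op b)
  refine ⟨c.unop, d.unop, d'.unop, ?_, ?_⟩
  · simpa using congrArg MulOpposite.unop h
  · simpa using congrArg MulOpposite.unop h'

end Semisimple

/-! ### Reduction modulo a maximal ideal -/

section Residue

theorem exists_right_generator_mod_jacobson (k : Type*) {K : Type*} [Field k] [Ring K] [Algebra k K]
    [Module.Finite k K] (a b : K) : ∃ c d d', a - (a + b * c) * d ∈ Ring.jacobson K ∧
      b - (a + b * c) * d' ∈ Ring.jacobson K := by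
  have : IsArtinianRing K := IsArtinianRing.of_finite k K
  have : Module.Finite k (K ⧸ Ring.jacobson K) := Module.Finite.of_surjective
    (Ideal.Quotient.mkₐ k (Ring.jacobson K)).toLinearMap Ideal.Quotient.mk_surjective
  obtain ⟨c, d, d', h, h'⟩ := exists_right_generator k
    (Ideal.Quotient.mk (Ring.jacobson K) a) (Ideal.Quotient.mk (Ring.jacobson K) b)
  obtain ⟨c, rfl⟩ := Ideal.Quotient.mk_surjective c
  obtain ⟨d, rfl⟩ := Ideal.Quotient.mk_surjective d
  obtain ⟨d', rfl⟩ := Ideal.Quotient.mk_surjective d'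
  exact ⟨c, d, d', (Ideal.Quotient.mk_eq_mk_iff_sub_mem _ _).1 (by simpa using h),
    (Ideal.Quotient.mk_eq_mk_iff_sub_mem _ _).1 (by simpa using h')⟩

theorem isUnit_of_mul_sub_one_mem_jacobson {K : Type*} [Ring K] [IsArtinianRing K] {x y : K}
    (h : x * y - 1 ∈ Ring.jacobson K) : IsUnit x := by
  obtain ⟨n, hn⟩ := IsSemiprimaryRing.isNilpotent (R := K)
  have h1 : IsNilpotent (x * y - 1) := ⟨n, by
    have := Ideal.pow_mem_pow h n
    rwa [hn] at this⟩
  have h2 : IsUnit (x * y) := by simpa using h1.isUnit_one_add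
  obtain ⟨z, hz⟩ := h2.exists_right_inv
  rw [mul_assoc] at hz
  exact IsUnit.of_mul_eq_one _ hz

/-- Modulo a maximal ideal `𝔪` of `S`, a finite `S`-algebra has a semisimple quotient, in which
every finitely generated right ideal is principal with a generator of a special form; this quotient
detects the elements that become right invertible after inverting some element outside `𝔪`. -/
theorem exists_semisimple_residue (S : Type*) {Λ : Type*} [CommRing S] [Ring Λ] [Algebra S Λ]
    [Module.Finite S Λ] (𝔪 : Ideal S) [h𝔪 : 𝔪.IsMaximal] :
    ∃ I : Ideal Λ, I.IsTwoSided ∧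
      (∀ a b : Λ, ∃ c d d', a - (a + b * c) * d ∈ I ∧ b - (a + b * c) * d' ∈ I) ∧
      ∀ x y : Λ, x * y - 1 ∈ I → ∃ t ∉ 𝔪, ∃ z, x * z = algebraMap S Λ t := by
  let _ : Field (S ⧸ 𝔪) := Ideal.Quotient.field 𝔪
  have : IsArtinianRing ((S ⧸ 𝔪) ⊗[S] Λ) := IsArtinianRing.of_finite (S ⧸ 𝔪) _
  let f : Λ →ₐ[S] (S ⧸ 𝔪) ⊗[S] Λ := Algebra.TensorProduct.includeRight
  have hf : Function.Surjective f := fun z => by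
    induction z using TensorProduct.induction_on with
    | zero => exact ⟨0, map_zero f⟩
    | tmul r x =>
      obtain ⟨r, rfl⟩ := Ideal.Quotient.mk_surjective r
      refine ⟨r • x, ?_⟩
      change (1 : S ⧸ 𝔪) ⊗ₜ[S] (r • x) = _
      rw [← TensorProduct.smul_tmul, Algebra.smul_def, mul_one]
      rfl
    | add x y hx hy =>
      obtain ⟨x, rfl⟩ := hx
      obtain ⟨y, rfl⟩ := hy
      exact ⟨x + y, map_add f x y⟩
  have hker : ∀ z, f z = 0 → z ∈ 𝔪 • (⊤ : Submodule S Λ) := fun z hz => by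
    have h1 : TensorProduct.quotTensorEquivQuotSMul Λ 𝔪 (f z) = Submodule.Quotient.mk z := by
      change TensorProduct.quotTensorEquivQuotSMul Λ 𝔪 ((Ideal.Quotient.mk 𝔪 1) ⊗ₜ z) = _
      rw [TensorProduct.quotTensorEquivQuotSMul_mk_tmul, one_smul]
    rw [hz, map_zero, eq_comm, Submodule.Quotient.mk_eq_zero] at h1
    exact h1
  -- Nakayama's lemma.
  have hnak : ∀ N : Submodule S Λ, (∀ z, ∃ z' ∈ N, f z = f z') →
      ∃ t, t - 1 ∈ 𝔪 ∧ algebraMap S Λ t ∈ N := fun N hN => by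
    obtain ⟨t, ht, h⟩ := Submodule.exists_sub_one_mem_and_smul_le_of_fg_of_le_sup
      (I := 𝔪) (N := N) (N' := ⊤) (P := ⊤) Module.Finite.fg_top le_rfl (fun z _ => by
        obtain ⟨z', hz', e⟩ := hN z
        rw [← sub_eq_zero, ← map_sub] at e
        exact Submodule.mem_sup.2 ⟨z', hz', z - z', hker _ e, by abel⟩)
    refine ⟨t, ht, h ?_⟩
    rw [Algebra.algebraMap_eq_smul_one]
    exact Submodule.smul_mem_pointwise_smul 1 t ⊤ trivial
  refine ⟨(Ring.jacobson ((S ⧸ 𝔪) ⊗[S] Λ)).comap f.toRingHom, inferInstance, fun a b => ?_,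
    fun x y hxy => ?_⟩
  · obtain ⟨c, d, d', h, h'⟩ := exists_right_generator_mod_jacobson (S ⧸ 𝔪) (f a) (f b)
    obtain ⟨c, rfl⟩ := hf c
    obtain ⟨d, rfl⟩ := hf d
    obtain ⟨d', rfl⟩ := hf d'
    exact ⟨c, d, d', by simpa [Ideal.mem_comap] using h, by simpa [Ideal.mem_comap] using h'⟩
  · have hu : IsUnit (f x) := isUnit_of_mul_sub_one_mem_jacobson (y := f y)
      (by simpa [Ideal.mem_comap] using hxy)
    obtain ⟨v, hv⟩ := hu.exists_right_inv
    obtain ⟨v, rfl⟩ := hf v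
    obtain ⟨t, ht, z, hz⟩ := hnak (LinearMap.range (LinearMap.mulLeft S x)) fun z =>
      ⟨x * (v * z), ⟨v * z, rfl⟩, by rw [map_mul, map_mul, ← mul_assoc, hv, one_mul]⟩
    exact ⟨t, fun h => h𝔪.ne_top ((Ideal.eq_top_iff_one 𝔪).2 (by simpa using 𝔪.sub_mem h ht)),
      z, hz⟩

end Residue

/-! ### Moving a hyperbolic pair into a hyperbolic basis -/

section Reduction

variable {Λ : Type*} [Ring Λ] {m : ℕ}

/-- The set `Z` of coordinate vectors is closed under root elements: one may add a right multiple of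
the coordinate `k` to the coordinate `q`, at the cost of adding a multiple of the coordinate `q'` to
the coordinate `k'`. -/
def ClosedUnderRoots (Z : Set (Fin m ⊕ Fin m → Λ)) : Prop :=
  ∀ z ∈ Z, ∀ k q : Fin m ⊕ Fin m, q ≠ k → q ≠ k.swap → ∀ a : Λ, ∃ z' ∈ Z,
    z' q = z q + z k * a ∧ (∃ c, z' k.swap = z k.swap + z q.swap * c) ∧
    ∀ r, r ≠ q → r ≠ k.swap → z' r = z r

variable {I : Ideal Λ} [I.IsTwoSided]
  (hreg : ∀ a b : Λ, ∃ c d d', a - (a + b * c) * d ∈ I ∧ b - (a + b * c) * d' ∈ I)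
  {Z : Set (Fin m ⊕ Fin m → Λ)} (hZ : ClosedUnderRoots Z)
include hreg hZ

omit [I.IsTwoSided] in
/-- The coordinate `q` can be absorbed by the coordinate `p`, modulo `I`. -/
theorem exists_absorb {z : Fin m ⊕ Fin m → Λ} (hz : z ∈ Z) (p q : Fin m ⊕ Fin m) (h : q ≠ p)
    (h' : q ≠ p.swap) : ∃ z' ∈ Z, z' q ∈ I ∧
      (∃ c c', z' p.swap = z p.swap + z q.swap * c + z p.swap * c') ∧
      (∃ c, z' q.swap = z q.swap + z p.swap * c) ∧
      ∀ r, r ≠ p → r ≠ q → r ≠ p.swap → r ≠ q.swap → z' r = z r := by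
  have sw : ∀ {i j : Fin m ⊕ Fin m}, i ≠ j.swap → j ≠ i.swap := fun h h' => h (by simp [h'])
  have sw' : ∀ {i j : Fin m ⊕ Fin m}, i ≠ j → i.swap ≠ j.swap := fun h h' =>
    h (Sum.swap_leftInverse.injective h')
  obtain ⟨c, d, d', -, hd'⟩ := hreg (z p) (z q)
  obtain ⟨z₁, hz₁, a1, ⟨c₁, a2⟩, a3⟩ := hZ z hz q p h.symm (sw h') c
  obtain ⟨z₂, hz₂, b1, ⟨c₂, b2⟩, b3⟩ := hZ z₁ hz₁ p q h h' (-d')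
  refine ⟨z₂, hz₂, ?_, ⟨c₂, c₁ * c₂, ?_⟩, ⟨c₁, ?_⟩, fun r h1 h2 h3 h4 => ?_⟩
  · rw [b1, a1, a3 q h (sum_swap_ne q).symm, mul_neg, ← sub_eq_add_neg]
    exact hd'
  · rw [b2, a2, a3 _ (sum_swap_ne p) (sw' h.symm), add_mul, mul_assoc, add_assoc]
  · rw [b3 _ (sum_swap_ne q) (sw' h), a2]
  · rw [b3 _ h2 h3, a3 _ h1 h4]

/-- Suppose that right ideals with two generators are principal modulo `I`, in the form `hreg`. Then
a set of unimodular coordinate vectors which is closed under root elements contains a vector whose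
coordinate `inl i₀` is right invertible modulo `I`: the other coordinates are absorbed or made zero
one after the other, and the last two of them are absorbed after copies of them have been placed in
coordinates which are not paired with `inl i₀`. -/
theorem exists_right_unit (hm : 3 ≤ m) (hne : Z.Nonempty)
    (huni : ∀ z ∈ Z, ∃ y : Fin m ⊕ Fin m → Λ, ∑ k, z k * y k = 1) (i₀ : Fin m) :
    ∃ z ∈ Z, ∃ y, z (.inl i₀) * y - 1 ∈ I := by
  obtain ⟨i₁, i₂, h10, h20, h21⟩ : ∃ i₁ i₂ : Fin m, i₁ ≠ i₀ ∧ i₂ ≠ i₀ ∧ i₂ ≠ i₁ := by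
    obtain ⟨i₁, h1⟩ : ∃ i, i ∉ ({i₀} : Finset (Fin m)) := by
      by_contra! h
      have := Finset.card_le_card (fun i _ => h i : Finset.univ ⊆ ({i₀} : Finset (Fin m)))
      simp at this
      omega
    obtain ⟨i₂, h2⟩ : ∃ i, i ∉ ({i₀, i₁} : Finset (Fin m)) := by
      by_contra! h
      have := (Finset.card_le_card
        (fun i _ => h i : Finset.univ ⊆ ({i₀, i₁} : Finset (Fin m)))).trans Finset.card_le_two
      simp at this
      omega
    simp only [Finset.mem_insert, Finset.mem_singleton, not_or] at h1 h2
    exact ⟨i₁, i₂, h1, h2.1, h2.2⟩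
  -- The coordinates `inl i` with `i ≠ i₀` are made zero modulo `I`.
  have s1 : ∀ s : Finset (Fin m), i₀ ∉ s → ∃ z ∈ Z, ∀ i ∈ s, z (.inl i) ∈ I := by
    intro s
    induction s using Finset.induction_on with
    | empty =>
      obtain ⟨z, hz⟩ := hne
      exact fun _ => ⟨z, hz, by simp⟩
    | insert a s ha ih =>
      intro h0
      rw [Finset.mem_insert, not_or] at h0
      obtain ⟨z, hz, h⟩ := ih h0.2
      obtain ⟨z', hz', h1, -, -, h2⟩ := exists_absorb hreg hZ hz (.inl i₀) (.inl a)
        (by simpa using Ne.symm h0.1) (by simp)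
      refine ⟨z', hz', fun i hi => ?_⟩
      rcases Finset.mem_insert.1 hi with rfl | hi
      · exact h1
      · rw [h2 _ (by rintro ⟨⟩; exact h0.2 hi) (by rintro ⟨⟩; exact ha hi) (by simp) (by simp)]
        exact h i hi
  -- Next, the coordinates `inr i` with `i ≠ i₀, i₁`.
  have s2 : ∀ s : Finset (Fin m), i₀ ∉ s → i₁ ∉ s → ∃ z ∈ Z, (∀ i, i ≠ i₀ → z (.inl i) ∈ I) ∧
      ∀ i ∈ s, z (.inr i) ∈ I := by
    intro s
    induction s using Finset.induction_on with
    | empty =>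
      intro _ _
      obtain ⟨z, hz, h⟩ := s1 (Finset.univ.erase i₀) (by simp)
      exact ⟨z, hz, fun i hi => h i (by simp [hi]), by simp⟩
    | insert a s ha ih =>
      intro h0 h1
      rw [Finset.mem_insert, not_or] at h0 h1
      obtain ⟨z, hz, h, h'⟩ := ih h0.2 h1.2
      obtain ⟨z', hz', h2, ⟨c, c', h3⟩, ⟨c'', h4⟩, h5⟩ :=
        exists_absorb hreg hZ hz (.inr i₁) (.inr a) (by simpa using Ne.symm h1.1) (by simp)
      rw [Sum.swap_inr, Sum.swap_inr] at h3 h4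
      have e1 := h _ h10
      have e2 := h _ (Ne.symm h0.1)
      refine ⟨z', hz', fun i hi => ?_, fun i hi => ?_⟩
      · by_cases hi1 : i = i₁
        · rw [hi1, h3]
          exact I.add_mem (I.add_mem e1 (I.mul_mem_right _ e2)) (I.mul_mem_right _ e1)
        by_cases hia : i = a
        · rw [hia, h4]
          exact I.add_mem e2 (I.mul_mem_right _ e1)
        · rw [h5 _ (by simp) (by simp) (by simpa using hi1) (by simpa using hia)]
          exact h i hi
      · rcases Finset.mem_insert.1 hi with rfl | hi
        · exact h2
        · rw [h5 _ (by rintro ⟨⟩; exact h1.2 hi) (by rintro ⟨⟩; exact ha hi) (by simp) (by simp)]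
          exact h' i hi
  obtain ⟨z, hz, hl, hr⟩ := s2 ((Finset.univ.erase i₀).erase i₁) (by simp) (by simp)
  replace hr : ∀ i, i ≠ i₀ → i ≠ i₁ → z (.inr i) ∈ I := fun i h h' => hr i (by simp [h, h'])
  -- The coordinates `inr i₁` and `inr i₀` are copied to `inl i₂` and `inl i₁`.
  obtain ⟨z₁, hz₁, a1, ⟨c₁, a2⟩, a3⟩ := hZ z hz (.inr i₁) (.inl i₂) (by simp) (by simpa using h21) 1
  rw [Sum.swap_inr, Sum.swap_inl] at a2
  obtain ⟨z₂, hz₂, b1, ⟨c₂, b2⟩, b3⟩ := hZ z₁ hz₁ (.inr i₀) (.inl i₁) (by simp)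
    (by simpa using h10) 1
  rw [Sum.swap_inr, Sum.swap_inl] at b2
  obtain ⟨c₃, d₃, d₃', e3, e3'⟩ := hreg (z₂ (.inl i₀)) (z₂ (.inl i₁))
  obtain ⟨z₃, hz₃, f1, -, f3⟩ := hZ z₂ hz₂ (.inl i₁) (.inl i₀) (by simpa using h10.symm)
    (by simp) c₃
  obtain ⟨c₄, d₄, d₄', e4, e4'⟩ := hreg (z₃ (.inl i₀)) (z₃ (.inl i₂))
  obtain ⟨z₄, hz₄, g1, -, g3⟩ := hZ z₃ hz₃ (.inl i₂) (.inl i₀) (by simpa using h20.symm)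
    (by simp) c₄
  refine ⟨z₄, hz₄, ?_⟩
  set g := z₄ (.inl i₀) with hg
  -- The elements which are divisible by `g` modulo `I`.
  let P : Λ → Prop := fun x => ∃ v, x - g * v ∈ I
  have Padd : ∀ x y, P x → P y → P (x + y) := by
    rintro x y ⟨v, hv⟩ ⟨w, hw⟩
    exact ⟨v + w, by simpa [mul_add, add_sub_add_comm] using I.add_mem hv hw⟩
  have Pmul : ∀ x y, P x → P (x * y) := by
    rintro x y ⟨v, hv⟩
    exact ⟨v * y, by rw [← mul_assoc, ← sub_mul]; exact I.mul_mem_right _ hv⟩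
  have PI : ∀ x ∈ I, P x := fun x hx => ⟨0, by simpa using hx⟩
  have Psub : ∀ x y, x - y ∈ I → P y → P x := fun x y h hy => by
    simpa using Padd _ _ (PI _ h) hy
  rw [← g1] at e4 e4'
  rw [← f1] at e3 e3'
  have P3 : P (z₃ (.inl i₀)) := ⟨_, e4⟩
  have P2 : P (z₃ (.inl i₂)) := ⟨_, e4'⟩
  have P0' : P (z₂ (.inl i₀)) := Psub _ _ e3 (Pmul _ _ P3)
  have P1' : P (z₂ (.inl i₁)) := Psub _ _ e3' (Pmul _ _ P3)
  rw [f3 _ (by simpa using h20) (by simp), b3 _ (by simpa using h21) (by simpa using h20)] at P2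
  have hz1i1 : z₁ (.inl i₁) ∈ I := by
    rw [a2]
    exact I.add_mem (hl _ h10) (I.mul_mem_right _ (hr _ h20 h21))
  have Q1 : P (z₁ (.inr i₀)) := by
    refine Psub _ (z₂ (.inl i₁)) ?_ P1'
    rw [b1, mul_one, sub_add_cancel_right]
    exact I.neg_mem hz1i1
  have Q2 : P (z₁ (.inr i₁)) := by
    refine Psub _ (z₁ (.inl i₂)) ?_ P2
    rw [a1, a3 _ (by simp) (by simp), mul_one, sub_add_cancel_right]
    exact I.neg_mem (hl _ h20)
  have Q0 : P (z₁ (.inl i₀)) := by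
    have := Padd _ _ P0' (Pmul _ (-c₂) Q2)
    rw [b2] at this
    simpa using this
  obtain ⟨y, hy⟩ := huni z₁ hz₁
  have hall : ∀ k, P (z₁ k) := by
    rintro (i | i)
    · by_cases h0 : i = i₀
      · rwa [h0]
      by_cases h1 : i = i₁
      · rw [h1]; exact PI _ hz1i1
      by_cases h2 : i = i₂
      · rwa [h2]
      · rw [a3 _ (by simpa using h2) (by simpa using h1)]
        exact PI _ (hl i h0)
    · by_cases h0 : i = i₀
      · rwa [h0]
      by_cases h1 : i = i₁
      · rwa [h1]
      · rw [a3 _ (by simp) (by simp)]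
        exact PI _ (hr i h0 h1)
  obtain ⟨v, hv⟩ : P 1 := by
    rw [← hy]
    exact Finset.sum_induction _ P Padd (PI 0 I.zero_mem) fun k _ => Pmul _ _ (hall k)
  exact ⟨v, by simpa using I.neg_mem hv⟩

end Reduction

namespace IsFrame

variable {Λ M : Type*} [Ring Λ] [AddCommGroup M] [Module Λ M] {m : ℕ}
  {ε : ℤ} {J : Λ → Λ} {F : M → M → Λ} {b : Fin m ⊕ Fin m → M}
  (H : HermForm ε J F) (hb : IsFrame ε F b)
include H hb

omit H in
theorem ext_of_pairing {x y : M} (h : ∀ k, F x (b k) = F y (b k)) : x = y := by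
  rw [hb.expand x, hb.expand y]
  simp only [h]

theorem pairing_root (p q r : Fin m ⊕ Fin m) (hpq : q ≠ p.swap) (a : Λ) (x : M) :
    F (transv ε F (b p) (a • b q) x) (b r) = F x (b r) + F x (b p) * a * F (b q) (b r) -
      ε • (F x (b q) * J a * F (b p) (b r)) := by
  rw [H.transv_eq (H.isoPair_smul_right (hb.isoPair hpq) a), H.sub_left, H.add_left, H.eps_left,
    smul_smul, H.smul_left, H.smul_left, H.smul_right]

/-- The first vector of a hyperbolic pair can be moved by the elementary group such that one of its
coordinates is invertible modulo `I`. -/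
theorem exists_coordinate_unit (hm : 3 ≤ m) {I : Ideal Λ} [I.IsTwoSided]
    (hreg : ∀ a b : Λ, ∃ c d d', a - (a + b * c) * d ∈ I ∧ b - (a + b * c) * d' ∈ I)
    {e f : M} (hef : F e f = 1) (i₀ : Fin m) :
    ∃ γ ∈ rootGroup ε F b Set.univ, ∃ y, F (γ e) (b (.inr i₀)) * y - 1 ∈ I := by
  let Z : Set (Fin m ⊕ Fin m → Λ) := {z | ∃ γ ∈ rootGroup ε F b Set.univ,
    z = fun k => sgn ε k • F (γ e) (b k.swap)}
  have hZ : ClosedUnderRoots Z := by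
    rintro _ ⟨γ, hγ, rfl⟩ k q hqk hqk' a
    have hq : q ≠ k.swap.swap := by simpa using hqk
    have hsk : ∀ {x : Λ}, sgn ε k • sgn ε k • x = x := fun {x} => by
      rw [smul_smul, sgn_mul H.eps_mul, one_smul]
    have hsq : ∀ {x : Λ}, sgn ε q • sgn ε q • x = x := fun {x} => by
      rw [smul_smul, sgn_mul H.eps_mul, one_smul]
    refine ⟨_, ⟨transv ε F (b k.swap) ((sgn ε k • a) • b q) * γ,
      mul_mem (transv_mem_rootGroup hq trivial) hγ, rfl⟩, ?_, ?_, fun r hr hr' => ?_⟩ <;>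
    simp only [LinearEquiv.mul_apply, hb.pairing_root H _ _ _ hq]
    · rw [hb.dual, hb.orth k.swap q.swap (by simpa using fun h => hqk' (by simp [← h]))]
      simp only [mul_smul_comm, mul_one, mul_zero, smul_zero, sub_zero, smul_add, hsq,
        smul_mul_assoc]
    · refine ⟨-(ε • (sgn ε k.swap * sgn ε q.swap * sgn ε k.swap) • J (sgn ε k • a)), ?_⟩
      have hd : F (b k.swap) (b k) = sgn ε k.swap • (1 : Λ) := by simpa using hb.dual k.swap
      rw [Sum.swap_swap, Sum.swap_swap, hb.orth q k (by simpa using fun h => hqk' (by simp [h])),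
        hd]
      rcases H.eps with rfl | rfl <;> rcases k with k | k <;> rcases q with q | q <;>
        simp [sgn, sub_eq_add_neg, H.J_neg]
    · rw [hb.orth q r.swap (by simpa using fun h => hr (Sum.swap_leftInverse.injective h)),
        hb.orth k.swap r.swap (by simpa using fun h => hr' (by simp [← h]))]
      simp
  have huni : ∀ z ∈ Z, ∃ y : Fin m ⊕ Fin m → Λ, ∑ k, z k * y k = 1 := by
    rintro _ ⟨γ, hγ, rfl⟩
    refine ⟨fun k => F (b k) (γ f), ?_⟩
    have h1 : F (γ e) (γ f) = 1 := by rw [hb.rootGroup_isometry H hγ, hef]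
    have h2 : ∀ (s : Finset (Fin m ⊕ Fin m)) (g : Fin m ⊕ Fin m → M) (y : M),
        F (∑ k ∈ s, g k) y = ∑ k ∈ s, F (g k) y := fun s g y => by
      induction s using Finset.induction_on with
      | empty => simp [H.zero_left]
      | insert a s ha ih => rw [Finset.sum_insert ha, Finset.sum_insert ha, H.add_left, ih]
    rw [hb.expand (γ e), h2] at h1
    rw [← h1]
    exact Finset.sum_congr rfl fun k _ => by rw [← smul_assoc, H.smul_left]
  obtain ⟨_, ⟨γ, hγ, rfl⟩, y, hy⟩ := exists_right_unit hreg hZ hm ⟨_, 1, one_mem _, rfl⟩ huni i₀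
  exact ⟨γ, hγ, y, by simpa [sgn] using hy⟩

/-- An isotropic vector whose coordinate `k` is `1` can be moved to the basis vector `b k` by the
elementary group, without moving `b k'`. -/
theorem exists_move_vector {half : Λ} (hh : half + half = 1) (hc : ∀ a, half * a = a * half)
    {x : M} (hx : F x x = 0) (k : Fin m ⊕ Fin m) (hk : F x (b k.swap) = sgn ε k • (1 : Λ)) :
    ∃ δ ∈ rootGroup ε F b Set.univ, δ x = b k ∧ δ (b k.swap) = b k.swap := by
  have hss : ∀ (r : Fin m ⊕ Fin m) {x : Λ}, sgn ε r • sgn ε r • x = x := fun r {x} => by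
    rw [smul_smul, sgn_mul H.eps_mul, one_smul]
  have clear : ∀ s : Finset (Fin m ⊕ Fin m), k ∉ s → k.swap ∉ s →
      ∃ δ ∈ rootGroup ε F b Set.univ, δ (b k.swap) = b k.swap ∧
        ∀ r ∈ s, F (δ x) (b r.swap) = 0 := by
    intro s
    induction s using Finset.induction_on with
    | empty => exact fun _ _ => ⟨1, one_mem _, rfl, by simp⟩
    | insert q s hq ih =>
      intro h1 h2
      rw [Finset.mem_insert, not_or] at h1 h2
      obtain ⟨δ, hδ, e1, e2⟩ := ih h1.2 h2.2
      have hqk : q ≠ k.swap.swap := by simpa using Ne.symm h1.1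
      have e3 : F (δ x) (b k.swap) = sgn ε k • (1 : Λ) := by
        rw [← hk, ← hb.rootGroup_isometry H hδ x, e1]
      refine ⟨transv ε F (b k.swap) ((-(sgn ε k • sgn ε q • F (δ x) (b q.swap))) • b q) * δ,
        mul_mem (transv_mem_rootGroup hqk trivial) hδ, ?_, fun r hr => ?_⟩
      · refine hb.ext_of_pairing fun r => ?_
        rw [LinearEquiv.mul_apply, e1, hb.pairing_root H _ _ _ hqk, hb.self,
          hb.orth k.swap q hqk]
        simp
      · rw [LinearEquiv.mul_apply, hb.pairing_root H _ _ _ hqk, e3]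
        rw [hb.orth k.swap r.swap (by
          rw [Sum.swap_swap]
          rintro h
          rcases Finset.mem_insert.1 hr with rfl | hr
          · exact h2.1 (by simp [← h])
          · exact h2.2 (by rwa [← h, Sum.swap_swap])), mul_zero, smul_zero, sub_zero]
        by_cases hrq : r = q
        · rw [hrq, hb.dual, smul_mul_assoc, one_mul, smul_neg, hss, mul_smul_comm, mul_one,
            smul_neg, hss, add_neg_cancel]
        · rw [hb.orth q r.swap (fun h => hrq (Sum.swap_leftInverse.injective h)), mul_zero,
            add_zero]
          exact e2 r ((Finset.mem_insert.1 hr).resolve_left hrq)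
  obtain ⟨δ, hδ, e1, e2⟩ := clear ((Finset.univ.erase k).erase k.swap) (by simp) (by simp)
  have e3 : F (δ x) (b k.swap) = sgn ε k • (1 : Λ) := by
    rw [← hk, ← hb.rootGroup_isometry H hδ x, e1]
  set y := sgn ε k.swap • F (δ x) (b k) with hy
  have e4 : δ x = b k + y • b k.swap := by
    rw [hb.expand (δ x), ← Finset.add_sum_erase _ _ (Finset.mem_univ k),
      ← Finset.add_sum_erase _ _ (Finset.mem_erase.2 ⟨sum_swap_ne k, Finset.mem_univ k.swap⟩),
      Finset.sum_eq_zero (fun r hr => by rw [e2 r hr]; simp), e3, add_zero, Sum.swap_swap,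
      ← smul_assoc, hss, one_smul, ← smul_assoc]
  have e5 : J y = -(ε • y) := by
    have h1 : F (δ x) (δ x) = 0 := by rw [hb.rootGroup_isometry H hδ, hx]
    have h2 : F (b k.swap) (b k) = sgn ε k.swap • (1 : Λ) := by simpa using hb.dual k.swap
    rw [e4, H.add_left, H.add_right, H.add_right, hb.self, H.smul_right, hb.dual, H.smul_left, h2,
      H.smul_left, H.smul_right, hb.self, sgn_swap H.eps_mul] at h1
    have h3 := congrArg (fun z => sgn ε k • z) h1
    simp only [smul_mul_assoc, one_mul, zero_mul, mul_zero, add_zero, zero_add, mul_smul_comm,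
      mul_one, smul_zero, smul_add, hss, mul_comm ε, mul_smul] at h3
    exact eq_neg_of_add_eq_zero_left h3
  have hJh : J half = half := by
    have h1 : J half + J half = 1 := by rw [← H.J_add, hh, H.J_one]
    calc J half = (half + half) * J half := by rw [hh, one_mul]
      _ = half * (J half + J half) := by noncomm_ring
      _ = half := by rw [h1, mul_one]
  obtain ⟨c, hc'⟩ : ∃ c, c = -(sgn ε k • y) := ⟨_, rfl⟩
  have e6 : half * c - ε • J (half * c) = c := by
    have h1 : ε • J c = -c := by
      rw [hc', H.J_neg, smul_neg, neg_neg]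
      rcases k with k | k <;>
        simp only [sgn, one_smul, H.J_eps, e5, smul_neg, neg_neg, H.eps_smul_smul]
    rw [H.J_mul, hJh, ← hc, ← mul_smul_comm, h1, mul_neg, sub_neg_eq_add, ← add_mul, hh, one_mul]
  refine ⟨transv ε F (b k.swap) ((half * c) • b k.swap) * δ,
    mul_mem (transv_mem_rootGroup (sum_swap_ne _).symm trivial) hδ, ?_, ?_⟩
  · rw [LinearEquiv.mul_apply, H.transv_self_apply (hb.self _) e6, e3, e4, hc', smul_mul_assoc,
      one_mul, smul_neg, hss, neg_smul, add_neg_cancel_right]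
  · rw [LinearEquiv.mul_apply, e1, H.transv_self_apply (hb.self _) e6, hb.self]
    simp

/-- A hyperbolic pair whose first vector has an invertible coordinate can be moved to a pair of the
hyperbolic basis by the elementary group. -/
theorem exists_move_pair (hm : 2 ≤ m) {half : Λ} (hh : half + half = 1)
    (hc : ∀ a, half * a = a * half) {e f : M} (he : F e e = 0) (hf : F f f = 0) (hef : F e f = 1)
    {i₀ : Fin m} {w : Λ} (hw : F e (b (.inr i₀)) * w = 1) :
    ∃ γ ∈ rootGroup ε F b Set.univ, ∃ i, γ e = b (.inl i) ∧ γ f = b (.inr i) := by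
  obtain ⟨i, hi⟩ : ∃ i, i ≠ i₀ := by
    have : Nontrivial (Fin m) := Fin.nontrivial_iff_two_le.2 hm
    exact exists_ne i₀
  have hne : (.inl i : Fin m ⊕ Fin m) ≠ Sum.swap (.inr i₀) := by simpa using hi
  set τ := transv ε F (b (.inr i₀)) ((w * (1 - F e (b (.inr i)))) • b (.inl i)) with hτ
  have hτm : τ ∈ rootGroup ε F b Set.univ := transv_mem_rootGroup hne trivial
  have h1 : F (τ e) (b (Sum.swap (.inl i))) = sgn ε (.inl i : Fin m ⊕ Fin m) • (1 : Λ) := by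
    rw [hτ, hb.pairing_root H _ _ _ hne, hb.dual, hb.orth (.inr i₀) _ (by simp), ← mul_assoc, hw]
    simp [sgn]
  obtain ⟨δ, hδ, e1, -⟩ := hb.exists_move_vector H hh hc
    (by rw [hb.rootGroup_isometry H hτm, he]) (.inl i) h1
  have h2 : F (δ (τ f)) (b (Sum.swap (.inr i))) = sgn ε (.inr i : Fin m ⊕ Fin m) • (1 : Λ) := by
    rw [Sum.swap_inr, ← e1, hb.rootGroup_isometry H hδ, hb.rootGroup_isometry H hτm, H.symm e f,
      hef, H.J_one, sgn]
  obtain ⟨δ', hδ', e2, e3⟩ := hb.exists_move_vector H hh hc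
    (by rw [hb.rootGroup_isometry H hδ, hb.rootGroup_isometry H hτm, hf]) (.inr i) h2
  refine ⟨δ' * δ * τ, mul_mem (mul_mem hδ' hδ) hτm, i, ?_, e2⟩
  rw [LinearEquiv.mul_apply, LinearEquiv.mul_apply, e1]
  exact e3

end IsFrame

/-! ### Extension of scalars for automorphisms -/

section ScalarExt

variable {Λ Λ' M M' : Type*} [Ring Λ] [Ring Λ'] [AddCommGroup M] [Module Λ M] [AddCommGroup M']
  [Module Λ' M']

/-- The map `i : M → M'` is semilinear with respect to `ρ : Λ → Λ'` and has the properties of the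
extension of scalars that are used here: `M'` is generated by the image of `i`, and semilinear maps
`M → M'` extend to linear maps `M' → M'`. -/
structure IsScalarExt (ρ : Λ →+* Λ') (i : M → M') : Prop where
  map_add : ∀ x y, i (x + y) = i x + i y
  map_smul : ∀ (a : Λ) x, i (a • x) = ρ a • i x
  span : ∀ y, y ∈ Submodule.span Λ' (Set.range i)
  lift : ∀ g : M → M', (∀ x y, g (x + y) = g x + g y) → (∀ (a : Λ) x, g (a • x) = ρ a • g x) →
    ∃ G : M' →ₗ[Λ'] M', ∀ x, G (i x) = g x

namespace IsScalarExt

variable {ρ : Λ →+* Λ'} {i : M → M'} (hi : IsScalarExt ρ i)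
include hi

theorem linearMap_ext {N : Type*} [AddCommGroup N] [Module Λ' N] {φ φ' : M' →ₗ[Λ'] N}
    (h : ∀ x, φ (i x) = φ' (i x)) : φ = φ' := by
  ext y
  induction hi.span y using Submodule.span_induction with
  | mem y hy => obtain ⟨x, rfl⟩ := hy; exact h x
  | zero => simp
  | add x y _ _ hx hy => rw [_root_.map_add, _root_.map_add, hx, hy]
  | smul a x _ hx => rw [_root_.map_smul, _root_.map_smul, hx]

theorem equiv_ext {φ φ' : M' ≃ₗ[Λ'] M'} (h : ∀ x, φ (i x) = φ' (i x)) : φ = φ' :=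
  LinearEquiv.toLinearMap_injective (hi.linearMap_ext h)

theorem exists_extends (σ : M ≃ₗ[Λ] M) : ∃ σ' : M' ≃ₗ[Λ'] M', Extends i i σ σ' := by
  have key : ∀ σ : M ≃ₗ[Λ] M, ∃ G : M' →ₗ[Λ'] M', ∀ x, G (i x) = i (σ x) := fun σ =>
    hi.lift (fun x => i (σ x)) (fun x y => by rw [_root_.map_add, hi.map_add])
      (fun a x => by rw [_root_.map_smul, hi.map_smul])
  obtain ⟨G, hG⟩ := key σ
  obtain ⟨G', hG'⟩ := key σ.symm
  refine ⟨LinearEquiv.ofLinearMap G G' (hi.linearMap_ext fun x => ?_)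
    (hi.linearMap_ext fun x => ?_), fun x => hG x⟩
  · simp [hG, hG']
  · simp [hG, hG']

end IsScalarExt

theorem Extends.mul {i : M → M'} {σ τ : M ≃ₗ[Λ] M} {σ' τ' : M' ≃ₗ[Λ'] M'} (h : Extends i i σ σ')
    (h' : Extends i i τ τ') : Extends i i (σ * τ : M ≃ₗ[Λ] M) (σ' * τ' : M' ≃ₗ[Λ'] M') :=
  fun x => by
  rw [LinearEquiv.mul_apply, LinearEquiv.mul_apply, h', h]

theorem Extends.inv {i : M → M'} {σ : M ≃ₗ[Λ] M} {σ' : M' ≃ₗ[Λ'] M'} (h : Extends i i σ σ') :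
    Extends i i (σ⁻¹ : M ≃ₗ[Λ] M) (σ'⁻¹ : M' ≃ₗ[Λ'] M') := fun x => by
  change σ'.symm (i x) = i (σ.symm x)
  rw [LinearEquiv.symm_apply_eq, h, LinearEquiv.apply_symm_apply]

theorem Extends.one {i : M → M'} : Extends i i (1 : M ≃ₗ[Λ] M) (1 : M' ≃ₗ[Λ'] M') := fun _ => rfl

/-- If every generator of a group extends along `i` to an element of a subgroup `K`, so does every
element. -/
theorem exists_extends_of_closure {i : M → M'} {S : Set (M ≃ₗ[Λ] M)}
    {K : Subgroup (M' ≃ₗ[Λ'] M')} (h : ∀ σ ∈ S, ∃ σ' ∈ K, Extends i i σ σ') {σ : M ≃ₗ[Λ] M}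
    (hσ : σ ∈ Subgroup.closure S) : ∃ σ' ∈ K, Extends i i σ σ' := by
  induction hσ using Subgroup.closure_induction with
  | mem σ hσ => exact h σ hσ
  | one => exact ⟨1, one_mem _, Extends.one⟩
  | mul σ τ _ _ h h' =>
    obtain ⟨σ', hσ', e⟩ := h
    obtain ⟨τ', hτ', e'⟩ := h'
    exact ⟨σ' * τ', mul_mem hσ' hτ', e.mul e'⟩
  | inv σ _ h =>
    obtain ⟨σ', hσ', e⟩ := h
    exact ⟨σ'⁻¹, inv_mem hσ', e.inv⟩

/-- The automorphisms of `M'` that extend an element of the subgroup `K` of automorphisms of `M`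
along `i`. -/
def extendable (i : M → M') (K : Subgroup (M ≃ₗ[Λ] M)) : Subgroup (M' ≃ₗ[Λ'] M') where
  carrier := {σ' | ∃ σ ∈ K, Extends i i σ σ'}
  mul_mem' := by
    rintro _ _ ⟨σ, hσ, e⟩ ⟨τ, hτ, e'⟩
    exact ⟨σ * τ, mul_mem hσ hτ, e.mul e'⟩
  one_mem' := ⟨1, one_mem _, Extends.one⟩
  inv_mem' := by
    rintro _ ⟨σ, hσ, e⟩
    exact ⟨σ⁻¹, inv_mem hσ, e.inv⟩

end ScalarExt

/-! ### The modules `P_B`, `Q_B` and their comparison maps -/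

section Concrete

variable {R A P : Type*} [CommRing R] [Ring A] [Algebra R A] [AddCommGroup P] [Module R P]
  {B B' B'' : Type*} [CommRing B] [Algebra R B] [CommRing B'] [Algebra R B'] [CommRing B'']
  [Algebra R B'']

/-- The map `A_B → A_{B'}` induced by `f : B → B'`, as a homomorphism of algebras. -/
def ringMapHom (A : Type*) [Ring A] [Algebra R A] (f : B →ₐ[R] B') : B ⊗[R] A →ₐ[R] B' ⊗[R] A :=
  Algebra.TensorProduct.map f (AlgHom.id R A)

theorem ringMap_eq (f : B →ₐ[R] B') (a : B ⊗[R] A) : ringMap f a = ringMapHom A f a := rfl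

@[simp]
theorem ringMapHom_tmul (f : B →ₐ[R] B') (b : B) (a : A) :
    ringMapHom A f (b ⊗ₜ a) = f b ⊗ₜ a := rfl

theorem ringMapHom_comp (g : B' →ₐ[R] B'') (f : B →ₐ[R] B') (a : B ⊗[R] A) :
    ringMapHom A g (ringMapHom A f a) = ringMapHom A (g.comp f) a := by
  induction a using TensorProduct.induction_on with
  | zero => simp
  | tmul b a => rfl
  | add x y hx hy => simp only [map_add, hx, hy]

@[elab_as_elim]
theorem Extn.induction_on {motive : Extn R B P → Prop} (x : Extn R B P) (zero : motive 0)
    (tmul : ∀ b p, motive (Extn.tmul b p)) (add : ∀ x y, motive x → motive y → motive (x + y)) :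
    motive x :=
  TensorProduct.induction_on (motive := motive) (show B ⊗[R] P from x) zero tmul add

theorem Extn.map_add (f : B →ₐ[R] B') (x y : Extn R B P) :
    Extn.map f (x + y) = Extn.map f x + Extn.map f y :=
  (LinearMap.rTensor P f.toLinearMap).map_add (show B ⊗[R] P from x) (show B ⊗[R] P from y)

@[simp]
theorem Extn.map_zero (f : B →ₐ[R] B') : Extn.map f (0 : Extn R B P) = 0 :=
  (LinearMap.rTensor P f.toLinearMap).map_zero

@[simp]
theorem Extn.map_tmul (f : B →ₐ[R] B') (b : B) (p : P) :
    Extn.map f (Extn.tmul b p) = Extn.tmul (f b) p := rfl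

theorem Extn.map_comp (g : B' →ₐ[R] B'') (f : B →ₐ[R] B') (x : Extn R B P) :
    Extn.map g (Extn.map f x) = Extn.map (g.comp f) x := by
  induction x using Extn.induction_on with
  | zero => simp
  | tmul b a => rfl
  | add x y hx hy => simp only [Extn.map_add, hx, hy]

theorem Extn.tmul_add (b : B) (p q : P) :
    (Extn.tmul b (p + q) : Extn R B P) = Extn.tmul b p + Extn.tmul b q :=
  TensorProduct.tmul_add b p q

theorem mapLin_comp (g : B' →ₐ[R] B'') (f : B →ₐ[R] B') (x : QLin R A P B) :
    mapLin g (mapLin f x) = mapLin (g.comp f) x :=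
  Prod.ext (Extn.map_comp g f _) (ringMapHom_comp g f _)

theorem mapForm_comp (g : B' →ₐ[R] B'') (f : B →ₐ[R] B') (x : QForm R A P B) :
    mapForm g (mapForm f x) = mapForm (g.comp f) x :=
  Prod.ext (Extn.map_comp g f _) (Prod.ext (ringMapHom_comp g f _) (ringMapHom_comp g f _))

theorem extInv_tmul (j : A →ₗ[R] A) (b : B) (a : A) : extInv B j (b ⊗ₜ a) = b ⊗ₜ j a := rfl

theorem extInv_add (j : A →ₗ[R] A) (x y : B ⊗[R] A) :
    extInv B j (x + y) = extInv B j x + extInv B j y := map_add (j.baseChange B) x y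

theorem extInv_zero (j : A →ₗ[R] A) : extInv B j (0 : B ⊗[R] A) = 0 := map_zero (j.baseChange B)

theorem extInv_zsmul (j : A →ₗ[R] A) (n : ℤ) (x : B ⊗[R] A) :
    extInv B j (n • x) = n • extInv B j x := map_zsmul (j.baseChange B) n x

theorem extForm_tmul (h : P →ₗ[R] P →ₗ[R] A) (b c : B) (p q : P) :
    extForm B h (Extn.tmul b p) (Extn.tmul c q) = (b * c) ⊗ₜ[R] h p q := by
  change LinearMap.BilinMap.baseChange B h (b ⊗ₜ p) (c ⊗ₜ q) = _
  rw [LinearMap.BilinMap.baseChange_tmul]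

theorem extForm_add_left (h : P →ₗ[R] P →ₗ[R] A) (x y z : Extn R B P) :
    extForm B h (x + y) z = extForm B h x z + extForm B h y z :=
  LinearMap.map_add₂ (LinearMap.BilinMap.baseChange B h) (show B ⊗[R] P from x)
    (show B ⊗[R] P from y) (show B ⊗[R] P from z)

theorem extForm_add_right (h : P →ₗ[R] P →ₗ[R] A) (x y z : Extn R B P) :
    extForm B h x (y + z) = extForm B h x y + extForm B h x z :=
  (LinearMap.BilinMap.baseChange B h (show B ⊗[R] P from x)).map_add (show B ⊗[R] P from y)
    (show B ⊗[R] P from z)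

theorem extForm_zero_left (h : P →ₗ[R] P →ₗ[R] A) (z : Extn R B P) : extForm B h 0 z = 0 := by
  simpa using extForm_add_left h 0 0 z

theorem extForm_zero_right (h : P →ₗ[R] P →ₗ[R] A) (z : Extn R B P) : extForm B h z 0 = 0 := by
  simpa using extForm_add_right h z 0 0

theorem extInv_ringMapHom (f : B →ₐ[R] B') (j : A →ₗ[R] A) (x : B ⊗[R] A) :
    extInv B' j (ringMapHom A f x) = ringMapHom A f (extInv B j x) := by
  induction x using TensorProduct.induction_on with
  | zero => simp [extInv_zero]
  | tmul b a => rfl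
  | add x y hx hy => simp only [_root_.map_add, extInv_add, hx, hy]

theorem extForm_map (f : B →ₐ[R] B') (h : P →ₗ[R] P →ₗ[R] A) (x y : Extn R B P) :
    extForm B' h (Extn.map f x) (Extn.map f y) = ringMapHom A f (extForm B h x y) := by
  induction x using Extn.induction_on with
  | zero => simp [extForm_zero_left]
  | add x x' hx hx' => simp only [Extn.map_add, extForm_add_left, hx, hx', _root_.map_add]
  | tmul b p =>
    induction y using Extn.induction_on with
    | zero => simp [extForm_zero_right]
    | add x x' hx hx' => simp only [Extn.map_add, extForm_add_right, hx, hx', _root_.map_add]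
    | tmul c q => simp [extForm_tmul]

theorem formQ_mapForm (κ : Kind) (j : A →ₗ[R] A) (h : P →ₗ[R] P →ₗ[R] A) (f : B →ₐ[R] B')
    (x y : QForm R A P B) :
    formQ κ (extInv B' j) (extForm B' h) (mapForm f x) (mapForm f y) =
      ringMapHom A f (formQ κ (extInv B j) (extForm B h) x y) := by
  simp only [formQ, mapForm, ringMap_eq, extForm_map, extInv_ringMapHom, _root_.map_add,
    _root_.map_mul, map_zsmul]

variable [Module A P] [IsScalarTower R A P]

theorem Extn.map_smul (f : B →ₐ[R] B') (a : B ⊗[R] A) (x : Extn R B P) :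
    Extn.map f (a • x) = ringMapHom A f a • Extn.map f x := by
  induction x using Extn.induction_on with
  | zero => simp
  | tmul c p =>
    induction a using TensorProduct.induction_on with
    | zero => simp
    | tmul b a => simp [Extn.tmul_smul_tmul]
    | add a a' h h' => rw [add_smul, Extn.map_add, h, h', _root_.map_add, add_smul]
  | add x y hx hy => rw [smul_add, Extn.map_add, hx, hy, Extn.map_add, smul_add]

theorem Extn.algebraMap_smul (r : R) (x : Extn R B P) :
    algebraMap R (B ⊗[R] A) r • x = (r • (show B ⊗[R] P from x) : B ⊗[R] P) := by
  induction x using Extn.induction_on with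
  | zero => rw [smul_zero]; exact (smul_zero (A := B ⊗[R] P) r).symm
  | tmul c p =>
    rw [Algebra.TensorProduct.algebraMap_apply, Extn.tmul_smul_tmul, one_smul, ← Algebra.smul_def]
    exact (TensorProduct.smul_tmul' r c p).symm
  | add x y hx hy =>
    rw [smul_add, hx, hy]
    exact (smul_add r (show B ⊗[R] P from x) (show B ⊗[R] P from y)).symm

/-- A semilinear map on `P_B` extends to a linear map on `P_{B'}`. -/
theorem Extn.exists_lift (f : B →ₐ[R] B') {W : Type*} [AddCommGroup W] [Module (B' ⊗[R] A) W]
    (g : Extn R B P → W) (h_add : ∀ x y, g (x + y) = g x + g y)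
    (h_smul : ∀ (a : B ⊗[R] A) x, g (a • x) = ringMapHom A f a • g x) :
    ∃ G : Extn R B' P →ₗ[B' ⊗[R] A] W, ∀ x, G (Extn.map f x) = g x := by
  let G₁ : B' ⊗[R] P →+ W := TensorProduct.liftAddHom
    { toFun := fun b =>
        { toFun := fun p => (b ⊗ₜ[R] (1 : A)) • g (Extn.tmul 1 p)
          map_zero' := by
            have h0 : (Extn.tmul 1 0 : Extn R B P) = 0 := TensorProduct.tmul_zero P 1
            have h1 : g 0 = 0 := by simpa using h_add 0 0
            rw [h0, h1, smul_zero]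
          map_add' := fun p q => by rw [Extn.tmul_add, h_add, smul_add] }
      map_zero' := by ext p; simp
      map_add' := fun b c => by ext p; simp [TensorProduct.add_tmul, add_smul] }
    (fun r b p => by
      have h1 : (Extn.tmul 1 (r • p) : Extn R B P) =
          ((1 : B) ⊗ₜ[R] algebraMap R A r) • Extn.tmul 1 p := by
        rw [Extn.tmul_smul_tmul, _root_.algebraMap_smul, one_mul]
      change ((r • b) ⊗ₜ[R] (1 : A)) • g (Extn.tmul 1 p) =
        (b ⊗ₜ[R] (1 : A)) • g (Extn.tmul 1 (r • p))
      rw [h1, h_smul, smul_smul, ringMapHom_tmul, Algebra.TensorProduct.tmul_mul_tmul, map_one,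
        mul_one, one_mul, Algebra.algebraMap_eq_smul_one, TensorProduct.smul_tmul])
  let G₀ : Extn R B' P →+ W := G₁
  have hG₀ : ∀ b p, G₀ (Extn.tmul b p : Extn R B' P) = (b ⊗ₜ[R] (1 : A)) • g (Extn.tmul 1 p) :=
    fun b p => rfl
  refine ⟨{ toFun := G₀, map_add' := G₀.map_add, map_smul' := fun a x => ?_ }, fun x => ?_⟩
  · induction x using Extn.induction_on with
    | zero => simp
    | tmul c p =>
      induction a using TensorProduct.induction_on with
      | zero => simp
      | tmul b a =>
        have h1 : (Extn.tmul 1 (a • p) : Extn R B P) = ((1 : B) ⊗ₜ[R] a) • Extn.tmul 1 p := by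
          rw [Extn.tmul_smul_tmul, one_mul]
        rw [Extn.tmul_smul_tmul, hG₀, hG₀, h1, h_smul, smul_smul, RingHom.id_apply, smul_smul,
          ringMapHom_tmul, Algebra.TensorProduct.tmul_mul_tmul,
          Algebra.TensorProduct.tmul_mul_tmul, map_one, one_mul, mul_one, mul_one]
      | add a a' h h' => simp only [add_smul, _root_.map_add, h, h', RingHom.id_apply]
    | add x y hx hy => simp only [smul_add, _root_.map_add, hx, hy]
  · change G₀ (Extn.map f x) = g x
    induction x using Extn.induction_on with
    | zero =>
      have h0 : g 0 = 0 := by simpa using h_add 0 0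
      rw [Extn.map_zero, _root_.map_zero, h0]
    | tmul b p =>
      have h1 : (Extn.tmul b p : Extn R B P) = (b ⊗ₜ[R] (1 : A)) • Extn.tmul 1 p := by
        rw [Extn.tmul_smul_tmul, one_smul, mul_one]
      rw [Extn.map_tmul, hG₀, h1, h_smul, ringMapHom_tmul]
    | add x y hx hy => rw [Extn.map_add, h_add, ← hx, ← hy, _root_.map_add]

theorem Extn.span_map (f : B →ₐ[R] B') (y : Extn R B' P) :
    y ∈ Submodule.span (B' ⊗[R] A) (Set.range (Extn.map f : Extn R B P → _)) := by
  induction y using Extn.induction_on with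
  | zero => exact zero_mem _
  | tmul b p =>
    have h1 : (Extn.tmul b p : Extn R B' P) = (b ⊗ₜ[R] (1 : A)) • Extn.map f (Extn.tmul 1 p) := by
      rw [Extn.map_tmul, Extn.tmul_smul_tmul, one_smul, _root_.map_one, mul_one]
    rw [h1]
    exact Submodule.smul_mem _ _ (Submodule.subset_span ⟨_, rfl⟩)
  | add x y hx hy => exact add_mem hx hy

theorem isScalarExt_mapLin (f : B →ₐ[R] B') :
    IsScalarExt (ringMapHom A f).toRingHom (mapLin f : QLin R A P B → QLin R A P B') where
  map_add x y := Prod.ext (Extn.map_add f _ _) (map_add (ringMapHom A f) _ _)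
  map_smul a x := Prod.ext (Extn.map_smul f _ _) (map_mul (ringMapHom A f) _ _)
  span := by
    rintro ⟨x, a⟩
    have h1 : ((0, 1) : QLin R A P B') = mapLin f (0, 1) :=
      Prod.ext (Extn.map_zero f).symm (map_one (ringMapHom A f)).symm
    have h2 : ((x, a) : QLin R A P B') = LinearMap.inl (B' ⊗[R] A) _ _ x + a • (0, 1) := by
      ext <;> simp
    rw [h2, h1]
    refine add_mem ?_ (Submodule.smul_mem _ _ (Submodule.subset_span ⟨_, rfl⟩))
    have h3 := Submodule.mem_map_of_mem (f := LinearMap.inl (B' ⊗[R] A) (Extn R B' P) (B' ⊗[R] A))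
      (Extn.span_map (A := A) f x)
    rw [Submodule.map_span] at h3
    refine Submodule.span_mono ?_ h3
    rintro _ ⟨_, ⟨y, rfl⟩, rfl⟩
    exact ⟨(y, 0), Prod.ext rfl (map_zero (ringMapHom A f))⟩
  lift g h_add h_smul := by
    obtain ⟨G, hG⟩ := Extn.exists_lift (A := A) f (fun x : Extn R B P => g (x, 0))
      (fun x y => by rw [← h_add]; simp) (fun a x => by
        refine Eq.trans ?_ (h_smul a _)
        simp)
    refine ⟨LinearMap.coprod G (LinearMap.toSpanSingleton _ _ (g (0, 1))), ?_⟩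
    rintro ⟨x, a⟩
    have h1 : ((x, a) : QLin R A P B) = (x, 0) + a • (0, 1) := by ext <;> simp
    rw [h1, h_add, h_smul, ← hG, ← h1]
    rfl

theorem isScalarExt_mapForm (f : B →ₐ[R] B') :
    IsScalarExt (ringMapHom A f).toRingHom (mapForm f : QForm R A P B → QForm R A P B') where
  map_add x y := Prod.ext (Extn.map_add f _ _)
    (Prod.ext (map_add (ringMapHom A f) _ _) (map_add (ringMapHom A f) _ _))
  map_smul a x := Prod.ext (Extn.map_smul f _ _)
    (Prod.ext (map_mul (ringMapHom A f) _ _) (map_mul (ringMapHom A f) _ _))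
  span := by
    rintro ⟨x, a, c⟩
    have h1 : ((0, 1, 0) : QForm R A P B') = mapForm f (0, 1, 0) :=
      Prod.ext (Extn.map_zero f).symm (Prod.ext (map_one (ringMapHom A f)).symm
        (map_zero (ringMapHom A f)).symm)
    have h1' : ((0, 0, 1) : QForm R A P B') = mapForm f (0, 0, 1) :=
      Prod.ext (Extn.map_zero f).symm (Prod.ext (map_zero (ringMapHom A f)).symm
        (map_one (ringMapHom A f)).symm)
    have h2 : ((x, a, c) : QForm R A P B') =
        LinearMap.inl (B' ⊗[R] A) _ _ x + a • (0, 1, 0) + c • (0, 0, 1) := by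
      ext <;> simp
    rw [h2, h1, h1']
    refine add_mem (add_mem ?_ (Submodule.smul_mem _ _ (Submodule.subset_span ⟨_, rfl⟩)))
      (Submodule.smul_mem _ _ (Submodule.subset_span ⟨_, rfl⟩))
    have h3 := Submodule.mem_map_of_mem
      (f := LinearMap.inl (B' ⊗[R] A) (Extn R B' P) ((B' ⊗[R] A) × (B' ⊗[R] A)))
      (Extn.span_map (A := A) f x)
    rw [Submodule.map_span] at h3
    refine Submodule.span_mono ?_ h3
    rintro _ ⟨_, ⟨y, rfl⟩, rfl⟩
    exact ⟨(y, 0, 0), Prod.ext rfl (Prod.ext (map_zero (ringMapHom A f))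
      (map_zero (ringMapHom A f)))⟩
  lift g h_add h_smul := by
    obtain ⟨G, hG⟩ := Extn.exists_lift (A := A) f (fun x : Extn R B P => g (x, 0, 0))
      (fun x y => by rw [← h_add]; simp) (fun a x => by
        refine Eq.trans ?_ (h_smul a _)
        simp)
    refine ⟨LinearMap.coprod G (LinearMap.coprod (LinearMap.toSpanSingleton _ _ (g (0, 1, 0)))
      (LinearMap.toSpanSingleton _ _ (g (0, 0, 1)))), ?_⟩
    rintro ⟨x, a, c⟩
    have h1 : ((x, a, c) : QForm R A P B) = (x, 0, 0) + (a • (0, 1, 0) + c • (0, 0, 1)) := by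
      ext <;> simp
    rw [h1, h_add, h_add, h_smul, h_smul, ← hG, ← h1]
    rfl

/-! ### The form of `Q_B` -/

variable {κ : Kind} {j : A →ₗ[R] A} {h : P →ₗ[R] P →ₗ[R] A}

variable (B) in
theorem hermForm_formQ (hj : IsInvolution j) (hh : IsForm κ j h) :
    HermForm κ.sign (extInv B j) (formQ (P := Extn R B P) κ (extInv B j) (extForm B h)) := by
  have J_mul : ∀ a b : B ⊗[R] A, extInv B j (a * b) = extInv B j b * extInv B j a := by
    intro x y
    induction x using TensorProduct.induction_on with
    | zero => simp [extInv_zero]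
    | add x x' hx hx' => simp only [add_mul, mul_add, extInv_add, hx, hx']
    | tmul b a =>
      induction y using TensorProduct.induction_on with
      | zero => simp [extInv_zero]
      | add x x' hx hx' => simp only [add_mul, mul_add, extInv_add, hx, hx']
      | tmul c d => simp [extInv_tmul, hj.map_mul, mul_comm]
  have J_J : ∀ a : B ⊗[R] A, extInv B j (extInv B j a) = a := by
    intro x
    induction x using TensorProduct.induction_on with
    | zero => simp [extInv_zero]
    | add x x' hx hx' => simp only [extInv_add, hx, hx']
    | tmul b a => simp [extInv_tmul, hj.invol]
  have h_symm : ∀ x y : Extn R B P,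
      extForm B h y x = κ.sign • extInv B j (extForm B h x y) := by
    intro x y
    induction x using Extn.induction_on with
    | zero => simp [extForm_zero_left, extForm_zero_right, extInv_zero]
    | add x x' hx hx' =>
      simp only [extForm_add_left, extForm_add_right, extInv_add, smul_add, hx, hx']
    | tmul b p =>
      induction y using Extn.induction_on with
      | zero => simp [extForm_zero_left, extForm_zero_right, extInv_zero]
      | add x x' hx hx' =>
        simp only [extForm_add_left, extForm_add_right, extInv_add, smul_add, hx, hx']
      | tmul c q =>
        rw [extForm_tmul, extForm_tmul, extInv_tmul, hh.symm p q, mul_comm,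
          TensorProduct.tmul_smul]
  have h_smul : ∀ (a : B ⊗[R] A) (x y : Extn R B P),
      extForm B h (a • x) y = a * extForm B h x y := by
    intro a x y
    induction x using Extn.induction_on with
    | zero => simp [extForm_zero_left]
    | add x x' hx hx' => simp only [smul_add, extForm_add_left, hx, hx', mul_add]
    | tmul b p =>
      induction y using Extn.induction_on with
      | zero => simp [extForm_zero_right]
      | add x x' hx hx' => simp only [extForm_add_right, hx, hx', mul_add]
      | tmul c q =>
        induction a using TensorProduct.induction_on with
        | zero => simp [extForm_zero_left]
        | add a a' ha ha' => simp only [add_smul, extForm_add_left, ha, ha', add_mul]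
        | tmul d a => simp [Extn.tmul_smul_tmul, extForm_tmul, hh.smul_left, mul_assoc]
  have eps : κ.sign = 1 ∨ κ.sign = -1 := by cases κ <;> simp [Kind.sign]
  refine ⟨eps, extInv_add j, J_mul, J_J, fun x y z => ?_, fun a x y => ?_, fun x y => ?_⟩
  · simp only [formQ, Prod.fst_add, Prod.snd_add, extForm_add_left, add_mul, smul_add]
    abel
  · simp only [formQ, Prod.smul_fst, Prod.smul_snd, h_smul, smul_eq_mul, mul_add, mul_assoc,
      mul_smul_comm]
  · simp only [formQ, extInv_add, smul_add, J_mul, J_J, extInv_zsmul, h_symm x.1 y.1]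
    rcases eps with e | e <;> simp only [e, one_smul, neg_smul, neg_neg] <;> abel

end Concrete

/-! ### Localization -/

section Localization

variable {R A P : Type*} [CommRing R] [Ring A] [Algebra R A] [AddCommGroup P] [Module R P]
  {B B' : Type*} [CommRing B] [Algebra R B] [CommRing B'] [Algebra R B']

theorem isLocalizedModule_ofId (u : R) : IsLocalizedModule (Submonoid.powers u)
    (Algebra.ofId R (Localization.Away u)).toLinearMap :=
  (isLocalizedModule_iff_isLocalization' (Submonoid.powers u) (Localization.Away u)).2 inferInstance

theorem isLocalizedModule_loc (u : R) :
    IsLocalizedModule (Submonoid.powers u) (loc u).toLinearMap := by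
  let _ : Algebra R[X] (Localization.Away u)[X] := Polynomial.algebra R (Localization.Away u)
  have h := isLocalizedModule_iff_isLocalization.2
    (Polynomial.isLocalization (Submonoid.powers u) (Localization.Away u))
  exact h

section

variable {f : B →ₐ[R] B'} {u : R} (hf : IsLocalizedModule (Submonoid.powers u) f.toLinearMap)
include hf

theorem isLocalizedModule_rTensor (N : Type*) [AddCommGroup N] [Module R N] :
    IsLocalizedModule (Submonoid.powers u) (LinearMap.rTensor N f.toLinearMap) :=
  IsLocalizedModule.rTensor (R := R) (A := R) (S := Submonoid.powers u) (N := N) f.toLinearMap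

theorem exists_ringMap_eq (a : B' ⊗[R] A) :
    ∃ (n : ℕ) (d : B ⊗[R] A), algebraMap R (B' ⊗[R] A) (u ^ n) * a = ringMapHom A f d := by
  obtain ⟨⟨d, ⟨_, n, rfl⟩⟩, h⟩ := (isLocalizedModule_rTensor hf A).surj a
  exact ⟨n, d, by rw [← Algebra.smul_def]; exact h⟩

theorem exists_mul_eq_zero {d : B ⊗[R] A} (hd : ringMapHom A f d = 0) :
    ∃ n : ℕ, algebraMap R (B ⊗[R] A) (u ^ n) * d = 0 := by
  obtain ⟨⟨_, n, rfl⟩, h⟩ := (isLocalizedModule_rTensor hf A).exists_of_eq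
    (x₁ := d) (x₂ := 0) (hd.trans (LinearMap.map_zero _).symm)
  exact ⟨n, by rw [← Algebra.smul_def]; exact h.trans (smul_zero _)⟩

variable [Module A P] [IsScalarTower R A P]

theorem Extn.exists_map_eq (x : Extn R B' P) :
    ∃ (n : ℕ) (y : Extn R B P), algebraMap R (B' ⊗[R] A) (u ^ n) • x = Extn.map f y := by
  obtain ⟨⟨d, ⟨_, n, rfl⟩⟩, h⟩ := (isLocalizedModule_rTensor hf P).surj (show B' ⊗[R] P from x)
  exact ⟨n, d, (Extn.algebraMap_smul _ _).trans h⟩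

end

theorem ringMapHom_algebraMap (f : B →ₐ[R] B') (r : R) :
    ringMapHom A f (algebraMap R _ r) = algebraMap R _ r := (ringMapHom A f).commutes r

theorem algebraMap_mul_comm (r : R) (x : B ⊗[R] A) :
    algebraMap R _ r * x = x * algebraMap R _ r := Algebra.commutes r x

theorem extInv_algebraMap {j : A →ₗ[R] A} (hj : IsInvolution j) (r : R) :
    extInv B j (algebraMap R _ r) = algebraMap R _ r := by
  rw [Algebra.TensorProduct.algebraMap_apply, extInv_tmul, hj.map_one]

/-- The filtration of `A_{B'}` by the multiples of `u ^ N` in the image of `A_B`. -/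
def imageFiltration (A : Type*) [Ring A] [Algebra R A] (f : B →ₐ[R] B') (u : R) (N : ℕ) :
    AddSubgroup (B' ⊗[R] A) :=
  ((AddMonoidHom.mulLeft (algebraMap R (B' ⊗[R] A) (u ^ N))).comp
    (ringMapHom A f : B ⊗[R] A →+ B' ⊗[R] A)).range

theorem mem_imageFiltration {f : B →ₐ[R] B'} {u : R} {N : ℕ} {a : B' ⊗[R] A} :
    a ∈ imageFiltration A f u N ↔
      ∃ d, a = algebraMap R (B' ⊗[R] A) (u ^ N) * ringMapHom A f d :=
  ⟨fun ⟨d, h⟩ => ⟨d, h.symm⟩, fun ⟨d, h⟩ => ⟨d, h.symm⟩⟩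

theorem isFiltration_imageFiltration {f : B →ₐ[R] B'} {u : R}
    (hf : IsLocalizedModule (Submonoid.powers u) f.toLinearMap) :
    IsFiltration (imageFiltration A f u) (fun N => algebraMap R (B' ⊗[R] A) (u ^ N)) where
  anti M N hMN a ha := by
    obtain ⟨d, rfl⟩ := mem_imageFiltration.1 ha
    obtain ⟨k, rfl⟩ := Nat.exists_eq_add_of_le hMN
    exact mem_imageFiltration.2 ⟨algebraMap R _ (u ^ k) * d, by
      rw [pow_add, map_mul, map_mul, ringMapHom_algebraMap, mul_assoc]⟩
  mul_left a N := by
    obtain ⟨n, d, hd⟩ := exists_ringMap_eq hf a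
    refine ⟨N + n, fun c hc => ?_⟩
    obtain ⟨e, rfl⟩ := mem_imageFiltration.1 hc
    refine mem_imageFiltration.2 ⟨d * e, ?_⟩
    rw [map_mul, ← hd, ← mul_assoc, ← algebraMap_mul_comm, pow_add, map_mul]
    simp only [mul_assoc]
  mul_right a N := by
    obtain ⟨n, d, hd⟩ := exists_ringMap_eq hf a
    refine ⟨N + n, fun c hc => ?_⟩
    obtain ⟨e, rfl⟩ := mem_imageFiltration.1 hc
    refine mem_imageFiltration.2 ⟨e * d, ?_⟩
    rw [map_mul, ← hd, ← mul_assoc (ringMapHom A f e), ← algebraMap_mul_comm, pow_add, map_mul]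
    simp only [mul_assoc]
  mul_mem N c hc d hd := by
    obtain ⟨c, rfl⟩ := mem_imageFiltration.1 hc
    obtain ⟨d, rfl⟩ := mem_imageFiltration.1 hd
    refine mem_imageFiltration.2 ⟨c * (algebraMap R _ (u ^ N) * d), ?_⟩
    rw [map_mul, map_mul, ringMapHom_algebraMap, mul_assoc]
  split N := by
    refine ⟨N + N, fun c hc => ?_⟩
    obtain ⟨d, rfl⟩ := mem_imageFiltration.1 hc
    exact ⟨_, mem_imageFiltration.2 ⟨d, rfl⟩, by rw [pow_add, map_mul, mul_assoc]⟩
  sigma_mem N := mem_imageFiltration.2 ⟨1, by simp⟩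

theorem extInv_mem_imageFiltration (j : A →ₗ[R] A) {f : B →ₐ[R] B'} {u : R}
    {N : ℕ} {c : B' ⊗[R] A} (hc : c ∈ imageFiltration A f u N) :
    extInv B' j c ∈ imageFiltration A f u N := by
  obtain ⟨d, rfl⟩ := mem_imageFiltration.1 hc
  refine mem_imageFiltration.2 ⟨extInv B j d, ?_⟩
  rw [← extInv_ringMapHom, ← Algebra.smul_def, ← Algebra.smul_def]
  exact (j.baseChange B').map_smul_of_tower (u ^ N) _

end Localization

/-! ### Transvections under extension of scalars -/

section FormExt

variable {R A P : Type*} [CommRing R] [Ring A] [Algebra R A] [AddCommGroup P] [Module R P]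
  {B B' : Type*} [CommRing B] [Algebra R B] [CommRing B']
  [Algebra R B']

/-- The form of `Q_B = P_B ⊥ A_B²`. -/
abbrev qForm (κ : Kind) (j : A →ₗ[R] A) (h : P →ₗ[R] P →ₗ[R] A) (B : Type*) [CommRing B]
    [Algebra R B] : QForm R A P B → QForm R A P B → B ⊗[R] A :=
  formQ κ (extInv B j) (extForm B h)

variable {κ : Kind} {j : A →ₗ[R] A} {h : P →ₗ[R] P →ₗ[R] A}

theorem qForm_mapForm (f : B →ₐ[R] B') (x y : QForm R A P B) :
    qForm κ j h B' (mapForm f x) (mapForm f y) = ringMapHom A f (qForm κ j h B x y) :=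
  formQ_mapForm κ j h f x y

theorem IsoPair.map (f : B →ₐ[R] B') {u w : QForm R A P B} (hu : IsoPair (qForm κ j h B) u w) :
    IsoPair (qForm κ j h B') (mapForm f u) (mapForm f w) :=
  ⟨by rw [qForm_mapForm, hu.left, map_zero], by rw [qForm_mapForm, hu.right, map_zero],
    by rw [qForm_mapForm, hu.orth, map_zero]⟩

/-- The hyperbolic pair of `Q_B = P_B ⊥ A_B²`; its two vectors are distinguished by a Boolean. -/
def hypVec (B : Type*) [CommRing B] [Algebra R B] : Bool → QForm R A P B
  | false => (0, 1, 0)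
  | true => (0, 0, 1)

theorem mapForm_hypVec (f : B →ₐ[R] B') (i : Bool) :
    mapForm f (hypVec B i : QForm R A P B) = hypVec B' i := by
  cases i <;> simp [hypVec, mapForm, ringMap_eq]

theorem mapForm_inl (f : B →ₐ[R] B') (q : Extn R B P) :
    mapForm f ((q, 0, 0) : QForm R A P B) = (Extn.map f q, 0, 0) := by
  simp [mapForm, ringMap_eq]

theorem isoPair_hypVec (i : Bool) {q : Extn R B P} (hq : extForm B h q q = 0) :
    IsoPair (qForm κ j h B) (hypVec B i) (q, 0, 0) := by
  cases i <;> constructor <;>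
    simp [formQ, hypVec, extForm_zero_left, extInv_zero, hq]

theorem isoPair_hypVec_self (i : Bool) :
    IsoPair (qForm κ j h B) (hypVec B i : QForm R A P B) (hypVec B i) := by
  cases i <;> constructor <;> simp [formQ, hypVec, extForm_zero_left, extInv_zero]

variable [Module A P] [IsScalarTower R A P]

/-- The transvections of `Q_B`. -/
noncomputable abbrev qTransv (κ : Kind) (j : A →ₗ[R] A) (h : P →ₗ[R] P →ₗ[R] A)
    (u w : QForm R A P B) : QForm R A P B ≃ₗ[B ⊗[R] A] QForm R A P B :=
  transv κ.sign (qForm κ j h B) u w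

variable (B) in
theorem hermForm_qForm (hj : IsInvolution j) (hh : IsForm κ j h) :
    HermForm κ.sign (extInv B j) (qForm κ j h B) := hermForm_formQ B hj hh

theorem mapForm_smul (f : B →ₐ[R] B') (a : B ⊗[R] A) (x : QForm R A P B) :
    mapForm f (a • x) = ringMapHom A f a • mapForm f x := (isScalarExt_mapForm f).map_smul a x

theorem mapForm_add (f : B →ₐ[R] B') (x y : QForm R A P B) :
    mapForm f (x + y) = mapForm f x + mapForm f y := (isScalarExt_mapForm f).map_add x y

theorem mapForm_zsmul (f : B →ₐ[R] B') (n : ℤ) (x : QForm R A P B) :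
    mapForm f (n • x) = n • mapForm f x :=
  map_zsmul (⟨⟨mapForm f, by simpa using mapForm_add f (0 : QForm R A P B) 0⟩, mapForm_add f⟩ :
    QForm R A P B →+ QForm R A P B') n x

theorem mapForm_sub (f : B →ₐ[R] B') (x y : QForm R A P B) :
    mapForm f (x - y) = mapForm f x - mapForm f y :=
  map_sub (⟨⟨mapForm f, by simpa using mapForm_add f (0 : QForm R A P B) 0⟩, mapForm_add f⟩ :
    QForm R A P B →+ QForm R A P B') x y

variable (hj : IsInvolution j) (hh : IsForm κ j h)
include hj hh

theorem extends_transv (f : B →ₐ[R] B') {u w : QForm R A P B}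
    (hu : IsoPair (qForm κ j h B) u w) :
    Extends (mapForm f) (mapForm f) (qTransv κ j h u w)
      (qTransv κ j h (mapForm f u) (mapForm f w)) := fun x => by
  rw [(hermForm_qForm B' hj hh).transv_eq (hu.map f), (hermForm_qForm B hj hh).transv_eq hu,
    mapForm_sub, mapForm_add, mapForm_smul, mapForm_zsmul, mapForm_smul, qForm_mapForm,
    qForm_mapForm]

theorem IsFrame.map {m : ℕ} {b : Fin m ⊕ Fin m → QForm R A P B} (f : B →ₐ[R] B')
    (hb : IsFrame κ.sign (qForm κ j h B) b) :
    IsFrame κ.sign (qForm κ j h B') (fun k => mapForm f (b k)) where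
  orth k l hkl := by rw [qForm_mapForm, hb.orth k l hkl, map_zero]
  dual k := by rw [qForm_mapForm, hb.dual k, map_zsmul, map_one]
  expand x := by
    have H := hermForm_qForm B' hj hh
    induction (isScalarExt_mapForm f).span x using Submodule.span_induction with
    | mem x hx =>
      obtain ⟨x, rfl⟩ := hx
      have h1 : ∀ (s : Finset (Fin m ⊕ Fin m)) (g : Fin m ⊕ Fin m → QForm R A P B),
          mapForm f (∑ k ∈ s, g k) = ∑ k ∈ s, mapForm f (g k) := fun s g =>
        map_sum (⟨⟨mapForm f, by simpa using mapForm_add f (0 : QForm R A P B) 0⟩,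
          mapForm_add f⟩ : QForm R A P B →+ QForm R A P B') g s
      conv_lhs => rw [hb.expand x, h1]
      exact Finset.sum_congr rfl fun k _ => by rw [mapForm_zsmul, mapForm_smul, qForm_mapForm]
    | zero => simp [H.zero_left]
    | add x y _ _ hx hy =>
      simp only [H.add_left, add_smul, smul_add, Finset.sum_add_distrib]
      rw [← hx, ← hy]
    | smul a x _ hx =>
      conv_lhs => rw [hx]
      rw [Finset.smul_sum]
      exact Finset.sum_congr rfl fun k _ => by rw [H.smul_left, mul_smul, smul_comm]

theorem exists_extends_rootGroup {m : ℕ} {b : Fin m ⊕ Fin m → QForm R A P B} (f : B →ₐ[R] B')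
    (hb : IsFrame κ.sign (qForm κ j h B) b) {γ : QForm R A P B ≃ₗ[B ⊗[R] A] QForm R A P B}
    (hγ : γ ∈ rootGroup κ.sign (qForm κ j h B) b Set.univ) :
    ∃ γ' ∈ rootGroup κ.sign (qForm κ j h B') (fun k => mapForm f (b k)) Set.univ,
      Extends (mapForm f) (mapForm f) γ γ' := by
  refine exists_extends_of_closure ?_ hγ
  rintro _ ⟨k, l, hkl, c, -, rfl⟩
  refine ⟨_, transv_mem_rootGroup hkl
    (Set.mem_univ (ringMapHom A f c)), ?_⟩
  rw [← mapForm_smul]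
  exact extends_transv hj hh f ((hermForm_qForm B hj hh).isoPair_smul_right (hb.isoPair hkl) c)

end FormExt

/-! ### The elementary transvections of `Q_B` -/

section ETrans

variable {R A P : Type*} [CommRing R] [Ring A] [Algebra R A] [AddCommGroup P] [Module R P]
  [Module A P] [IsScalarTower R A P] {B B' : Type*} [CommRing B] [Algebra R B] [CommRing B']
  [Algebra R B'] {κ : Kind} {j : A →ₗ[R] A} {h : P →ₗ[R] P →ₗ[R] A}

theorem extInv_one (hj : IsInvolution j) : extInv B j (1 : B ⊗[R] A) = 1 := by
  rw [Algebra.TensorProduct.one_def, extInv_tmul, hj.map_one]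

variable (hj : IsInvolution j) (hh : IsForm κ j h)
include hj hh

theorem transv_hypVec_false {q : Extn R B P} (hq : extForm B h q q = 0) (p : Extn R B P)
    (b a : B ⊗[R] A) : qTransv κ j h (hypVec B false) (q, 0, 0) (p, b, a) =
      (p + (κ.sign • a) • q, b - κ.sign • extForm B h p q, a) := by
  rw [(hermForm_qForm B hj hh).transv_eq (isoPair_hypVec false hq)]
  simp [formQ, hypVec, extInv_zero, extInv_one hj, extForm_zero_right]

theorem transv_hypVec_true {q : Extn R B P} (hq : extForm B h q q = 0) (p : Extn R B P)
    (b a : B ⊗[R] A) : qTransv κ j h (hypVec B true) (q, 0, 0) (p, b, a) =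
      (p + b • q, b, a - κ.sign • extForm B h p q) := by
  rw [(hermForm_qForm B hj hh).transv_eq (isoPair_hypVec true hq)]
  simp [formQ, hypVec, extInv_zero, extInv_one hj, extForm_zero_right]

theorem transv_hypVec_self {r : R} (hr : r + r = 1) (hκ : κ = .symplectic) (i : Bool)
    (x : QForm R A P B) :
    qTransv κ j h (hypVec B i) (-algebraMap R (B ⊗[R] A) r • hypVec B i) x =
      x - qForm κ j h B x (hypVec B i) • hypVec B i := by
  have H := hermForm_qForm B hj hh
  have := H.transv_self_apply (isoPair_hypVec_self (κ := κ) (j := j) (h := h) (B := B) i).left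
    (c := -1) (d := -algebraMap R (B ⊗[R] A) r) (by
      rw [H.J_neg, extInv_algebraMap hj, hκ, Kind.sign, neg_smul, one_smul, sub_neg_eq_add,
        ← neg_add, ← map_add, hr, map_one]) x
  rw [qTransv, this]
  simp [sub_eq_add_neg]

/-- A set of generators of the group of elementary transvections in terms of Eichler
transvections. In the symplectic case it contains a long root element for each of the two vectors
of the hyperbolic pair. -/
theorem eTransForm_eq_closure {r : R} (hr : r + r = 1) :
    eTransForm (P := Extn R B P) κ (extForm B h) = Subgroup.closure
      ({τ | ∃ (i : Bool) (q : Extn R B P), extForm B h q q = 0 ∧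
        τ = qTransv κ j h (hypVec B i) (q, 0, 0)} ∪
      {τ | κ = .symplectic ∧ ∃ i : Bool, τ = qTransv κ j h (hypVec B i)
        (-algebraMap R (B ⊗[R] A) r • hypVec B i)}) := by
  have hz : extForm B h (0 : Extn R B P) 0 = 0 := extForm_zero_left h 0
  have hsub : ∀ p q : Extn R B P, extForm B h p (-q) = -extForm B h p q := by
    intro p q
    have h1 := extForm_add_right h p q (-q)
    rw [add_neg_cancel, extForm_zero_right] at h1
    exact (neg_eq_of_add_eq_zero_right h1.symm).symm
  have hneg : ∀ {q : Extn R B P}, extForm B h q q = 0 → extForm B h (-q) (-q) = 0 := by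
    intro q hq
    have h1 := extForm_add_left h q (-q) (-q)
    rw [add_neg_cancel, extForm_zero_left, hsub, hq, neg_zero, zero_add] at h1
    exact h1.symm
  have hF : ∀ {q : Extn R B P}, extForm B h q q = 0 → ∀ p b a, _ :=
    fun hq p b a => transv_hypVec_false hj hh hq p b a
  have hT : ∀ {q : Extn R B P}, extForm B h q q = 0 → ∀ p b a, _ :=
    fun hq p b a => transv_hypVec_true hj hh hq p b a
  have hLF : κ = .symplectic → ∀ p b a, qTransv κ j h (hypVec B false)
      (-algebraMap R (B ⊗[R] A) r • hypVec B false) (p, b, a) = (p, b + a, a) := by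
    intro hκ p b a
    rw [transv_hypVec_self hj hh hr hκ]
    simp [formQ, hypVec, extInv_zero, extInv_one hj, extForm_zero_right, Kind.sign, hκ]
  have hLT : κ = .symplectic → ∀ p b a, qTransv κ j h (hypVec B true)
      (-algebraMap R (B ⊗[R] A) r • hypVec B true) (p, b, a) = (p, b, a - b) := by
    intro hκ p b a
    rw [transv_hypVec_self hj hh hr hκ]
    simp [formQ, hypVec, extInv_zero, extInv_one hj, extForm_zero_right, Kind.sign, hκ]
  refine le_antisymm ?_ ?_
  · cases κ with
    | orthogonal =>
      refine (Subgroup.closure_le _).2 ?_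
      rintro τ (⟨q, hq, hτ⟩ | ⟨q, hq, hτ⟩)
      · refine Subgroup.subset_closure (.inl ⟨false, -q, hneg hq, LinearEquiv.ext ?_⟩)
        rintro ⟨p, b, a⟩
        rw [hτ, hF (hneg hq), hsub]
        simp [Kind.sign, sub_eq_add_neg]
      · refine Subgroup.subset_closure (.inl ⟨true, -q, hneg hq, LinearEquiv.ext ?_⟩)
        rintro ⟨p, b, a⟩
        rw [hτ, hT (hneg hq), hsub]
        simp [Kind.sign, sub_eq_add_neg]
    | symplectic =>
      refine (Subgroup.closure_le _).2 ?_
      rintro τ (⟨q, hq, hτ⟩ | ⟨q, hq, hτ⟩)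
      · have : τ = qTransv .symplectic j h (hypVec B false) (-q, 0, 0) *
            qTransv .symplectic j h (hypVec B false)
              (-algebraMap R (B ⊗[R] A) r • hypVec B false) := by
          refine LinearEquiv.ext ?_
          rintro ⟨p, b, a⟩
          rw [hτ, LinearEquiv.mul_apply, hLF rfl, hF (hneg hq), hsub]
          simp [Kind.sign, sub_eq_add_neg, add_right_comm]
        rw [this]
        exact mul_mem (Subgroup.subset_closure (.inl ⟨false, -q, hneg hq, rfl⟩))
          (Subgroup.subset_closure (.inr ⟨rfl, false, rfl⟩))
      · have : τ = qTransv .symplectic j h (hypVec B true) (q, 0, 0) *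
            qTransv .symplectic j h (hypVec B true)
              (-algebraMap R (B ⊗[R] A) r • hypVec B true) := by
          refine LinearEquiv.ext ?_
          rintro ⟨p, b, a⟩
          rw [hτ, LinearEquiv.mul_apply, hLT rfl, hT hq]
          simp [Kind.sign, sub_eq_add_neg, add_right_comm]
        rw [this]
        exact mul_mem (Subgroup.subset_closure (.inl ⟨true, q, hq, rfl⟩))
          (Subgroup.subset_closure (.inr ⟨rfl, true, rfl⟩))
  · cases κ with
    | orthogonal =>
      refine (Subgroup.closure_le _).2 ?_
      rintro _ (⟨i, q, hq, rfl⟩ | ⟨hκ, -⟩)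
      · refine Subgroup.subset_closure ?_
        cases i with
        | false =>
          refine .inl ⟨-q, hneg hq, fun p b a => ?_⟩
          rw [hF hq, hsub]
          simp [Kind.sign, sub_eq_add_neg]
        | true =>
          refine .inr ⟨-q, hneg hq, fun p b a => ?_⟩
          rw [hT hq, hsub]
          simp [Kind.sign, sub_eq_add_neg]
      · cases hκ
    | symplectic =>
      have hlong : ∀ i : Bool, qTransv .symplectic j h (hypVec B i)
          (-algebraMap R (B ⊗[R] A) r • hypVec B i) ∈
            eTransForm (P := Extn R B P) .symplectic (extForm B h) := by
        intro i
        refine Subgroup.subset_closure ?_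
        cases i with
        | false =>
          refine .inl ⟨0, hz, fun p b a => ?_⟩
          rw [hLF rfl]
          simp [extForm_zero_right]
        | true =>
          refine .inr ⟨0, hz, fun p b a => ?_⟩
          rw [hLT rfl]
          simp [extForm_zero_right]
      refine (Subgroup.closure_le _).2 ?_
      rintro _ (⟨i, q, hq, rfl⟩ | ⟨-, i, rfl⟩)
      · rw [SetLike.mem_coe, ← Subgroup.mul_mem_cancel_right _ (hlong i)]
        refine Subgroup.subset_closure ?_
        cases i with
        | false =>
          refine .inl ⟨-q, hneg hq, fun p b a => ?_⟩
          rw [LinearEquiv.mul_apply, hLF rfl, hF hq, hsub]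
          simp [Kind.sign, sub_eq_add_neg, add_right_comm]
        | true =>
          refine .inr ⟨q, hq, fun p b a => ?_⟩
          rw [LinearEquiv.mul_apply, hLT rfl, hT hq]
          simp [Kind.sign, sub_eq_add_neg, add_right_comm]
      · exact hlong i

theorem transv_mem_eTransForm {r : R} (hr : r + r = 1) (i : Bool) {q : Extn R B P}
    (hq : extForm B h q q = 0) :
    qTransv κ j h (hypVec B i) (q, 0, 0) ∈ eTransForm (P := Extn R B P) κ (extForm B h) := by
  rw [eTransForm_eq_closure hj hh hr]
  exact Subgroup.subset_closure (.inl ⟨i, q, hq, rfl⟩)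

theorem exists_extends_eTransForm {r : R} (hr : r + r = 1) (f : B →ₐ[R] B')
    {τ : QForm R A P B ≃ₗ[B ⊗[R] A] QForm R A P B}
    (hτ : τ ∈ eTransForm (P := Extn R B P) κ (extForm B h)) :
    ∃ τ' ∈ eTransForm (P := Extn R B' P) κ (extForm B' h),
      Extends (mapForm f) (mapForm f) τ τ' := by
  rw [eTransForm_eq_closure hj hh hr] at hτ ⊢
  refine exists_extends_of_closure ?_ hτ
  rintro _ (⟨i, q, hq, rfl⟩ | ⟨hκ, i, rfl⟩)
  · refine ⟨_, Subgroup.subset_closure (.inl ⟨i, Extn.map f q, ?_, rfl⟩), ?_⟩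
    · rw [extForm_map, hq, map_zero]
    · rw [← mapForm_hypVec f, ← mapForm_inl]
      exact extends_transv hj hh f (isoPair_hypVec i hq)
  · refine ⟨_, Subgroup.subset_closure (.inr ⟨hκ, i, rfl⟩), ?_⟩
    have h1 : -algebraMap R (B' ⊗[R] A) r • (hypVec B' i : QForm R A P B') =
        mapForm f (-algebraMap R (B ⊗[R] A) r • hypVec B i) := by
      rw [mapForm_smul, map_neg, ringMapHom_algebraMap, mapForm_hypVec]
    rw [h1, ← mapForm_hypVec f]
    exact extends_transv hj hh f ((hermForm_qForm B hj hh).isoPair_smul_right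
      (isoPair_hypVec_self i) _)

end ETrans

/-! ### Lifting root elements to elementary transvections -/

section Split

variable {Λ M : Type*} [Ring Λ] [AddCommGroup M] [Module Λ M] {m : ℕ} {ε : ℤ} {J : Λ → Λ}
  {F : M → M → Λ} {b : Fin m ⊕ Fin m → M}

/-- Suppose that the planes of a hyperbolic basis are divided into two non-empty classes. If a
group contains the root elements that involve both classes, for small coefficients, then it
contains all root elements of smaller coefficients. -/
theorem IsFrame.exists_rootGroup_le_of_ne (hb : IsFrame ε F b) (H : HermForm ε J F)
    {Φ : ℕ → AddSubgroup Λ} {σ : ℕ → Λ} (hΦ : IsFiltration Φ σ) (hJσ : ∀ N, J (σ N) = σ N)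
    (Z : Fin m ⊕ Fin m → Prop) (Zswap : ∀ k, Z k.swap ↔ Z k) {p q : Fin m ⊕ Fin m} (hp : Z p)
    (hq : ¬ Z q) {L : Subgroup (M ≃ₗ[Λ] M)} {N : ℕ}
    (hdir : ∀ k l, l ≠ Sum.swap k → (Z k ↔ ¬ Z l) → ∀ c ∈ Φ N, transv ε F (b k) (c • b l) ∈ L) :
    ∃ N', rootGroup ε F b (Φ N' : Set Λ) ≤ L := by
  obtain ⟨N₁, hN₁⟩ := hΦ.split N
  refine ⟨N ⊔ N₁, (Subgroup.closure_le _).2 ?_⟩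
  rintro _ ⟨k, l, hkl, c, hc, rfl⟩
  rw [SetLike.mem_coe] at hc
  by_cases hz : Z k ↔ ¬ Z l
  · exact hdir k l hkl hz c (hΦ.anti le_sup_left hc)
  have hz' : Z k ↔ Z l := not_not.1 fun h =>
    hz (by rw [not_iff] at h; exact not_iff_comm.1 h |>.symm)
  obtain ⟨r, hr⟩ : ∃ r, Z r ↔ ¬ Z k := by
    by_cases hk : Z k
    · exact ⟨q, by simp [hq, hk]⟩
    · exact ⟨p, by simp [hp, hk]⟩
  obtain ⟨d, hd, rfl⟩ := hN₁ c (hΦ.anti le_sup_right hc)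
  have hr' : Z r ↔ ¬ Z l := hr.trans (not_congr hz')
  have hne : ∀ {i j}, (Z i ↔ ¬ Z j) → i ≠ j := by rintro i _ h rfl; exact iff_not_self h
  have z1 : r ≠ k.swap := hne (by rw [Zswap]; exact hr)
  have z2 : r.swap ≠ k.swap := hne (by rw [Zswap, Zswap]; exact hr)
  have z3 : r ≠ l.swap := hne (by rw [Zswap]; exact hr')
  have z4 : r.swap ≠ l.swap := hne (by rw [Zswap, Zswap]; exact hr')
  rw [hb.transv_eq_commutator H (hb.isoPair hkl) r (hb.orth _ _ z1) (hb.orth _ _ z2)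
    (hb.orth _ _ z3) (hb.orth _ _ z4) (hJσ N) d, commutatorElement_def]
  have m1 := hdir k r z1 (by rw [hr, not_not]) _ (hΦ.sigma_mem N)
  have m2 := hdir r.swap l (by simpa using (hne hr').symm) (by rw [Zswap]; exact hr') _
    (zsmul_mem hd (-ε * sgn ε r.swap))
  exact mul_mem (mul_mem (mul_mem m1 m2) (inv_mem m1)) (inv_mem m2)

end Split

section Lift

variable {R A P : Type*} [CommRing R] [Ring A] [Algebra R A] [AddCommGroup P] [Module R P]
  [Module A P] [IsScalarTower R A P] {κ : Kind} {j : A →ₗ[R] A} {h : P →ₗ[R] P →ₗ[R] A}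

theorem const_comp_ofId (u : R) :
    (const u).comp (Algebra.ofId R _) = (loc u).comp (Algebra.ofId R R[X]) :=
  AlgHom.ext fun r => by
    rw [AlgHom.comp_apply, AlgHom.comp_apply]
    simp [const, loc, Algebra.ofId_apply, Polynomial.algebraMap_apply]

theorem extForm_smul_left {B : Type*} [CommRing B] [Algebra R B] (hj : IsInvolution j)
    (hh : IsForm κ j h) (d : B ⊗[R] A) (x y : Extn R B P) :
    extForm B h (d • x) y = d * extForm B h x y := by
  simpa [formQ, extInv_zero] using (hermForm_qForm B hj hh).smul_left d (x, 0, 0) (y, 0, 0)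

theorem extForm_smul_right {B : Type*} [CommRing B] [Algebra R B] (hj : IsInvolution j)
    (hh : IsForm κ j h) (d : B ⊗[R] A) (x y : Extn R B P) :
    extForm B h x (d • y) = extForm B h x y * extInv B j d := by
  simpa [formQ, extInv_zero] using (hermForm_qForm B hj hh).smul_right d (x, 0, 0) (y, 0, 0)

/-- Elements of `P_u` become extended from `P` after multiplication with a power of `u`, and
isotropic ones from isotropic ones. -/
theorem exists_isotropic_lift (hj : IsInvolution j) (hh : IsForm κ j h) (u : R)
    {v : Extn R (Localization.Away u) P} (hv : extForm _ h v v = 0) :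
    ∃ (n : ℕ) (y : Extn R R P), extForm R h y y = 0 ∧
      Extn.map (Algebra.ofId R (Localization.Away u)) y =
        algebraMap R (Localization.Away u ⊗[R] A) (u ^ n) • v := by
  obtain ⟨n, y, hy⟩ := Extn.exists_map_eq (A := A) (isLocalizedModule_ofId u) v
  obtain ⟨k, hk⟩ := exists_mul_eq_zero (isLocalizedModule_ofId u) (d := extForm R h y y) (by
    rw [← extForm_map, ← hy, extForm_smul_left hj hh, extForm_smul_right hj hh, hv,
      zero_mul, mul_zero])
  refine ⟨k + n, algebraMap R (R ⊗[R] A) (u ^ k) • y, ?_, ?_⟩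
  · rw [extForm_smul_left hj hh, extForm_smul_right hj hh, ← mul_assoc, hk, zero_mul]
  · rw [Extn.map_smul, ringMapHom_algebraMap, ← hy, smul_smul, ← map_mul, pow_add]

/-- Transvections with one vector of the hyperbolic pair and a multiple of an isotropic vector of
`P_u`, with a sufficiently small coefficient, are extended from generators of the group of
elementary transvections. -/
theorem exists_transv_hypVec_mem (hj : IsInvolution j) (hh : IsForm κ j h) {r : R}
    (hr : r + r = 1) (u : R) {v : Extn R (Localization.Away u) P} (hv : extForm _ h v v = 0) :
    ∃ N, ∀ (i : Bool), ∀ c ∈ imageFiltration A (loc u) u N,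
      qTransv κ j h (hypVec _ i) (c • mapForm (const u) (v, 0, 0)) ∈
        extendable (mapForm (loc u)) (eTransForm (P := Extn R R[X] P) κ (extForm R[X] h)) := by
  obtain ⟨N, y, hy, hyv⟩ := exists_isotropic_lift hj hh u hv
  refine ⟨N, fun i c hc => ?_⟩
  obtain ⟨d, rfl⟩ := mem_imageFiltration.1 hc
  have hq : extForm R[X] h (d • Extn.map (Algebra.ofId R R[X]) y)
      (d • Extn.map (Algebra.ofId R R[X]) y) = 0 := by
    rw [extForm_smul_left hj hh, extForm_smul_right hj hh, extForm_map, hy, map_zero, zero_mul,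
      mul_zero]
  refine ⟨_, transv_mem_eTransForm hj hh hr i hq, ?_⟩
  have e := extends_transv hj hh (loc u) (isoPair_hypVec (κ := κ) (j := j) i hq)
  rw [mapForm_hypVec] at e
  convert e using 3
  rw [mapForm_inl, mapForm_inl, Extn.map_smul, Extn.map_comp, ← const_comp_ofId, ← Extn.map_comp,
    hyv, Extn.map_smul, ringMapHom_algebraMap, algebraMap_mul_comm]
  ext1
  · simp [mul_smul]
  · simp

omit [Module A P] [IsScalarTower R A P] in
theorem eq_inl_of_orth {B : Type*} [CommRing B] [Algebra R B] (hj : IsInvolution j)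
    {x : QForm R A P B} (h0 : qForm κ j h B x (hypVec B false) = 0)
    (h1 : qForm κ j h B x (hypVec B true) = 0) : x = (x.1, 0, 0) := by
  obtain ⟨p, b, a⟩ := x
  have hb : b = 0 := by
    simpa [formQ, hypVec, extForm_zero_right, extInv_zero, extInv_one hj] using h1
  have ha : a = 0 := by
    cases κ <;>
    simpa [formQ, hypVec, extForm_zero_right, extInv_zero, extInv_one hj, Kind.sign] using h0
  rw [ha, hb]

/-- If a frame of `Q_u` contains the given hyperbolic pair, then all its root elements of
sufficiently small coefficients over `A_u[X]` are extended from elementary transvections. -/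
theorem IsFrame.exists_rootGroup_le (hj : IsInvolution j) (hh : IsForm κ j h) {r : R}
    (hr : r + r = 1) {u : R} {m : ℕ} (hm : 2 ≤ m)
    {b : Fin m ⊕ Fin m → QForm R A P (Localization.Away u)}
    (hb : IsFrame κ.sign (qForm κ j h _) b) (i : Fin m) (h0 : b (.inl i) = hypVec _ false)
    (h1 : b (.inr i) = hypVec _ true) :
    ∃ N, rootGroup κ.sign (qForm κ j h _) (fun k => mapForm (const u) (b k))
      (imageFiltration A (loc u) u N : Set ((Localization.Away u)[X] ⊗[R] A)) ≤
        extendable (mapForm (loc u)) (eTransForm (P := Extn R R[X] P) κ (extForm R[X] h)) := by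
  set L := extendable (Λ' := (Localization.Away u)[X] ⊗[R] A)
    (mapForm (loc u)) (eTransForm (P := Extn R R[X] P) κ (extForm R[X] h)) with hL
  set Φ := imageFiltration A (loc u) u with hΦdef
  have hΦ := isFiltration_imageFiltration (A := A) (isLocalizedModule_loc u)
  have H := hermForm_qForm (P := P) (Localization.Away u)[X] hj hh
  have hw := hb.map hj hh (const u)
  set w := fun k => mapForm (const u) (b k) with hwdef
  let Z : Fin m ⊕ Fin m → Prop := fun k => k = .inl i ∨ k = .inr i
  have Zswap : ∀ k, Z k.swap ↔ Z k := by rintro (k | k) <;> simp [Z]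
  have hZ : ∀ k, Z k → ∃ β, w k = hypVec _ β := by
    rintro k (rfl | rfl)
    · exact ⟨false, by simp only [hwdef, h0, mapForm_hypVec]⟩
    · exact ⟨true, by simp only [hwdef, h1, mapForm_hypVec]⟩
  have hout : ∀ l, ∃ N, ¬ Z l → ∀ (β : Bool), ∀ c ∈ Φ N,
      qTransv κ j h (hypVec _ β) (c • w l) ∈ L := by
    intro l
    by_cases hl : Z l
    · exact ⟨0, fun h => absurd hl h⟩
    have e := eq_inl_of_orth (x := b l) (κ := κ) (j := j) (h := h) hj
      (by rw [← h0]; exact hb.orth _ _ fun h => hl ((Zswap l).1 (h ▸ .inl rfl)))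
      (by rw [← h1]; exact hb.orth _ _ fun h => hl ((Zswap l).1 (h ▸ .inr rfl)))
    have iso := hb.self l
    rw [e] at iso
    obtain ⟨N, hN⟩ := exists_transv_hypVec_mem hj hh hr u (v := (b l).1)
      (by simpa [formQ, extInv_zero] using iso)
    exact ⟨N, fun _ β c hc => by simp only [hwdef]; rw [e]; exact hN β c hc⟩
  choose f hf using hout
  have hfle : ∀ l, f l ≤ Finset.univ.sup f := fun l => Finset.le_sup (Finset.mem_univ l)
  set N₀ := Finset.univ.sup f
  -- Root elements that involve exactly one of the two planes of the hyperbolic pair.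
  have hdir : ∀ k l, l ≠ Sum.swap k → (Z k ↔ ¬ Z l) → ∀ c ∈ Φ N₀,
      qTransv κ j h (w k) (c • w l) ∈ L := by
    intro k l hkl hz c hc
    by_cases hk : Z k
    · obtain ⟨β, hβ⟩ := hZ k hk
      rw [hβ]
      exact hf l (hz.1 hk) β c (hΦ.anti (hfle l) hc)
    · obtain ⟨β, hβ⟩ := hZ l (not_not.1 fun h => hk (hz.2 h))
      rw [qTransv, H.transv_smul_swap (hw.isoPair hkl), ← qTransv, hβ]
      exact hf k hk β _ (hΦ.anti (hfle k) (zsmul_mem (extInv_mem_imageFiltration j hc) _))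
  have : Nontrivial (Fin m) := Fin.nontrivial_iff_two_le.2 hm
  obtain ⟨q, hq⟩ := exists_ne i
  exact hw.exists_rootGroup_le_of_ne H hΦ (fun N => extInv_algebraMap hj _) Z Zswap
    (p := .inl i) (q := .inl q) (.inl rfl) (by simp [Z, hq]) hdir

end Lift

/-! ### Normalization at zero -/

/-- Let `c` be an idempotent endomorphism of the situation, which will be `X ↦ 0`. If `τ ∈ K`
extends to an automorphism `g` which reduces to the identity under `c`, then `τ` can be divided by
its reduction without changing its extension. -/
theorem exists_reduction_eq_id {Λ Λ' M M' : Type*} [Ring Λ] [Ring Λ'] [AddCommGroup M]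
    [Module Λ M] [AddCommGroup M'] [Module Λ' M'] {ρ : Λ →+* Λ} {ρ' ρ'' : Λ →+* Λ'} {c : M → M}
    {i : M → M'} {c' : M' → M'} (hc : IsScalarExt ρ c) (hi : IsScalarExt ρ' i)
    (hic : IsScalarExt ρ'' fun x => i (c x)) (hcc : ∀ x, c (c x) = c x)
    (hcomm : ∀ x, i (c x) = c' (i x)) {K : Subgroup (M ≃ₗ[Λ] M)}
    (hK : ∀ τ ∈ K, ∃ τ' ∈ K, Extends c c τ τ') {g : M' ≃ₗ[Λ'] M'} (hg : g ∈ extendable i K)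
    (hg' : ∀ x, c' (g x) = c' x) :
    ∃ τ ∈ K, Extends i i τ g ∧ ∀ x, c (τ x) = c x := by
  obtain ⟨τ, hτ, e⟩ := hg
  obtain ⟨τ₀, hτ₀, e₀⟩ := hK τ hτ
  obtain ⟨g₀, eg⟩ := hi.exists_extends τ₀
  have hg₀ : g₀ = 1 := hic.equiv_ext fun x => by
    rw [eg, e₀, hcomm, ← e, hg', ← hcomm]
    rfl
  obtain ⟨τ₁, e₁⟩ := hc.exists_extends τ₀
  have hτ₁ : τ₁ = τ₀ := hc.equiv_ext fun x => by
    rw [← hcc x, e₁, e₀, hcc, ← e₀, hcc]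
  subst hτ₁ hg₀
  refine ⟨τ * τ₁⁻¹, mul_mem hτ (inv_mem hτ₀), by simpa using e.mul eg.inv, fun x => ?_⟩
  obtain ⟨y, rfl⟩ := τ₁.surjective x
  have : τ₁⁻¹ (τ₁ y) = y := τ₁.symm_apply_apply y
  rw [LinearEquiv.mul_apply, this, ← e₀, e₁]

/-! ### Comparison of automorphisms with equal localizations -/

section Compare

variable {R A P : Type*} [CommRing R] [Ring A] [Algebra R A] [AddCommGroup P] [Module R P]

/-- Substitution of a multiple of `u ^ n` for `X` changes a polynomial by a multiple of `u ^ n`,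
in a linear way. -/
theorem exists_aeval_eq {B : Type*} [CommRing B] [Algebra R B] (u : R) (n : ℕ) (y : B) :
    ∃ g : R[X] →ₗ[R] B, ∀ p : R[X], Polynomial.aeval (algebraMap R B (u ^ n) * y) p =
      algebraMap R B (p.coeff 0) + u ^ n • g p := by
  let D : R[X] →ₗ[R] R[X] :=
    { toFun := Polynomial.divX
      map_add' := fun _ _ => Polynomial.divX_add
      map_smul' := fun a p => by
        rw [Polynomial.smul_eq_C_mul, Polynomial.divX_C_mul, ← Polynomial.smul_eq_C_mul]; rfl }
  refine ⟨(LinearMap.mulLeft R y).comp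
    ((Polynomial.aeval (algebraMap R B (u ^ n) * y)).toLinearMap.comp D), fun p => ?_⟩
  conv_lhs => rw [← Polynomial.divX_mul_X_add p]
  simp only [map_add, map_mul, Polynomial.aeval_X, Polynomial.aeval_C, LinearMap.comp_apply,
    LinearMap.mulLeft_apply, AlgHom.toLinearMap_apply, Algebra.smul_def]
  change Polynomial.aeval _ p.divX * _ + _ = _ + _ * (y * Polynomial.aeval _ p.divX)
  ring

/-- The substitution `X ↦ z`, as a map `R[X] → R[X]`. -/
noncomputable abbrev subst (z : R[X]) : R[X] →ₐ[R] R[X] := Polynomial.aeval z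

/-- An element over `R[X]` which vanishes over `R_u[X]` and at `X = 0` also vanishes after
substitution of a sufficiently divisible multiple of `X`. -/
theorem exists_rTensor_aeval_eq_zero {N : Type*} [AddCommGroup N] [Module R N] (u : R)
    {d : R[X] ⊗[R] N} (h_loc : LinearMap.rTensor N (loc u).toLinearMap d = 0)
    (h_zero : LinearMap.rTensor N (evalZero (R := R)).toLinearMap d = 0) :
    ∃ n, ∀ m, n ≤ m → ∀ y : R[X],
      LinearMap.rTensor N (subst (algebraMap R R[X] (u ^ m) * y)).toLinearMap d = 0 := by
  obtain ⟨⟨_, n, rfl⟩, h⟩ := (isLocalizedModule_rTensor (isLocalizedModule_loc u) N).exists_of_eq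
    (x₁ := d) (x₂ := 0) (h_loc.trans (LinearMap.map_zero _).symm)
  have hn : u ^ n • d = 0 := h.trans (smul_zero _)
  refine ⟨n, fun m hnm y => ?_⟩
  obtain ⟨g, hg⟩ := exists_aeval_eq u m y
  have hm : u ^ m • d = 0 := by
    rw [← Nat.sub_add_cancel hnm, pow_add, mul_smul, hn, smul_zero]
  have e : (subst (algebraMap R R[X] (u ^ m) * y)).toLinearMap =
      (Algebra.linearMap R R[X]).comp (evalZero (R := R)).toLinearMap + u ^ m • g := by
    refine LinearMap.ext fun p => ?_
    simp only [AlgHom.toLinearMap_apply, hg, LinearMap.add_apply, LinearMap.smul_apply]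
    congr 1
    simp [evalZero, Polynomial.coeff_zero_eq_eval_zero]
  rw [e, LinearMap.rTensor_add, LinearMap.rTensor_comp, LinearMap.rTensor_smul,
    LinearMap.add_apply, LinearMap.comp_apply, h_zero, map_zero, LinearMap.smul_apply,
    ← LinearMap.map_smul, hm, map_zero, add_zero]

variable [Module A P] [IsScalarTower R A P]

theorem Extn.finite (B : Type*) [CommRing B] [Algebra R B] [Module.Finite A P] :
    Module.Finite (B ⊗[R] A) (Extn R B P) := by
  obtain ⟨S, hS⟩ := Module.Finite.fg_top (R := A) (M := P)
  classical
  refine ⟨⟨S.image (Extn.tmul 1), top_le_iff.1 fun x _ => ?_⟩⟩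
  have key : ∀ p : P, (Extn.tmul 1 p : Extn R B P) ∈
      Submodule.span (B ⊗[R] A) (S.image (Extn.tmul 1 : P → Extn R B P) : Set (Extn R B P)) := by
    intro p
    have hp : p ∈ Submodule.span A (S : Set P) := hS ▸ Submodule.mem_top
    induction hp using Submodule.span_induction with
    | mem p hp => exact Submodule.subset_span (by simpa using ⟨p, hp, rfl⟩)
    | zero =>
      have h0 : (Extn.tmul 1 0 : Extn R B P) = 0 := TensorProduct.tmul_zero P 1
      rw [h0]
      exact zero_mem _
    | add x y _ _ hx hy =>
      rw [Extn.tmul_add]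
      exact add_mem hx hy
    | smul a x _ hx =>
      have := Submodule.smul_mem _ ((1 : B) ⊗ₜ[R] a) hx
      rwa [Extn.tmul_smul_tmul, one_mul] at this
  induction x using Extn.induction_on with
  | zero => exact zero_mem _
  | add x y hx hy => exact add_mem (hx trivial) (hy trivial)
  | tmul b p =>
    have := Submodule.smul_mem _ (b ⊗ₜ[R] (1 : A)) (key p)
    rwa [Extn.tmul_smul_tmul, one_smul, mul_one] at this

/-- Two automorphisms over `R[X]` with equal extensions to `R_u[X]` and equal values at `X = 0`
become equal after substitution of a sufficiently divisible multiple of `X`. -/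
theorem exists_aeval_extends_eq [Module.Finite A P] (u : R)
    {φ ψ : QForm R A P R[X] ≃ₗ[R[X] ⊗[R] A] QForm R A P R[X]}
    (h_loc : ∀ x, mapForm (loc u) (φ x) = mapForm (loc u) (ψ x))
    (h_zero : ∀ x, mapForm (evalZero (R := R)) (φ x) = mapForm (evalZero (R := R)) (ψ x)) :
    ∃ n, ∀ (y : R[X]) (φ' ψ' : QForm R A P R[X] ≃ₗ[R[X] ⊗[R] A] QForm R A P R[X]),
      Extends (mapForm (subst (algebraMap R R[X] (u ^ n) * y)))
        (mapForm (subst (algebraMap R R[X] (u ^ n) * y))) φ φ' →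
      Extends (mapForm (subst (algebraMap R R[X] (u ^ n) * y)))
        (mapForm (subst (algebraMap R R[X] (u ^ n) * y))) ψ ψ' → φ' = ψ' := by
  have := Extn.finite (R := R) (A := A) (P := P) R[X]
  have hfin : Module.Finite (R[X] ⊗[R] A) (QForm R A P R[X]) :=
    Module.Finite.prod (M := Extn R R[X] P)
  obtain ⟨S, hS⟩ := hfin.fg_top
  have key : ∀ x : QForm R A P R[X], ∃ n, ∀ m, n ≤ m → ∀ y : R[X],
      mapForm (subst (algebraMap R R[X] (u ^ m) * y)) (φ x) =
        mapForm (subst (algebraMap R R[X] (u ^ m) * y)) (ψ x) := by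
    intro x
    have e1 : mapForm (loc u) (φ x - ψ x) = 0 := by rw [mapForm_sub, h_loc, sub_self]
    have e2 : mapForm (evalZero (R := R)) (φ x - ψ x) = 0 := by
      rw [mapForm_sub, h_zero, sub_self]
    obtain ⟨n₁, h₁⟩ := exists_rTensor_aeval_eq_zero (N := P) u (congrArg Prod.fst e1)
      (congrArg Prod.fst e2)
    obtain ⟨n₂, h₂⟩ := exists_rTensor_aeval_eq_zero (N := A) u
      (congrArg (fun z => z.2.1) e1) (congrArg (fun z => z.2.1) e2)
    obtain ⟨n₃, h₃⟩ := exists_rTensor_aeval_eq_zero (N := A) u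
      (congrArg (fun z => z.2.2) e1) (congrArg (fun z => z.2.2) e2)
    refine ⟨n₁ ⊔ n₂ ⊔ n₃, fun m hm y => ?_⟩
    rw [← sub_eq_zero, ← mapForm_sub]
    simp only [sup_le_iff] at hm
    exact Prod.ext (h₁ m hm.1.1 y) (Prod.ext (h₂ m hm.1.2 y) (h₃ m hm.2 y))
  choose f hf using key
  classical
  refine ⟨S.sup f, fun y φ' ψ' e e' => ?_⟩
  refine (isScalarExt_mapForm (subst _)).equiv_ext fun x => (e x).trans (Eq.trans ?_ (e' x).symm)
  have hx : x ∈ Submodule.span (R[X] ⊗[R] A) (S : Set (QForm R A P R[X])) :=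
    hS ▸ Submodule.mem_top
  induction hx using Submodule.span_induction with
  | mem x hx => exact hf x _ (Finset.le_sup hx) y
  | zero => rw [map_zero, map_zero]
  | add x x' _ _ h h' => rw [map_add, map_add, mapForm_add, mapForm_add, h, h']
  | smul a x _ h => rw [map_smul, map_smul, mapForm_smul, mapForm_smul, h]

end Compare

/-! ### Root elements over a localization at a maximal ideal -/

section Conjugate

variable {Λ M : Type*} [Ring Λ] [AddCommGroup M] [Module Λ M] {m : ℕ} {ε : ℤ} {J : Λ → Λ}
  {F : M → M → Λ} {b : Fin m ⊕ Fin m → M}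

theorem IsFrame.comp_isometry (hb : IsFrame ε F b) (g : M ≃ₗ[Λ] M)
    (hg : ∀ x y, F (g x) (g y) = F x y) : IsFrame ε F (fun k => g (b k)) where
  orth k l h := by rw [hg, hb.orth k l h]
  dual k := by rw [hg, hb.dual k]
  expand x := by
    obtain ⟨x, rfl⟩ := g.surjective x
    conv_lhs => rw [hb.expand x, map_sum]
    exact Finset.sum_congr rfl fun k _ => by rw [hg, map_zsmul, map_smul]

theorem IsFrame.conj_mem_rootGroup (hb : IsFrame ε F b) (H : HermForm ε J F) (g : M ≃ₗ[Λ] M)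
    (hg : ∀ x y, F (g x) (g y) = F x y) {S : Set Λ} {τ : M ≃ₗ[Λ] M}
    (hτ : τ ∈ rootGroup ε F b S) : g * τ * g⁻¹ ∈ rootGroup ε F (fun k => g (b k)) S := by
  induction hτ using Subgroup.closure_induction with
  | mem τ h =>
    obtain ⟨k, l, h, c, hc, rfl⟩ := h
    rw [H.conj_transv hg (H.isoPair_smul_right (hb.isoPair h) c), map_smul]
    exact Subgroup.subset_closure ⟨k, l, h, c, hc, rfl⟩
  | one => simp
  | mul g g' _ _ h h' => simpa [mul_assoc] using mul_mem h h'
  | inv g _ h => simpa [mul_assoc] using inv_mem h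

end Conjugate

section AtMaximal

variable {R A P : Type*} [CommRing R] [Ring A] [Algebra R A] [AddCommGroup P] [Module R P]
  [Module A P] [IsScalarTower R A P] {κ : Kind} {j : A →ₗ[R] A} {h : P →ₗ[R] P →ₗ[R] A}

theorem half_add_half {B : Type*} [CommRing B] [Algebra R B] {r : R} (hr : r + r = 1) :
    algebraMap R (B ⊗[R] A) r + algebraMap R (B ⊗[R] A) r = 1 := by
  rw [← map_add, hr, map_one]

/-- If some vector of the elementary orbit of the hyperbolic pair has an invertible coordinate,
then the elementary group moves the hyperbolic pair into the frame. All root elements of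
sufficiently small coefficients are then extended from elementary transvections. -/
theorem IsFrame.exists_rootGroup_le_of_coordinate (hj : IsInvolution j) (hh : IsForm κ j h) {r : R}
    (hr : r + r = 1) {u : R} {m : ℕ} (hm : 3 ≤ m)
    {b : Fin m ⊕ Fin m → QForm R A P (Localization.Away u)}
    (hb : IsFrame κ.sign (qForm κ j h _) b)
    {γ : QForm R A P (Localization.Away u) ≃ₗ[Localization.Away u ⊗[R] A]
      QForm R A P (Localization.Away u)} (hγ : γ ∈ rootGroup κ.sign (qForm κ j h _) b Set.univ)
    {i₀ : Fin m} {w : Localization.Away u ⊗[R] A}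
    (hw : qForm κ j h _ (γ (hypVec _ false)) (b (.inr i₀)) * w = 1) :
    ∃ N, rootGroup κ.sign (qForm κ j h _) (fun k => mapForm (const u) (b k))
      (imageFiltration A (loc u) u N : Set ((Localization.Away u)[X] ⊗[R] A)) ≤
        extendable (mapForm (loc u)) (eTransForm (P := Extn R R[X] P) κ (extForm R[X] h)) := by
  have H := hermForm_qForm (P := P) (Localization.Away u) hj hh
  have HX := hermForm_qForm (P := P) (Localization.Away u)[X] hj hh
  have iso := hb.rootGroup_isometry H hγ
  have hef : qForm κ j h _ (hypVec (Localization.Away u) false : QForm R A P _)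
      (hypVec _ true) = 1 := by
    simp [formQ, hypVec, extForm_zero_left, extInv_zero, extInv_one hj]
  obtain ⟨δ, hδ, i, h1, h2⟩ := hb.exists_move_pair H (by omega) (half_add_half hr)
    (fun a => algebraMap_mul_comm r a)
    (by rw [iso, (isoPair_hypVec_self false).left])
    (by rw [iso, (isoPair_hypVec_self true).left]) (by rw [iso, hef]) hw
  have hg := mul_mem hδ hγ
  have e1 : (δ * γ)⁻¹ (b (.inl i)) = hypVec _ false := by
    rw [← h1]
    exact (δ * γ).symm_apply_apply _
  have e2 : (δ * γ)⁻¹ (b (.inr i)) = hypVec _ true := by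
    rw [← h2]
    exact (δ * γ).symm_apply_apply _
  obtain ⟨N, hN⟩ := (hb.comp_isometry _ (hb.rootGroup_isometry H (inv_mem hg))).exists_rootGroup_le
    hj hh hr (by omega) i e1 e2
  obtain ⟨g, hgX, eg⟩ := exists_extends_rootGroup hj hh (const u) hb hg
  have hbX := hb.map hj hh (const u)
  obtain ⟨N', hN'⟩ := hbX.rootGroup_conj HX hm
    (isFiltration_imageFiltration (A := A) (isLocalizedModule_loc u))
    (fun N c hc => extInv_mem_imageFiltration j hc) (fun N => extInv_algebraMap hj _)
    (half_add_half hr) (fun a => algebraMap_mul_comm r a) hgX N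
  refine ⟨N', fun τ hτ => hN ?_⟩
  have h3 := hbX.conj_mem_rootGroup HX g⁻¹ (hbX.rootGroup_isometry HX (inv_mem hgX)) (hN' τ hτ)
  rw [inv_inv, ← mul_assoc, ← mul_assoc, inv_mul_cancel, one_mul, mul_assoc, inv_mul_cancel,
    mul_one] at h3
  convert h3 using 2
  ext1 k
  exact (eg.inv (b k)).symm

/-- Every maximal ideal of `R_s` has a basic open neighbourhood `u` such that the root elements of
a given frame of `Q_s` are extended from elementary transvections after localization at `u`, for
sufficiently small coefficients. -/
theorem IsFrame.exists_rootGroup_le_at_maximal [Module.Finite R A] (hj : IsInvolution j)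
    (hh : IsForm κ j h) {r : R}
    (hr : r + r = 1) {s : R} {m : ℕ} (hm : 3 ≤ m)
    {b : Fin m ⊕ Fin m → QForm R A P (Localization.Away s)}
    (hb : IsFrame κ.sign (qForm κ j h _) b) (𝔪 : Ideal (Localization.Away s)) [𝔪.IsMaximal] :
    ∃ u : R, algebraMap R (Localization.Away s) u ∉ 𝔪 ∧
      ∃ (ι : Localization.Away s →ₐ[R] Localization.Away u) (N : ℕ),
        rootGroup κ.sign (qForm κ j h _) (fun k => mapForm (const u) (mapForm ι (b k)))
          (imageFiltration A (loc u) u N : Set ((Localization.Away u)[X] ⊗[R] A)) ≤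
        extendable (mapForm (loc u)) (eTransForm (P := Extn R R[X] P) κ (extForm R[X] h)) := by
  have H := hermForm_qForm (P := P) (Localization.Away s) hj hh
  obtain ⟨I, hI, hreg, hlift⟩ :=
    exists_semisimple_residue (Λ := Localization.Away s ⊗[R] A) (Localization.Away s) 𝔪
  have hef : qForm κ j h _ (hypVec (Localization.Away s) false : QForm R A P _)
      (hypVec _ true) = 1 := by
    simp [formQ, hypVec, extForm_zero_left, extInv_zero, extInv_one hj]
  obtain ⟨γ, hγ, y, hy⟩ := hb.exists_coordinate_unit H hm hreg hef ⟨0, by omega⟩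
  obtain ⟨t, ht, z, hz⟩ := hlift _ y hy
  obtain ⟨⟨t₀, ⟨_, n, rfl⟩⟩, hn⟩ := IsLocalization.surj (Submonoid.powers s) t
  dsimp only at hn
  have hs : IsUnit (algebraMap R (Localization.Away s) s) := IsLocalization.Away.algebraMap_isUnit s
  have hs𝔪 : algebraMap R (Localization.Away s) s ∉ 𝔪 := fun hmem =>
    Ideal.IsPrime.ne_top' (𝔪.eq_top_of_isUnit_mem hmem hs)
  have hu : IsUnit (algebraMap R (Localization.Away (s * t₀)) (s * t₀)) :=
    IsLocalization.Away.algebraMap_isUnit _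
  rw [map_mul, IsUnit.mul_iff] at hu
  refine ⟨s * t₀, ?_, ?_⟩
  · rw [map_mul, ← hn, map_pow]
    intro hmem
    rcases Ideal.IsPrime.mem_or_mem ‹𝔪.IsMaximal›.isPrime hmem with h1 | h1
    · exact hs𝔪 h1
    · rcases Ideal.IsPrime.mem_or_mem ‹𝔪.IsMaximal›.isPrime h1 with h2 | h2
      · exact ht h2
      · exact hs𝔪 (Ideal.IsPrime.mem_of_pow_mem ‹𝔪.IsMaximal›.isPrime _ h2)
  let ι : Localization.Away s →ₐ[R] Localization.Away (s * t₀) :=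
    IsLocalization.Away.liftAlgHom (f := Algebra.ofId R _) s hu.1
  have hιt : IsUnit (ι t) := by
    have h1 := congrArg ι hn
    rw [map_mul, ι.commutes, ι.commutes] at h1
    exact isUnit_of_mul_isUnit_left (h1 ▸ hu.2)
  obtain ⟨t', ht'⟩ := hιt.exists_right_inv
  obtain ⟨γ', hγ', e⟩ := exists_extends_rootGroup hj hh ι hb hγ
  refine ⟨ι, (hb.map hj hh ι).exists_rootGroup_le_of_coordinate hj hh hr hm hγ'
    (i₀ := ⟨0, by omega⟩) (w := ringMapHom A ι z * (t' ⊗ₜ 1)) ?_⟩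
  rw [← mapForm_hypVec ι, e, qForm_mapForm, ← mul_assoc, ← map_mul, hz,
    Algebra.TensorProduct.algebraMap_apply, ringMapHom_tmul, Algebra.TensorProduct.tmul_mul_tmul]
  change (ι t * t') ⊗ₜ[R] ((1 : A) * 1) = _
  rw [ht', mul_one]
  rfl

end AtMaximal

/-! ### Patching -/

section Patch

variable {R A P : Type*} [CommRing R] [Ring A] [Algebra R A] [AddCommGroup P] [Module R P]
  [Module A P] [IsScalarTower R A P] {κ : Kind} {j : A →ₗ[R] A} {h : P →ₗ[R] P →ₗ[R] A}

omit [Module A P] [IsScalarTower R A P] in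
theorem mapForm_ofId {B B' : Type*} [CommRing B] [Algebra R B] [CommRing B'] [Algebra R B']
    (f : B →ₐ[R] B') (x : QForm R A P R) :
    mapForm f (mapForm (Algebra.ofId R B) x) = mapForm (Algebra.ofId R B') x := by
  rw [mapForm_comp]
  congr 1
  exact Subsingleton.elim _ _

omit [Module A P] [IsScalarTower R A P] in
theorem isoPair_ofId {v w : QForm R A P R} (hvw : IsoPair (qForm κ j h R) v w) (B : Type*)
    [CommRing B] [Algebra R B] : IsoPair (qForm κ j h B) (mapForm (Algebra.ofId R B) v)
      (mapForm (Algebra.ofId R B) w) := hvw.map _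

theorem extends_transv_ofId (hj : IsInvolution j) (hh : IsForm κ j h) {v w : QForm R A P R}
    (hvw : IsoPair (qForm κ j h R) v w) {B B' : Type*} [CommRing B] [Algebra R B] [CommRing B']
    [Algebra R B'] (f : B →ₐ[R] B') (d : B ⊗[R] A) :
    Extends (mapForm f) (mapForm f)
      (qTransv κ j h (mapForm (Algebra.ofId R B) v) (d • mapForm (Algebra.ofId R B) w))
      (qTransv κ j h (mapForm (Algebra.ofId R B') v)
        (ringMapHom A f d • mapForm (Algebra.ofId R B') w)) := by
  have := extends_transv hj hh f
    ((hermForm_qForm B hj hh).isoPair_smul_right (isoPair_ofId hvw B) d)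
  rwa [mapForm_smul, mapForm_ofId, mapForm_ofId] at this

theorem mapForm_transv_ofId_of_eq_zero (hj : IsInvolution j) (hh : IsForm κ j h)
    {v w : QForm R A P R} (hvw : IsoPair (qForm κ j h R) v w) {B B' : Type*} [CommRing B]
    [Algebra R B] [CommRing B'] [Algebra R B'] (f : B →ₐ[R] B') {d : B ⊗[R] A}
    (hd : ringMapHom A f d = 0) (x : QForm R A P B) :
    mapForm f (qTransv κ j h (mapForm (Algebra.ofId R B) v)
      (d • mapForm (Algebra.ofId R B) w) x) = mapForm f x := by
  rw [← extends_transv_ofId hj hh hvw f d x, hd, zero_smul, qTransv,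
    (hermForm_qForm B' hj hh).transv_zero_right (isoPair_ofId hvw B').left]
  rfl

/-- The endomorphism `X ↦ 0` of `R_u[X]`. -/
noncomputable def constPart (u : R) : (Localization.Away u)[X] →ₐ[R] (Localization.Away u)[X] :=
  (const u).comp ((Polynomial.aeval (0 : Localization.Away u)).restrictScalars R)

theorem loc_comp_subst_zero (u : R) :
    (loc u).comp (subst 0) = (constPart u).comp (loc u) :=
  Polynomial.algHom_ext (by simp [loc, constPart])

theorem subst_zero_comp : (subst (0 : R[X])).comp (subst 0) = subst 0 :=
  Polynomial.algHom_ext (by simp)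

theorem evalZero_comp_subst_zero : (evalZero (R := R)).comp (subst 0) = evalZero :=
  Polynomial.algHom_ext (by simp [evalZero])

/-- The automorphisms over `R_u[X]` that are extended from elementary transvections over
`R[X]`. -/
noncomputable abbrev liftableForm (κ : Kind) (h : P →ₗ[R] P →ₗ[R] A) (u : R) :
    Subgroup (QForm R A P (Localization.Away u)[X] ≃ₗ[(Localization.Away u)[X] ⊗[R] A]
      QForm R A P (Localization.Away u)[X]) :=
  extendable (Λ := R[X] ⊗[R] A) (Λ' := (Localization.Away u)[X] ⊗[R] A) (mapForm (loc u))
    (eTransForm (P := Extn R R[X] P) κ (extForm R[X] h))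

/-- An automorphism which reduces to the identity at `X = 0` and is extended from an elementary
transvection is extended from one which is the identity at `X = 0`. -/
theorem exists_eTransForm_of_extendable (hj : IsInvolution j) (hh : IsForm κ j h) {r : R}
    (hr : r + r = 1) (u : R)
    {g : QForm R A P (Localization.Away u)[X] ≃ₗ[(Localization.Away u)[X] ⊗[R] A]
      QForm R A P (Localization.Away u)[X]}
    (hg : g ∈ liftableForm κ h u)
    (hg' : ∀ x, mapForm (constPart u) (g x) = mapForm (constPart u) x) :
    ∃ τ ∈ eTransForm (P := Extn R R[X] P) κ (extForm R[X] h),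
      Extends (mapForm (loc u)) (mapForm (loc u)) τ g ∧
        ∀ x, mapForm (evalZero (R := R)) (τ x) = mapForm (evalZero (R := R)) x := by
  have hic := isScalarExt_mapForm (A := A) (P := P) ((loc u).comp (subst (0 : R[X])))
  have e : (mapForm ((loc u).comp (subst (0 : R[X]))) : QForm R A P R[X] → _) =
      fun x => mapForm (loc u) (mapForm (subst 0) x) := funext fun x => (mapForm_comp _ _ x).symm
  rw [e] at hic
  obtain ⟨τ, hτ, h1, h2⟩ := exists_reduction_eq_id (isScalarExt_mapForm (subst (0 : R[X])))
    (isScalarExt_mapForm (loc u)) hic (c' := mapForm (constPart u))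
    (fun x => by rw [mapForm_comp, subst_zero_comp])
    (fun x => by rw [mapForm_comp, mapForm_comp, loc_comp_subst_zero])
    (fun τ hτ => exists_extends_eTransForm hj hh hr (subst (0 : R[X])) hτ) hg hg'
  refine ⟨τ, hτ, h1, fun x => ?_⟩
  have := congrArg (mapForm (evalZero (R := R))) (h2 x)
  rwa [mapForm_comp, mapForm_comp, evalZero_comp_subst_zero] at this

/-- If the root elements of a totally isotropic pair are extended from elementary transvections
over `R_u[X]`, for small coefficients, then they are elementary transvections over `R[X]` if their
coefficients are divisible by a power of `u`. -/
theorem exists_transv_mem_of_localized [Module.Finite A P] (hj : IsInvolution j)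
    (hh : IsForm κ j h) {r : R} (hr : r + r = 1) {v w : QForm R A P R}
    (hvw : IsoPair (qForm κ j h R) v w) (a : A) {u : R} {N : ℕ}
    (hN : ∀ c ∈ imageFiltration A (loc u) u N, qTransv κ j h (mapForm (Algebra.ofId R _) v)
      (c • mapForm (Algebra.ofId R _) w) ∈ liftableForm κ h u) :
    ∃ K, ∀ y : R[X], qTransv κ j h (mapForm (Algebra.ofId R R[X]) v)
      (((algebraMap R R[X] (u ^ K) * y) ⊗ₜ[R] a) • mapForm (Algebra.ofId R R[X]) w) ∈
        eTransForm (P := Extn R R[X] P) κ (extForm R[X] h) := by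
  have hmem : ringMapHom A (loc u) ((algebraMap R R[X] (u ^ N) * Polynomial.X) ⊗ₜ[R] a) ∈
      imageFiltration A (loc u) u N := mem_imageFiltration.2 ⟨Polynomial.X ⊗ₜ a, by
    rw [← ringMapHom_algebraMap (loc u), ← map_mul, Algebra.TensorProduct.algebraMap_apply,
      Algebra.TensorProduct.tmul_mul_tmul, one_mul]⟩
  have hz : ∀ {B : Type _} [CommRing B] [Algebra R B] (f : R[X] →ₐ[R] B), f Polynomial.X = 0 →
      ringMapHom A f ((algebraMap R R[X] (u ^ N) * Polynomial.X) ⊗ₜ[R] a) = 0 := by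
    intro B _ _ f hf
    rw [ringMapHom_tmul, map_mul, hf, mul_zero, TensorProduct.zero_tmul]
  obtain ⟨τ, hτ, h1, h2⟩ := exists_eTransForm_of_extendable hj hh hr u (hN _ hmem) fun x =>
    mapForm_transv_ofId_of_eq_zero hj hh hvw (constPart u) (by
      rw [ringMapHom_comp]
      exact hz _ (by simp [loc, constPart])) x
  have h3 := extends_transv_ofId hj hh hvw (loc u)
    ((algebraMap R R[X] (u ^ N) * Polynomial.X) ⊗ₜ[R] a)
  obtain ⟨n, hn⟩ := exists_aeval_extends_eq u (fun x => (h3 x).symm.trans (h1 x)) (fun x => by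
    rw [h2]
    exact mapForm_transv_ofId_of_eq_zero hj hh hvw evalZero (hz _ (by simp [evalZero])) x)
  refine ⟨N + n, fun y => ?_⟩
  obtain ⟨τ', hτ', h4⟩ := exists_extends_eTransForm hj hh hr
    (subst (algebraMap R R[X] (u ^ n) * y)) hτ
  have h5 := hn y _ _ (extends_transv_ofId hj hh hvw _ _) h4
  rw [ringMapHom_tmul, map_mul, AlgHom.commutes, subst, Polynomial.aeval_X, ← mul_assoc, ← map_mul,
    ← pow_add] at h5
  rw [h5]
  exact hτ'

/-- The coefficients of `R` for which root elements are elementary transvections form an ideal,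
which can therefore be computed locally. -/
theorem exists_transv_mem_of_maximal (hj : IsInvolution j) (hh : IsForm κ j h)
    {v w : QForm R A P R} (hvw : IsoPair (qForm κ j h R) v w) (a : A) (s : R)
    (hloc : ∀ 𝔪 : Ideal (Localization.Away s), 𝔪.IsMaximal → ∃ d,
      algebraMap R (Localization.Away s) d ∉ 𝔪 ∧
      ∀ y : R[X], qTransv κ j h (mapForm (Algebra.ofId R R[X]) v)
        (((algebraMap R R[X] d * y) ⊗ₜ[R] a) • mapForm (Algebra.ofId R R[X]) w) ∈
          eTransForm (P := Extn R R[X] P) κ (extForm R[X] h)) :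
    ∃ K, ∀ y : R[X], qTransv κ j h (mapForm (Algebra.ofId R R[X]) v)
      (((algebraMap R R[X] (s ^ K) * y) ⊗ₜ[R] a) • mapForm (Algebra.ofId R R[X]) w) ∈
        eTransForm (P := Extn R R[X] P) κ (extForm R[X] h) := by
  have H := hermForm_qForm (P := P) R[X] hj hh
  have iso := isoPair_ofId hvw R[X]
  let D : Ideal R :=
    { carrier := {d | ∀ y : R[X], qTransv κ j h (mapForm (Algebra.ofId R R[X]) v)
        (((algebraMap R R[X] d * y) ⊗ₜ[R] a) • mapForm (Algebra.ofId R R[X]) w) ∈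
          eTransForm (P := Extn R R[X] P) κ (extForm R[X] h)}
      add_mem' := fun {d d'} hd hd' y => by
        rw [map_add, add_mul, TensorProduct.add_tmul, qTransv, ← H.transv_smul_mul iso]
        exact mul_mem (hd y) (hd' y)
      zero_mem' := fun y => by
        have h0 : ((algebraMap R R[X] 0 * y) ⊗ₜ[R] a) • mapForm (Algebra.ofId R R[X]) w = 0 := by
          rw [map_zero, zero_mul, TensorProduct.zero_tmul]
          exact zero_smul (R[X] ⊗[R] A) (mapForm (Algebra.ofId R R[X]) w)
        rw [h0, qTransv, H.transv_zero_right iso.left]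
        exact one_mem _
      smul_mem' := fun c d hd y => by
        rw [smul_eq_mul, mul_comm c d, map_mul, mul_assoc]
        exact hd _ }
  by_contra! hcon
  have hdisj : Disjoint (Submonoid.powers s : Set R) (D : Set R) := by
    rw [Set.disjoint_left]
    rintro _ ⟨K, rfl⟩ hK
    obtain ⟨y, hy⟩ := hcon K
    exact hy (hK y)
  have hne := (IsLocalization.map_algebraMap_ne_top_iff_disjoint (Submonoid.powers s)
    (Localization.Away s) D).2 hdisj
  obtain ⟨𝔪, h𝔪, hle⟩ := Ideal.exists_le_maximal _ hne
  obtain ⟨d, hd, hdD⟩ := hloc 𝔪 h𝔪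
  exact hd (hle (Ideal.mem_map_of_mem _ (show d ∈ D from hdD)))

end Patch

section PatchFrame

variable {R A P : Type*} [CommRing R] [Ring A] [Algebra R A] [AddCommGroup P] [Module R P]
  [Module A P] [IsScalarTower R A P] {κ : Kind} {j : A →ₗ[R] A} {h : P →ₗ[R] P →ₗ[R] A}

theorem exists_mapForm_eq {B B' : Type*} [CommRing B] [Algebra R B] [CommRing B'] [Algebra R B']
    {f : B →ₐ[R] B'} {u : R} (hf : IsLocalizedModule (Submonoid.powers u) f.toLinearMap)
    (x : QForm R A P B') :
    ∃ N, ∀ n, N ≤ n → ∃ y, mapForm f y = algebraMap R (B' ⊗[R] A) (u ^ n) • x := by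
  obtain ⟨p, b, a⟩ := x
  obtain ⟨n₁, y₁, h₁⟩ := Extn.exists_map_eq (A := A) hf p
  obtain ⟨n₂, y₂, h₂⟩ := exists_ringMap_eq hf b
  obtain ⟨n₃, y₃, h₃⟩ := exists_ringMap_eq hf a
  refine ⟨n₁ ⊔ n₂ ⊔ n₃, fun n hn => ?_⟩
  simp only [sup_le_iff] at hn
  refine ⟨(algebraMap R (B ⊗[R] A) (u ^ (n - n₁)) • y₁, algebraMap R _ (u ^ (n - n₂)) * y₂,
    algebraMap R _ (u ^ (n - n₃)) * y₃), Prod.ext ?_ (Prod.ext ?_ ?_)⟩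
  · change Extn.map f (algebraMap R (B ⊗[R] A) (u ^ (n - n₁)) • y₁) = algebraMap R _ (u ^ n) • p
    rw [Extn.map_smul, ringMapHom_algebraMap, ← h₁, smul_smul, ← map_mul, ← pow_add,
      Nat.sub_add_cancel hn.1.1]
  · change ringMapHom A f (algebraMap R _ (u ^ (n - n₂)) * y₂) = algebraMap R _ (u ^ n) * b
    rw [map_mul, ringMapHom_algebraMap, ← h₂, ← mul_assoc, ← map_mul, ← pow_add,
      Nat.sub_add_cancel hn.1.2]
  · change ringMapHom A f (algebraMap R _ (u ^ (n - n₃)) * y₃) = algebraMap R _ (u ^ n) * a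
    rw [map_mul, ringMapHom_algebraMap, ← h₃, ← mul_assoc, ← map_mul, ← pow_add,
      Nat.sub_add_cancel hn.2]

/-- A frame of `Q_s` lifts to `Q` up to a power of `s`, with the orthogonality relations. -/
theorem IsFrame.exists_lift (hj : IsInvolution j) (hh : IsForm κ j h) {s : R} {m : ℕ}
    {b : Fin m ⊕ Fin m → QForm R A P (Localization.Away s)}
    (hb : IsFrame κ.sign (qForm κ j h _) b) :
    ∃ (n : ℕ) (v : Fin m ⊕ Fin m → QForm R A P R),
      (∀ k, mapForm (Algebra.ofId R (Localization.Away s)) (v k) =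
        algebraMap R (Localization.Away s ⊗[R] A) (s ^ n) • b k) ∧
      ∀ k l, l ≠ k.swap → qForm κ j h R (v k) (v l) = 0 := by
  have H := hermForm_qForm (P := P) (Localization.Away s) hj hh
  have HR := hermForm_qForm (P := P) R hj hh
  choose N hN using fun k => exists_mapForm_eq (isLocalizedModule_ofId s) (b k)
  choose y hy using fun k => hN k (Finset.univ.sup N) (Finset.le_sup (Finset.mem_univ k))
  have hann : ∀ k l, ∃ n, l ≠ Sum.swap k →
      algebraMap R (R ⊗[R] A) (s ^ n) * qForm κ j h R (y k) (y l) = 0 := by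
    intro k l
    by_cases hkl : l = Sum.swap k
    · exact ⟨0, fun h => absurd hkl h⟩
    · obtain ⟨n, hn⟩ := exists_mul_eq_zero (isLocalizedModule_ofId s)
        (d := qForm κ j h R (y k) (y l)) (by
          rw [← qForm_mapForm, hy, hy, H.smul_left, H.smul_right, hb.orth k l hkl, zero_mul,
            mul_zero])
      exact ⟨n, fun _ => hn⟩
  choose e he using hann
  set K := Finset.univ.sup fun p : (Fin m ⊕ Fin m) × (Fin m ⊕ Fin m) => e p.1 p.2 with hK
  refine ⟨K + Finset.univ.sup N, fun k => algebraMap R (R ⊗[R] A) (s ^ K) • y k, fun k => ?_,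
    fun k l hkl => ?_⟩
  · rw [mapForm_smul, ringMapHom_algebraMap, hy, smul_smul, ← map_mul, pow_add]
  · have hle : e k l ≤ K := Finset.le_sup
      (f := fun p : (Fin m ⊕ Fin m) × (Fin m ⊕ Fin m) => e p.1 p.2) (Finset.mem_univ (k, l))
    rw [HR.smul_left, HR.smul_right,
      ← mul_assoc, ← Nat.sub_add_cancel hle, pow_add, map_mul, mul_assoc (algebraMap R _ _),
      he k l hkl, mul_zero, zero_mul]

/-- Root elements whose coefficients are divisible by a high power of `s` are elementary
transvections if this holds for the coefficients `y ⊗ a` with fixed `a`, because `A` is finite over `R`. -/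
theorem exists_transv_mem_of_tmul [Module.Finite R A] (hj : IsInvolution j) (hh : IsForm κ j h)
    {v w : QForm R A P R} (hvw : IsoPair (qForm κ j h R) v w) {s : R}
    (hs : ∀ a : A, ∃ K, ∀ y : R[X], qTransv κ j h (mapForm (Algebra.ofId R R[X]) v)
      (((algebraMap R R[X] (s ^ K) * y) ⊗ₜ[R] a) • mapForm (Algebra.ofId R R[X]) w) ∈
        eTransForm (P := Extn R R[X] P) κ (extForm R[X] h)) :
    ∃ M, ∀ n, M ≤ n → ∀ d : R[X] ⊗[R] A, qTransv κ j h (mapForm (Algebra.ofId R R[X]) v)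
      ((algebraMap R _ (s ^ n) * d) • mapForm (Algebra.ofId R R[X]) w) ∈
        eTransForm (P := Extn R R[X] P) κ (extForm R[X] h) := by
  have H := hermForm_qForm (P := P) R[X] hj hh
  have iso := isoPair_ofId hvw R[X]
  let E : AddSubgroup (R[X] ⊗[R] A) :=
    { carrier := {d | qTransv κ j h (mapForm (Algebra.ofId R R[X]) v)
        (d • mapForm (Algebra.ofId R R[X]) w) ∈
          eTransForm (P := Extn R R[X] P) κ (extForm R[X] h)}
      add_mem' := fun {d d'} hd hd' => by
        rw [Set.mem_ofPred_eq, qTransv, ← H.transv_smul_mul iso]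
        exact mul_mem hd hd'
      zero_mem' := by
        rw [Set.mem_ofPred_eq, zero_smul (R[X] ⊗[R] A) (mapForm (Algebra.ofId R R[X]) w), qTransv,
          H.transv_zero_right iso.left]
        exact one_mem _
      neg_mem' := fun {d} hd => by
        rw [Set.mem_ofPred_eq, neg_smul, qTransv,
          ← H.transv_inv (H.isoPair_smul_right iso d)]
        exact inv_mem hd }
  obtain ⟨S, hS⟩ := Module.Finite.fg_top (R := R) (M := A)
  choose K hK using hs
  refine ⟨S.sup K, fun n hn d => show _ ∈ E from ?_⟩
  induction d using TensorProduct.induction_on with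
  | zero => rw [mul_zero]; exact zero_mem _
  | add x y hx hy => rw [mul_add]; exact add_mem hx hy
  | tmul y a =>
    have ha : a ∈ Submodule.span R (S : Set A) := hS ▸ Submodule.mem_top
    induction ha using Submodule.span_induction generalizing y with
    | mem a ha =>
      have hle : K a ≤ n := (Finset.le_sup ha).trans hn
      have h1 : algebraMap R (R[X] ⊗[R] A) (s ^ n) * y ⊗ₜ[R] a =
          (algebraMap R R[X] (s ^ K a) * (algebraMap R R[X] (s ^ (n - K a)) * y)) ⊗ₜ a := by
        rw [← mul_assoc, ← map_mul, ← pow_add, Nat.add_sub_cancel' hle,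
          Algebra.TensorProduct.algebraMap_apply, Algebra.TensorProduct.tmul_mul_tmul, one_mul]
      rw [h1]
      exact hK a _
    | zero => rw [TensorProduct.tmul_zero, mul_zero]; exact zero_mem _
    | add a a' _ _ h h' => rw [TensorProduct.tmul_add, mul_add]; exact add_mem (h y) (h' y)
    | smul c a _ h => rw [← TensorProduct.smul_tmul]; exact h (c • y)

/-- All root elements over `A_s[X]` with respect to a frame of `Q_s` are extended from elementary
transvections over `A[X]`, for sufficiently small coefficients. -/
theorem IsFrame.exists_rootGroup_le_liftable [Module.Finite R A] [Module.Finite A P]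
    (hj : IsInvolution j) (hh : IsForm κ j h) {r : R}
    (hr : r + r = 1) {s : R} {m : ℕ} (hm : 3 ≤ m)
    {b : Fin m ⊕ Fin m → QForm R A P (Localization.Away s)}
    (hb : IsFrame κ.sign (qForm κ j h _) b) :
    ∃ N, rootGroup κ.sign (qForm κ j h _) (fun k => mapForm (const s) (b k))
      (imageFiltration A (loc s) s N : Set ((Localization.Away s)[X] ⊗[R] A)) ≤
        liftableForm κ h s := by
  obtain ⟨n, v, hv, horth⟩ := hb.exists_lift hj hh
  have hvf : ∀ {B : Type _} [CommRing B] [Algebra R B] (f : Localization.Away s →ₐ[R] B) k,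
      mapForm (Algebra.ofId R B) (v k) = algebraMap R (B ⊗[R] A) (s ^ n) • mapForm f (b k) := by
    intro B _ _ f k
    rw [← mapForm_ofId f, hv, mapForm_smul, ringMapHom_algebraMap]
  have htr : ∀ {B : Type _} [CommRing B] [Algebra R B] (f : Localization.Away s →ₐ[R] B) k l,
      l ≠ Sum.swap k → ∀ c : B ⊗[R] A, qTransv κ j h (mapForm (Algebra.ofId R B) (v k))
        (c • mapForm (Algebra.ofId R B) (v l)) = qTransv κ j h (mapForm f (b k))
          ((algebraMap R _ (s ^ (n + n)) * c) • mapForm f (b l)) := by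
    intro B _ _ f k l hkl c
    have H := hermForm_qForm (P := P) B hj hh
    rw [hvf f, hvf f, smul_smul, qTransv, H.transv_smul_left (H.isoPair_smul_right
      ((hb.map hj hh f).isoPair hkl) _), extInv_algebraMap hj, smul_smul, ← algebraMap_mul_comm,
      ← mul_assoc, ← map_mul, ← pow_add]
  have iso : ∀ {k l}, l ≠ Sum.swap k → IsoPair (qForm κ j h R) (v k) (v l) := fun {k l} hkl =>
    ⟨horth _ _ (sum_swap_ne k).symm, horth _ _ (sum_swap_ne l).symm, horth _ _ hkl⟩
  have key : ∀ k l, ∃ M, l ≠ Sum.swap k → ∀ n, M ≤ n → ∀ d : R[X] ⊗[R] A,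
      qTransv κ j h (mapForm (Algebra.ofId R R[X]) (v k))
        ((algebraMap R _ (s ^ n) * d) • mapForm (Algebra.ofId R R[X]) (v l)) ∈
          eTransForm (P := Extn R R[X] P) κ (extForm R[X] h) := by
    intro k l
    by_cases hkl : l = Sum.swap k
    · exact ⟨0, fun h => absurd hkl h⟩
    obtain ⟨M, hM⟩ := exists_transv_mem_of_tmul hj hh (iso hkl) (s := s) fun a =>
      exists_transv_mem_of_maximal hj hh (iso hkl) a s fun 𝔪 h𝔪 => by
        obtain ⟨u, hu, ι, N, hN⟩ := hb.exists_rootGroup_le_at_maximal hj hh hr hm 𝔪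
        obtain ⟨K, hK⟩ := exists_transv_mem_of_localized hj hh hr (iso hkl) a (u := u) (N := N)
          fun c hc => by
            rw [htr ((const u).comp ι) k l hkl]
            refine hN ?_
            rw [← mapForm_comp, ← mapForm_comp]
            refine transv_mem_rootGroup hkl ?_
            obtain ⟨d, rfl⟩ := mem_imageFiltration.1 hc
            refine mem_imageFiltration.2 ⟨algebraMap R _ (s ^ (n + n)) * d, ?_⟩
            rw [map_mul, ringMapHom_algebraMap, ← mul_assoc, ← mul_assoc,
              algebraMap_mul_comm]
        refine ⟨u ^ K, fun hmem => hu (h𝔪.isPrime.mem_of_pow_mem K ?_), hK⟩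
        rwa [← map_pow]
    exact ⟨M, fun _ => hM⟩
  choose M hM using key
  set K := Finset.univ.sup fun p : (Fin m ⊕ Fin m) × (Fin m ⊕ Fin m) => M p.1 p.2 with hK
  refine ⟨n + n + K, (Subgroup.closure_le _).2 ?_⟩
  rintro _ ⟨k, l, hkl, c, hc, rfl⟩
  obtain ⟨d, rfl⟩ := mem_imageFiltration.1 hc
  have hle : M k l ≤ K := Finset.le_sup
    (f := fun p : (Fin m ⊕ Fin m) × (Fin m ⊕ Fin m) => M p.1 p.2) (Finset.mem_univ (k, l))
  refine ⟨_, hM k l hkl K hle d, ?_⟩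
  have h1 := extends_transv_ofId hj hh (iso hkl) (loc s) (algebraMap R _ (s ^ K) * d)
  rwa [htr (const s) k l hkl, map_mul, ringMapHom_algebraMap, ← mul_assoc, ← map_mul,
    ← pow_add] at h1

end PatchFrame

/-! ### Substitution of multiples of the variable -/

section Scaling

/-- Let `f t` be endomorphisms of a module that act on root elements `x α c` through their
coefficients, and suppose that `f t` is close to `f₀` on coefficients for `t` in a small set. Then
for every product `g` of root elements the extensions of `g` along `f t` and `f₀` are close. -/
theorem exists_extends_near {Λ M ι β : Type*} [Ring Λ] [AddCommGroup M] [Module Λ M]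
    (x : ι → Λ → (M ≃ₗ[Λ] M)) {Φ : ℕ → AddSubgroup Λ} {V : ℕ → Set β} (hV : Antitone V)
    {f : β → M → M} {ρ : β → Λ → Λ} {f₀ : M → M} {ρ₀ : Λ → Λ}
    (hx : ∀ α c c', x α c * (x α c')⁻¹ = x α (c - c'))
    (hf : ∀ t α c, Extends (f t) (f t) (x α c) (x α (ρ t c)))
    (hf₀ : ∀ α c, Extends f₀ f₀ (x α c) (x α (ρ₀ c)))
    (hρ : ∀ c N, ∃ l, ∀ t ∈ V l, ρ t c - ρ₀ c ∈ Φ N)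
    (hconj : ∀ γ ∈ Subgroup.closure {g | ∃ α, ∃ c ∈ (Set.univ : Set Λ), g = x α c}, ∀ N, ∃ N',
      ∀ g ∈ Subgroup.closure {g | ∃ α, ∃ c ∈ (Φ N' : Set Λ), g = x α c},
        γ * g * γ⁻¹ ∈ Subgroup.closure {g | ∃ α, ∃ c ∈ (Φ N : Set Λ), g = x α c})
    {g : M ≃ₗ[Λ] M}
    (hg : g ∈ Subgroup.closure {g | ∃ α, ∃ c ∈ (Set.univ : Set Λ), g = x α c}) :
    ∃ g₀ ∈ Subgroup.closure {g | ∃ α, ∃ c ∈ (Set.univ : Set Λ), g = x α c},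
      Extends f₀ f₀ g g₀ ∧ ∀ N, ∃ l, ∀ t ∈ V l, ∃ g' : M ≃ₗ[Λ] M, Extends (f t) (f t) g g' ∧
        g' * g₀⁻¹ ∈ Subgroup.closure {g | ∃ α, ∃ c ∈ (Φ N : Set Λ), g = x α c} := by
  induction hg using Subgroup.closure_induction with
  | mem g hg =>
    obtain ⟨α, c, -, rfl⟩ := hg
    refine ⟨x α (ρ₀ c), Subgroup.subset_closure ⟨α, _, trivial, rfl⟩, hf₀ α c, fun N => ?_⟩
    obtain ⟨l, hl⟩ := hρ c N
    exact ⟨l, fun t ht => ⟨_, hf t α c, Subgroup.subset_closure ⟨α, _, hl t ht, hx _ _ _⟩⟩⟩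
  | one => exact ⟨1, one_mem _, Extends.one, fun N => ⟨0, fun t _ => ⟨1, Extends.one, by simp⟩⟩⟩
  | mul g h _ _ ihg ihh =>
    obtain ⟨g₀, hg₀, eg, ihg⟩ := ihg
    obtain ⟨h₀, hh₀, eh, ihh⟩ := ihh
    refine ⟨g₀ * h₀, mul_mem hg₀ hh₀, eg.mul eh, fun N => ?_⟩
    obtain ⟨N', hN'⟩ := hconj g₀ hg₀ N
    obtain ⟨l, hl⟩ := ihg N
    obtain ⟨l', hl'⟩ := ihh N'
    refine ⟨l ⊔ l', fun t ht => ?_⟩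
    obtain ⟨g', eg', hg'⟩ := hl t (hV le_sup_left ht)
    obtain ⟨h', eh', hh'⟩ := hl' t (hV le_sup_right ht)
    refine ⟨g' * h', eg'.mul eh', ?_⟩
    have := mul_mem hg' (hN' _ hh')
    convert this using 1
    group
  | inv g _ ihg =>
    obtain ⟨g₀, hg₀, eg, ihg⟩ := ihg
    refine ⟨g₀⁻¹, inv_mem hg₀, eg.inv, fun N => ?_⟩
    obtain ⟨N', hN'⟩ := hconj g₀⁻¹ (inv_mem hg₀) N
    obtain ⟨l, hl⟩ := ihg N'
    refine ⟨l, fun t ht => ?_⟩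
    obtain ⟨g', eg', hg'⟩ := hl t ht
    refine ⟨g'⁻¹, eg'.inv, ?_⟩
    have := hN' _ (inv_mem hg')
    convert this using 1
    group

/-- If `σ` is the identity at zero, then so is its localization. -/
theorem extends_eq_one {Λ Λ' M M' : Type*} [Ring Λ] [Ring Λ']
    [AddCommGroup M] [Module Λ M] [AddCommGroup M'] [Module Λ' M'] {ρic : Λ →+* Λ'} {c : M → M}
    {i : M → M'} {c' : M' → M'} (hic : IsScalarExt ρic fun x => i (c x))
    (hci : ∀ x, i (c x) = c' (i x)) {σ : M ≃ₗ[Λ] M} {σ' g₀ : M' ≃ₗ[Λ'] M'}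
    (hσ : ∀ x, c (σ x) = c x) (e : Extends i i σ σ') (eg : Extends c' c' σ' g₀) : g₀ = 1 :=
  hic.equiv_ext fun x => by
    rw [hci, eg, e, ← hci, hσ, hci]
    rfl

/-- Here `i` is a localization map, `f` and `f'` are the substitution of a multiple of the
variable, and `c` and `c'` are the reduction at zero. If the substitution in the localization of
`σ` is extended from the group `K`, then it is extended from an element of `K` that is the identity
at zero, and which agrees with the substitution in `σ` after localization. -/
theorem exists_reduction_eq_id_of_extends {Λ Λ' M M' : Type*} [Ring Λ] [Ring Λ']
    [AddCommGroup M] [Module Λ M] [AddCommGroup M'] [Module Λ' M'] {ρc ρf : Λ →+* Λ}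
    {ρi ρic ρif : Λ →+* Λ'} {ρc' : Λ' →+* Λ'} {c f : M → M} {i : M → M'} {c' f' : M' → M'}
    (hc : IsScalarExt ρc c) (hf : IsScalarExt ρf f) (hi : IsScalarExt ρi i)
    (hic : IsScalarExt ρic fun x => i (c x)) (hif : IsScalarExt ρif fun x => i (f x))
    (hc' : IsScalarExt ρc' c') (hcc : ∀ x, c (c x) = c x) (hci : ∀ x, i (c x) = c' (i x))
    (hfi : ∀ x, i (f x) = f' (i x)) (hcf : ∀ y, c' (f' y) = c' y) {K : Subgroup (M ≃ₗ[Λ] M)}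
    (hK : ∀ τ ∈ K, ∃ τ' ∈ K, Extends c c τ τ') {σ : M ≃ₗ[Λ] M} {σ' g : M' ≃ₗ[Λ'] M'}
    (hσ : ∀ x, c (σ x) = c x) (e : Extends i i σ σ') (eg : Extends f' f' σ' g)
    (hg : g ∈ extendable i K) :
    ∃ τ ∈ K, (∀ x, c (τ x) = c x) ∧ ∃ ρ : M ≃ₗ[Λ] M, Extends f f σ ρ ∧
      ∀ x, i (τ x) = i (ρ x) := by
  have hσ' : ∀ y, c' (σ' y) = c' y := by
    obtain ⟨g₀, eg₀⟩ := hc'.exists_extends σ'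
    intro y
    rw [← eg₀, extends_eq_one hic hci hσ e eg₀]
    rfl
  have hg' : ∀ y, c' (g y) = c' y := by
    obtain ⟨g₀, eg₀⟩ := hc'.exists_extends g
    have h1 : g₀ = 1 := hc'.equiv_ext fun y => by
      rw [← hcf, eg₀, eg, hcf, hσ', hcf]
      rfl
    intro y
    rw [← eg₀, h1]
    rfl
  obtain ⟨τ, hτ, eτ, hτ0⟩ := exists_reduction_eq_id hc hi hic hcc hci hK hg hg'
  obtain ⟨ρ, eρ⟩ := hf.exists_extends σ
  obtain ⟨ρ', eρ'⟩ := hi.exists_extends ρ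
  have h1 : ρ' = g := hif.equiv_ext fun x => by
    rw [eρ', eρ, hfi, ← e, ← eg, ← hfi]
  exact ⟨τ, hτ, hτ0, ρ, eρ, fun x => by rw [← eτ, ← eρ', h1]⟩

variable {R A P : Type*} [CommRing R] [Ring A] [Algebra R A] [AddCommGroup P] [Module R P]

/-- The substitution `X ↦ b X`, as an endomorphism of `R_s[X]`. -/
noncomputable def scaleLoc (s b : R) : (Localization.Away s)[X] →ₐ[R] (Localization.Away s)[X] :=
  (Polynomial.aeval (Polynomial.C (algebraMap R (Localization.Away s) b) * Polynomial.X :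
    (Localization.Away s)[X])).restrictScalars R

theorem ofId_comp_evalZero : (Algebra.ofId R R[X]).comp evalZero = subst 0 :=
  Polynomial.algHom_ext (by simp [evalZero])

theorem scaleLoc_comp_loc (s b : R) : (scaleLoc s b).comp (loc s) = (loc s).comp (scale b) :=
  Polynomial.algHom_ext (by simp [scaleLoc, loc, scale])

theorem scaleLoc_comp_const (s b : R) : (scaleLoc s b).comp (const s) = const s :=
  AlgHom.ext fun r => by simp [scaleLoc, const]

theorem constPart_comp_const (s : R) : (constPart s).comp (const s) = const s :=
  AlgHom.ext fun r => by simp [constPart, const]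

theorem constPart_comp_scaleLoc (s b : R) : (constPart s).comp (scaleLoc s b) = constPart s :=
  AlgHom.ext fun p => by
    induction p using Polynomial.induction_on' with
    | add p q hp hq => rw [map_add, map_add, hp, hq]
    | monomial n a =>
      rw [← Polynomial.C_mul_X_pow_eq_monomial]
      simp [constPart, scaleLoc, const]

/-- The substitutions `X ↦ b X` and `X ↦ 0` differ by small elements if `b` is divisible by a high
power of `s`. -/
theorem exists_scaleLoc_sub_mem (s : R) (c : (Localization.Away s)[X] ⊗[R] A) (N : ℕ) :
    ∃ l, ∀ b ∈ Ideal.span {s ^ l},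
      ringMapHom A (scaleLoc s b) c - ringMapHom A (constPart s) c ∈
        imageFiltration A (loc s) s N := by
  have hadd : ∀ c c' : (Localization.Away s)[X] ⊗[R] A,
      (∃ l, ∀ b ∈ Ideal.span {s ^ l}, ringMapHom A (scaleLoc s b) c -
        ringMapHom A (constPart s) c ∈ imageFiltration A (loc s) s N) →
      (∃ l, ∀ b ∈ Ideal.span {s ^ l}, ringMapHom A (scaleLoc s b) c' -
        ringMapHom A (constPart s) c' ∈ imageFiltration A (loc s) s N) →
      ∃ l, ∀ b ∈ Ideal.span {s ^ l}, ringMapHom A (scaleLoc s b) (c + c') -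
        ringMapHom A (constPart s) (c + c') ∈ imageFiltration A (loc s) s N := by
    rintro c c' ⟨l, hl⟩ ⟨l', hl'⟩
    refine ⟨l ⊔ l', fun b hb => ?_⟩
    have hle : ∀ k, k ≤ l ⊔ l' → b ∈ Ideal.span {s ^ k} := fun k hk =>
      Ideal.span_singleton_le_span_singleton.2 (pow_dvd_pow s hk) hb
    rw [map_add, map_add, add_sub_add_comm]
    exact add_mem (hl b (hle l le_sup_left)) (hl' b (hle l' le_sup_right))
  induction c using TensorProduct.induction_on with
  | zero => exact ⟨0, fun b _ => by rw [map_zero, map_zero, sub_zero]; exact zero_mem _⟩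
  | add c c' h h' => exact hadd c c' h h'
  | tmul p a =>
    induction p using Polynomial.induction_on' with
    | add p q hp hq => rw [TensorProduct.add_tmul]; exact hadd _ _ hp hq
    | monomial n r =>
      rw [← Polynomial.C_mul_X_pow_eq_monomial]
      cases n with
      | zero =>
        refine ⟨0, fun b _ => ?_⟩
        rw [ringMapHom_tmul, ringMapHom_tmul]
        have : scaleLoc s b (Polynomial.C r * Polynomial.X ^ 0) =
            constPart s (Polynomial.C r * Polynomial.X ^ 0) := by
          simp [constPart, scaleLoc, const]
        rw [this, sub_self]
        exact zero_mem _
      | succ n =>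
        obtain ⟨⟨r₀, ⟨_, k, rfl⟩⟩, hk⟩ := IsLocalization.surj (Submonoid.powers s) r
        dsimp only at hk
        refine ⟨N + k, fun b hb => ?_⟩
        obtain ⟨b', rfl⟩ := Ideal.mem_span_singleton'.1 hb
        refine mem_imageFiltration.2 ⟨(Polynomial.C (r₀ * b' * (b' * s ^ (N + k)) ^ n) *
          Polynomial.X ^ (n + 1)) ⊗ₜ a, ?_⟩
        have h0 : constPart s (Polynomial.C r * Polynomial.X ^ (n + 1)) = 0 := by
          simp [constPart]
        rw [ringMapHom_tmul, ringMapHom_tmul, h0, TensorProduct.zero_tmul, sub_zero,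
          ringMapHom_tmul, Algebra.TensorProduct.algebraMap_apply,
          Algebra.TensorProduct.tmul_mul_tmul, one_mul]
        congr 1
        have h1 : scaleLoc s (b' * s ^ (N + k)) (Polynomial.C r * Polynomial.X ^ (n + 1)) =
            Polynomial.C (r * algebraMap R _ (b' * s ^ (N + k)) ^ (n + 1)) *
              Polynomial.X ^ (n + 1) := by
          simp [scaleLoc, mul_pow, mul_assoc]
        have h2 : loc s (Polynomial.C (r₀ * b' * (b' * s ^ (N + k)) ^ n) *
            Polynomial.X ^ (n + 1)) = Polynomial.C (algebraMap R _
              (r₀ * b' * (b' * s ^ (N + k)) ^ n)) * Polynomial.X ^ (n + 1) := by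
          simp [loc]
        rw [h1, h2, ← mul_assoc, Polynomial.algebraMap_apply, ← Polynomial.C_mul]
        congr 2
        simp only [map_mul, map_pow] at hk ⊢
        rw [← hk]
        ring

end Scaling

/-! ### The symplectic and orthogonal cases -/

section AutPullback

variable {Λ M N : Type*} [Semiring Λ] [AddCommMonoid M] [Module Λ M] [AddCommMonoid N] [Module Λ N]

/-- Transport of automorphisms along an isomorphism. -/
def autPullback (θ : M ≃ₗ[Λ] N) :
    (N ≃ₗ[Λ] N) →* (M ≃ₗ[Λ] M) where
  toFun g := θ ≪≫ₗ g ≪≫ₗ θ.symm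
  map_one' := LinearEquiv.ext fun x => θ.symm_apply_apply x
  map_mul' g g' := LinearEquiv.ext fun x => by simp

theorem autPullback_conj (θ : M ≃ₗ[Λ] N)
    (σ : M ≃ₗ[Λ] M) : autPullback θ (θ.symm ≪≫ₗ σ ≪≫ₗ θ) = σ :=
  LinearEquiv.ext fun x => by simp [autPullback]

end AutPullback

section Hyperbolic

variable {Λ M : Type*} [Ring Λ] [AddCommGroup M] [Module Λ M] {m : ℕ} {κ : Kind} {J : Λ → Λ}
  {F : M → M → Λ}

theorem Kind.eta_eq_sgn (κ : Kind) (k : Fin m ⊕ Fin m) : κ.eta k = sgn κ.sign k := by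
  cases k <;> rfl

theorem hypForm_single (h0 : J 0 = 0) (h1 : J 1 = 1) (x : Fin m ⊕ Fin m → Λ)
    (k : Fin m ⊕ Fin m) : hypForm κ J m x (Pi.single k 1) = sgn κ.sign k.swap • x k.swap := by
  rcases k with k | k
  · rw [hypForm, Finset.sum_eq_single k]
    · simp [h0, h1, sgn]
    · intro i _ hi
      simp [hi, h0]
    · simp
  · rw [hypForm, Finset.sum_eq_single k]
    · simp [h0, h1, sgn]
    · intro i _ hi
      simp [hi, h0]
    · simp

theorem isFrame_of_isometry (H : HermForm κ.sign J F) (θ : M ≃ₗ[Λ] (Fin m ⊕ Fin m → Λ))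
    (hθ : ∀ x y, hypForm κ J m (θ x) (θ y) = F x y) :
    IsFrame κ.sign F (fun k => θ.symm (Pi.single k 1)) := by
  have key : ∀ x k, F x (θ.symm (Pi.single k 1)) = sgn κ.sign k.swap • θ x k.swap := fun x k => by
    rw [← hθ, θ.apply_symm_apply, hypForm_single H.J_zero H.J_one]
  have sq : ∀ k : Fin m ⊕ Fin m, sgn κ.sign k * sgn κ.sign k = 1 := sgn_mul H.eps_mul
  refine ⟨fun k l hkl => ?_, fun k => ?_, fun x => θ.injective ?_⟩
  · rw [key, θ.apply_symm_apply, Pi.single_eq_of_ne (fun h => hkl (by rw [← h, Sum.swap_swap])),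
      smul_zero]
  · rw [key, θ.apply_symm_apply, Sum.swap_swap, Pi.single_eq_same]
  · simp only [map_sum, map_zsmul, map_smul, θ.apply_symm_apply, key, Sum.swap_swap]
    ext l
    simp only [Finset.sum_apply, Pi.smul_apply]
    rw [Finset.sum_eq_single l]
    · rw [Pi.single_eq_same, smul_eq_mul, mul_one, smul_smul, sq, one_smul]
    · intro k _ hk
      rw [Pi.single_eq_of_ne hk.symm, smul_zero, smul_zero]
    · simp

/-- The elementary group of the standard hyperbolic module corresponds to the elementary group of
a frame. -/
theorem IsFrame.mem_rootGroup_of_hypElementaryGroup (H : HermForm κ.sign J F)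
    {b : Fin m ⊕ Fin m → M} (hb : IsFrame κ.sign F b) {half : Λ} (hh : half + half = 1)
    (hc : ∀ a, half * a = a * half) (θ : M ≃ₗ[Λ] (Fin m ⊕ Fin m → Λ))
    (hθ : ∀ k, θ (b k) = Pi.single k 1) {ω : (Fin m ⊕ Fin m → Λ) ≃ₗ[Λ] (Fin m ⊕ Fin m → Λ)}
    (hω : ω ∈ hypElementaryGroup κ J m) :
    autPullback θ ω ∈ rootGroup κ.sign F b Set.univ := by
  have sq : ∀ k : Fin m ⊕ Fin m, sgn κ.sign k * sgn κ.sign k = 1 := sgn_mul H.eps_mul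
  have hcoord : ∀ x k, θ x k = sgn κ.sign k • F x (b k.swap) := by
    intro x k
    conv_lhs => rw [hb.expand x]
    simp only [map_sum, map_zsmul, map_smul, hθ, Finset.sum_apply, Pi.smul_apply]
    rw [Finset.sum_eq_single k]
    · simp
    · intro l _ hl
      simp [Pi.single_eq_of_ne hl.symm]
    · simp
  have hsingle : ∀ k a, θ.symm (Pi.single k a) = a • b k := by
    intro k a
    rw [LinearEquiv.symm_apply_eq, map_smul, hθ, ← Pi.single_smul', smul_eq_mul, mul_one]
  refine (Subgroup.closure_le ((rootGroup κ.sign F b Set.univ).comap (autPullback θ))).2 ?_ hω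
  rintro ω (⟨k, l, hlk, hlk', c, hω⟩ | ⟨k, c, hc', hω⟩)
  · have hne : l ≠ k.swap.swap := by simpa using hlk
    refine Subgroup.subset_closure ⟨k.swap, l, hne, sgn κ.sign k • c, trivial,
      LinearEquiv.ext fun x => ?_⟩
    change (θ ≪≫ₗ ω ≪≫ₗ θ.symm) x = _
    rw [H.transv_eq (H.isoPair_smul_right (hb.isoPair hne) _), LinearEquiv.trans_apply,
      LinearEquiv.trans_apply, hω, map_sub, map_add, hsingle, hsingle, θ.symm_apply_apply,
      hcoord, hcoord, H.smul_right, Kind.eta_eq_sgn, Kind.eta_eq_sgn, Sum.swap_swap,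
      sgn_swap H.eps_mul]
    rcases H.eps with e | e <;> cases k <;> cases l <;> simp [sgn, e, H.J_neg, mul_smul]
  · have hJ : J half = half := by
      have h1 : J half + J half = 1 := by rw [← H.J_add, hh, H.J_one]
      calc J half = (half + half) * J half := by rw [hh, one_mul]
        _ = half * (J half + J half) := by noncomm_ring
        _ = half := by rw [h1, mul_one]
    refine Subgroup.subset_closure ⟨k.swap, k.swap, (sum_swap_ne _).symm,
      sgn κ.sign k • (half * c), trivial, LinearEquiv.ext fun x => ?_⟩
    change (θ ≪≫ₗ ω ≪≫ₗ θ.symm) x = _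
    rw [H.transv_self_apply (hb.self _) (c := sgn κ.sign k • c), LinearEquiv.trans_apply,
      LinearEquiv.trans_apply, hω, map_add, hsingle, θ.symm_apply_apply, hcoord,
      smul_mul_assoc, mul_smul_comm]
    have h1 : J (sgn κ.sign k • (half * c)) = sgn κ.sign k • (half * J c) := by
      rw [hc, ← hJ, ← H.J_mul, hJ]
      rcases H.eps with e | e <;> cases k <;> simp [sgn, e, H.J_neg]
    rw [h1, hc', mul_neg, mul_smul_comm, smul_neg, smul_neg, smul_comm (sgn κ.sign k) κ.sign,
      H.eps_smul_smul, sub_neg_eq_add, ← smul_add, ← add_mul, hh, one_mul]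

end Hyperbolic

section FormCase

variable {R A P : Type*} [CommRing R] [Ring A] [Algebra R A] [AddCommGroup P] [Module R P]
  [Module A P] [IsScalarTower R A P] {κ : Kind} {j : A →ₗ[R] A} {h : P →ₗ[R] P →ₗ[R] A}

/-- Substitution of `b X` and of `0` for `X` have close results on elementary automorphisms if
`b` is divisible by a high power of `s`. -/
theorem IsFrame.exists_extends_scale_near (hj : IsInvolution j) (hh : IsForm κ j h) {t : R}
    (ht : t + t = 1) {s : R} {m : ℕ} (hm : 3 ≤ m)
    {b : Fin m ⊕ Fin m → QForm R A P (Localization.Away s)}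
    (hb : IsFrame κ.sign (qForm κ j h _) b)
    {σ : QForm R A P (Localization.Away s)[X] ≃ₗ[(Localization.Away s)[X] ⊗[R] A]
      QForm R A P (Localization.Away s)[X]}
    (hσ : σ ∈ rootGroup κ.sign (qForm κ j h _) (fun k => mapForm (const s) (b k)) Set.univ) :
    ∃ g₀ : QForm R A P (Localization.Away s)[X] ≃ₗ[(Localization.Away s)[X] ⊗[R] A]
      QForm R A P (Localization.Away s)[X],
      Extends (mapForm (constPart s)) (mapForm (constPart s)) σ g₀ ∧
      ∀ N, ∃ l, ∀ c ∈ Ideal.span {s ^ l},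
        ∃ g : QForm R A P (Localization.Away s)[X] ≃ₗ[(Localization.Away s)[X] ⊗[R] A]
          QForm R A P (Localization.Away s)[X],
          Extends (mapForm (scaleLoc s c)) (mapForm (scaleLoc s c)) σ g ∧
          g * g₀⁻¹ ∈ rootGroup κ.sign (qForm κ j h _) (fun k => mapForm (const s) (b k))
            (imageFiltration A (loc s) s N : Set ((Localization.Away s)[X] ⊗[R] A)) := by
  have HX := hermForm_qForm (P := P) (Localization.Away s)[X] hj hh
  have hW := hb.map hj hh (const s)
  have hΦ := isFiltration_imageFiltration (A := A) (isLocalizedModule_loc s)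
  have hext : ∀ f : (Localization.Away s)[X] →ₐ[R] (Localization.Away s)[X],
      f.comp (const s) = const s →
      ∀ (α : {p : (Fin m ⊕ Fin m) × (Fin m ⊕ Fin m) // p.2 ≠ p.1.swap}) c,
        Extends (mapForm f) (mapForm f)
          (qTransv κ j h (mapForm (const s) (b α.1.1)) (c • mapForm (const s) (b α.1.2)))
          (qTransv κ j h (mapForm (const s) (b α.1.1))
            (ringMapHom A f c • mapForm (const s) (b α.1.2))) := fun f hf α c => by
    have := extends_transv hj hh f (HX.isoPair_smul_right (hW.isoPair α.2) c)
    rwa [mapForm_smul, mapForm_comp, mapForm_comp, hf] at this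
  rw [rootGroup_eq_closure] at hσ
  simp only [rootGroup_eq_closure]
  obtain ⟨g₀, -, eg₀, hg₀⟩ := exists_extends_near (Φ := imageFiltration A (loc s) s)
    (V := fun l => (Ideal.span {s ^ l} : Set R)) (f := fun b => mapForm (scaleLoc s b))
    (ρ := fun b => ringMapHom A (scaleLoc s b))
    (f₀ := mapForm (constPart s)) (ρ₀ := ringMapHom A (constPart s)) _
    (fun l l' hl => Ideal.span_singleton_le_span_singleton.2 (pow_dvd_pow s hl))
    (fun α c c' => by
      rw [HX.transv_inv (HX.isoPair_smul_right (hW.isoPair α.2) c'), ← neg_smul,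
        HX.transv_smul_mul (hW.isoPair α.2), sub_eq_add_neg])
    (fun b => hext _ (scaleLoc_comp_const s b)) (hext _ (constPart_comp_const s))
    (fun c N => exists_scaleLoc_sub_mem s c N)
    (fun γ hγ N => by
      have h1 := hW.rootGroup_conj HX hm hΦ (fun N c hc => extInv_mem_imageFiltration j hc)
        (fun N => extInv_algebraMap hj _) (half_add_half ht) (fun a => algebraMap_mul_comm t a)
        (γ := γ) (by rw [rootGroup_eq_closure]; exact hγ) N
      simp only [rootGroup_eq_closure] at h1
      exact h1)
    hσ
  exact ⟨g₀, eg₀, hg₀⟩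

/-- The dilation principle for modules with a form, where `t` is one half. -/
theorem exists_eTransForm_localizesToScale [Module.Finite R A] [Module.Finite A P] (s : R)
    (hj : IsInvolution j) (hh : IsForm κ j h) {t : R} (ht : t + t = 1) {r : ℕ} (hr : 3 ≤ r + 1)
    (θ₀ : QForm R A P (Localization.Away s) ≃ₗ[Localization.Away s ⊗[R] A]
      (Fin (r + 1) ⊕ Fin (r + 1) → Localization.Away s ⊗[R] A))
    (hθ₀ : IsHyperbolicIsometry κ j h (r + 1) θ₀)
    (σ : QForm R A P R[X] ≃ₗ[R[X] ⊗[R] A] QForm R A P R[X]) (hσ : IsIdAtZeroForm σ)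
    (hσs : LocElementaryForm κ j s r θ₀ σ) :
    ∃ l : ℕ, 0 < l ∧ ∀ b ∈ Ideal.span {s ^ l},
      ∃ τ ∈ eTransForm (P := Extn R R[X] P) κ (extForm R[X] h),
        IsIdAtZeroForm τ ∧ LocalizesToScaleForm s b τ σ := by
  obtain ⟨σs, θ, e, eθ, hmem⟩ := hσs
  have H := hermForm_qForm (P := P) (Localization.Away s) hj hh
  have HX := hermForm_qForm (P := P) (Localization.Away s)[X] hj hh
  have hb := isFrame_of_isometry H θ₀ hθ₀
  have hW := hb.map hj hh (const s)
  have hθW : ∀ k, θ (mapForm (const s) (θ₀.symm (Pi.single k 1))) = Pi.single k 1 := by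
    intro k
    rw [eθ, θ₀.apply_symm_apply]
    ext l
    dsimp only
    by_cases hl : l = k
    · subst hl
      rw [Pi.single_eq_same, Pi.single_eq_same, ringMap_eq, map_one]
    · rw [Pi.single_eq_of_ne hl, Pi.single_eq_of_ne hl, ringMap_eq, map_zero]
  have hσmem := hW.mem_rootGroup_of_hypElementaryGroup HX (half_add_half ht)
    (fun a => algebraMap_mul_comm t a) θ hθW hmem
  rw [autPullback_conj] at hσmem
  obtain ⟨N, hN⟩ := hb.exists_rootGroup_le_liftable hj hh ht hr
  obtain ⟨g₀, eg₀, hg₀⟩ := hb.exists_extends_scale_near hj hh ht hr hσmem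
  have hic := isScalarExt_mapForm (A := A) (P := P) ((loc s).comp (subst (0 : R[X])))
  have he : (mapForm ((loc s).comp (subst (0 : R[X]))) : QForm R A P R[X] → _) =
      fun x => mapForm (loc s) (mapForm (subst 0) x) := funext fun x => (mapForm_comp _ _ x).symm
  rw [he] at hic
  have hci : ∀ x : QForm R A P R[X], mapForm (loc s) (mapForm (subst 0) x) =
      mapForm (constPart s) (mapForm (loc s) x) := fun x => by
    rw [mapForm_comp, mapForm_comp, loc_comp_subst_zero]
  have hσ0 : ∀ x, mapForm (subst 0) (σ x) = mapForm (subst 0) x := fun x => by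
    have := congrArg (mapForm (Algebra.ofId R R[X])) (hσ x)
    rw [mapForm_comp, mapForm_comp, ofId_comp_evalZero] at this
    exact this.symm
  have hg₀1 : g₀ = 1 := extends_eq_one hic hci hσ0 e eg₀
  obtain ⟨l, hl⟩ := hg₀ N
  refine ⟨l + 1, l.succ_pos, fun b hb => ?_⟩
  obtain ⟨g, eg, hg⟩ := hl b (Ideal.span_singleton_le_span_singleton.2 (pow_dvd_pow s l.le_succ) hb)
  rw [hg₀1, inv_one, mul_one] at hg
  have hif := isScalarExt_mapForm (A := A) (P := P) ((loc s).comp (scale b))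
  have he' : (mapForm ((loc s).comp (scale b)) : QForm R A P R[X] → _) =
      fun x => mapForm (loc s) (mapForm (scale b) x) := funext fun x => (mapForm_comp _ _ x).symm
  rw [he'] at hif
  obtain ⟨τ, hτ, hτ0, ρ, eρ, hρ⟩ := exists_reduction_eq_id_of_extends
    (isScalarExt_mapForm (subst 0)) (isScalarExt_mapForm (scale b))
    (isScalarExt_mapForm (loc s)) hic hif (isScalarExt_mapForm (constPart s))
    (fun x => by rw [mapForm_comp, subst_zero_comp]) hci
    (fun x => by rw [mapForm_comp, mapForm_comp, scaleLoc_comp_loc])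
    (fun x => by rw [mapForm_comp, constPart_comp_scaleLoc])
    (fun τ hτ => exists_extends_eTransForm hj hh ht (subst 0) hτ) hσ0 e eg (hN hg)
  refine ⟨τ, hτ, fun x => ?_, ρ, eρ, hρ⟩
  have := congrArg (mapForm (evalZero (R := R))) (hτ0 x)
  rw [mapForm_comp, mapForm_comp, evalZero_comp_subst_zero] at this
  exact this.symm

end FormCase

/-! ### Elementary matrices -/

section Elementary

variable {Λ : Type*} [Ring Λ] {m : ℕ}

/-- The elementary matrix `1 + c e_{ij}`, acting on rows. -/
def elem {i j : Fin m} (hij : i ≠ j) (c : Λ) : (Fin m → Λ) ≃ₗ[Λ] (Fin m → Λ) :=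
  LinearEquiv.transvection (f := LinearMap.proj i) (v := Pi.single j c)
    (by simp [Pi.single_eq_of_ne hij])

theorem elem_apply {i j : Fin m} (hij : i ≠ j) (c : Λ) (v : Fin m → Λ) :
    elem hij c v = v + Pi.single j (v i * c) := by
  change v + v i • Pi.single j c = _
  rw [← Pi.single_smul', smul_eq_mul]

/-- The group generated by elementary matrices with coefficients in `S`. -/
def elemGroup (m : ℕ) (S : Set Λ) : Subgroup ((Fin m → Λ) ≃ₗ[Λ] (Fin m → Λ)) :=
  Subgroup.closure {g | ∃ α : {p : Fin m × Fin m // p.1 ≠ p.2}, ∃ c ∈ S, g = elem α.2 c}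

theorem elementaryGroup_eq : elementaryGroup Λ m = elemGroup m Set.univ := by
  rw [elementaryGroup, elemGroup]
  congr 1
  ext g
  constructor
  · rintro ⟨i, j, hij, c, h⟩
    exact ⟨⟨(i, j), hij⟩, c, trivial, LinearEquiv.ext fun v => by rw [h, elem_apply]⟩
  · rintro ⟨⟨⟨i, j⟩, hij⟩, c, -, rfl⟩
    exact ⟨i, j, hij, c, elem_apply hij c⟩

theorem elem_mul {i j : Fin m} (hij : i ≠ j) (c d : Λ) :
    elem hij c * elem hij d = elem hij (c + d) := by
  refine LinearEquiv.ext fun v => ?_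
  simp only [LinearEquiv.mul_apply, elem_apply, Pi.add_apply, Pi.single_eq_of_ne hij, add_zero,
    mul_add, Pi.single_add]
  abel

theorem elem_zero {i j : Fin m} (hij : i ≠ j) : elem hij (0 : Λ) = 1 :=
  LinearEquiv.ext fun v => by simp [elem_apply]

theorem elem_inv {i j : Fin m} (hij : i ≠ j) (c : Λ) : (elem hij c)⁻¹ = elem hij (-c) := by
  rw [inv_eq_iff_mul_eq_one, elem_mul, add_neg_cancel, elem_zero]

theorem elem_mul_comm {p q k l : Fin m} (hpq : p ≠ q) (hkl : k ≠ l) (hkq : k ≠ q) (hlp : p ≠ l)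
    (a c : Λ) : elem hpq a * elem hkl c = elem hkl c * elem hpq a := by
  refine LinearEquiv.ext fun v => ?_
  simp only [LinearEquiv.mul_apply, elem_apply, Pi.add_apply, Pi.single_eq_of_ne hkq,
    Pi.single_eq_of_ne hlp, add_zero]
  abel

theorem elem_mul_left {p q k : Fin m} (hpq : p ≠ q) (hkp : k ≠ p) (hkq : k ≠ q) (a c : Λ) :
    elem hpq a * elem hkp c = elem hkp c * elem hkq (c * a) * elem hpq a := by
  refine LinearEquiv.ext fun v => ?_
  simp only [LinearEquiv.mul_apply, elem_apply, Pi.add_apply, Pi.single_eq_of_ne hkq,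
    Pi.single_eq_same, add_zero, add_mul, mul_assoc, Pi.single_add]
  abel

theorem elem_mul_right {p q l : Fin m} (hpq : p ≠ q) (hql : q ≠ l) (hpl : p ≠ l) (a c : Λ) :
    elem hpq a * elem hql c = elem hql c * elem hpl (-(a * c)) * elem hpq a := by
  refine LinearEquiv.ext fun v => ?_
  simp only [LinearEquiv.mul_apply, elem_apply, Pi.add_apply, Pi.single_eq_of_ne hpq,
    Pi.single_eq_of_ne hpl, Pi.single_eq_of_ne hql, Pi.single_eq_same, add_zero, add_mul,
    mul_assoc, mul_neg, Pi.single_add, Pi.single_neg, Pi.neg_apply, neg_zero]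
  abel

theorem elem_commutator {p i q : Fin m} (hpi : p ≠ i) (hiq : i ≠ q) (hpq : p ≠ q) (a c : Λ) :
    ⁅elem hiq c, elem hpi a⁆ = elem hpq (a * c) := by
  rw [commutatorElement_def, mul_inv_eq_iff_eq_mul, mul_inv_eq_iff_eq_mul]
  refine LinearEquiv.ext fun v => ?_
  simp only [LinearEquiv.mul_apply, elem_apply, Pi.add_apply, Pi.single_eq_of_ne hpq,
    Pi.single_eq_of_ne hpi, Pi.single_eq_same, add_zero, add_mul,
    mul_assoc, Pi.single_add]
  abel

theorem elem_mem {S : Set Λ} {i j : Fin m} (hij : i ≠ j) {c : Λ} (hc : c ∈ S) :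
    elem hij c ∈ elemGroup m S := Subgroup.subset_closure ⟨⟨(i, j), hij⟩, c, hc, rfl⟩

/-- Conjugation of elementary matrices that are not opposite. -/
theorem elem_conj_mem {Φ : ℕ → AddSubgroup Λ} {σ : ℕ → Λ} (hΦ : IsFiltration Φ σ) {p q k l : Fin m}
    (hpq : p ≠ q) (hkl : k ≠ l) (hne : k ≠ q ∨ p ≠ l) (a : Λ) (N : ℕ) : ∃ N', ∀ c ∈ Φ N',
      elem hpq a * elem hkl c * (elem hpq a)⁻¹ ∈ elemGroup m (Φ N : Set Λ) := by
  by_cases hkq : k = q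
  · subst hkq
    have hpl := hne.resolve_left (by simp)
    obtain ⟨N', hN'⟩ := hΦ.mul_left a N
    refine ⟨N ⊔ N', fun c hc => ?_⟩
    rw [elem_mul_right hpq hkl hpl, mul_assoc _ (elem hpq a), mul_inv_cancel, mul_one]
    exact mul_mem (elem_mem _ (hΦ.anti le_sup_left hc))
      (elem_mem _ (neg_mem (hN' c (hΦ.anti le_sup_right hc))))
  · by_cases hpl : p = l
    · subst hpl
      obtain ⟨N', hN'⟩ := hΦ.mul_right a N
      refine ⟨N ⊔ N', fun c hc => ?_⟩
      rw [elem_mul_left hpq hkl hkq, mul_assoc _ (elem hpq a), mul_inv_cancel, mul_one]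
      exact mul_mem (elem_mem _ (hΦ.anti le_sup_left hc))
        (elem_mem _ (hN' c (hΦ.anti le_sup_right hc)))
    · refine ⟨N, fun c hc => ?_⟩
      rw [elem_mul_comm hpq hkl hkq hpl, mul_assoc, mul_inv_cancel, mul_one]
      exact elem_mem _ hc

/-- Conjugation with an elementary automorphism maps products of elementary matrices of
sufficiently small coefficients to products of elementary matrices of small coefficients. -/
theorem elemGroup_conj (hm : 3 ≤ m) {Φ : ℕ → AddSubgroup Λ} {σ : ℕ → Λ} (hΦ : IsFiltration Φ σ)
    {γ : (Fin m → Λ) ≃ₗ[Λ] (Fin m → Λ)} (hγ : γ ∈ elemGroup m Set.univ) (N : ℕ) :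
    ∃ N', ∀ g ∈ elemGroup m (Φ N' : Set Λ), γ * g * γ⁻¹ ∈ elemGroup m (Φ N : Set Λ) := by
  refine exists_conj_mem (fun α : {p : Fin m × Fin m // p.1 ≠ p.2} => elem α.2) hΦ.anti
    (fun α a => elem_inv α.2 a) ?_ hγ N
  rintro ⟨⟨p, q⟩, hpq⟩ a ⟨⟨k, l⟩, hkl⟩ N
  dsimp only at hpq hkl
  change ∃ N', ∀ c ∈ Φ N', elem hpq a * elem hkl c * (elem hpq a)⁻¹ ∈ elemGroup m (Φ N : Set Λ)
  by_cases hne : k ≠ q ∨ p ≠ l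
  · exact elem_conj_mem hΦ hpq hkl hne a N
  push Not at hne
  obtain ⟨rfl, rfl⟩ := hne
  -- An opposite matrix is a commutator by means of a third index.
  obtain ⟨i, hi⟩ : ∃ i : Fin m, i ∉ ({k, p} : Finset (Fin m)) := by
    apply Finset.exists_mem_notMem_of_card_lt_card (s := _) (t := Finset.univ) _ |>.imp
    · exact fun _ h => h.2
    · exact Finset.card_le_two.trans_lt (by rw [Finset.card_univ, Fintype.card_fin]; omega)
  rw [Finset.mem_insert, Finset.mem_singleton, not_or] at hi
  obtain ⟨hik, hip⟩ := hi
  obtain ⟨N₁, h₁⟩ := elem_conj_mem hΦ hpq (Ne.symm hik) (.inr (Ne.symm hip)) a N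
  obtain ⟨N₂, h₂⟩ := elem_conj_mem hΦ hpq hip (.inl hik) a N
  obtain ⟨N₃, h₃⟩ := hΦ.split (N₁ ⊔ N₂)
  refine ⟨N₃, fun c hc => ?_⟩
  obtain ⟨d, hd, rfl⟩ := h₃ c hc
  have g₁ := h₁ _ (hΦ.anti le_sup_left (hΦ.sigma_mem (N₁ ⊔ N₂)))
  have g₂ := h₂ d (hΦ.anti le_sup_right hd)
  rw [← elem_commutator (Ne.symm hik) hip hkl, conjugate_commutatorElement, commutatorElement_def]
  exact mul_mem (mul_mem (mul_mem g₂ g₁) (inv_mem g₂)) (inv_mem g₁)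

end Elementary

/-! ### The linear case -/

section LinearCase

variable {R A P : Type*} [CommRing R] [Ring A] [Algebra R A] [AddCommGroup P] [Module R P]
  [Module A P] [IsScalarTower R A P] {B B' : Type*} [CommRing B] [Algebra R B] [CommRing B']
  [Algebra R B']

/-- The transvection `(p, a) ↦ (p + a x, a)`. -/
def vecTransv (x : Extn R B P) : QLin R A P B ≃ₗ[B ⊗[R] A] QLin R A P B :=
  LinearEquiv.transvection (f := LinearMap.snd _ _ _) (v := (x, 0)) rfl

theorem vecTransv_apply (x p : Extn R B P) (a : B ⊗[R] A) :
    vecTransv x (p, a) = (p + a • x, a) := by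
  change ((p, a) : QLin R A P B) + a • (x, 0) = _
  simp

/-- The transvection `(p, a) ↦ (p, a + ψ(p))`. -/
def dualTransv (ψ : Extn R B P →ₗ[B ⊗[R] A] B ⊗[R] A) :
    QLin R A P B ≃ₗ[B ⊗[R] A] QLin R A P B :=
  LinearEquiv.transvection (f := ψ ∘ₗ LinearMap.fst _ _ _) (v := (0, 1)) (by simp)

theorem dualTransv_apply (ψ : Extn R B P →ₗ[B ⊗[R] A] B ⊗[R] A) (p : Extn R B P) (a : B ⊗[R] A) :
    dualTransv ψ (p, a) = (p, a + ψ p) := by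
  change ((p, a) : QLin R A P B) + ψ p • (0, 1) = _
  simp

theorem vecTransv_mem (x : Extn R B P) : vecTransv x ∈ eTrans (B ⊗[R] A) (Extn R B P) :=
  Subgroup.subset_closure (.inl ⟨x, vecTransv_apply x⟩)

theorem dualTransv_mem (ψ : Extn R B P →ₗ[B ⊗[R] A] B ⊗[R] A) :
    dualTransv ψ ∈ eTrans (B ⊗[R] A) (Extn R B P) :=
  Subgroup.subset_closure (.inr ⟨ψ, dualTransv_apply ψ⟩)

theorem extends_vecTransv (f : B →ₐ[R] B') (x : Extn R B P) :
    Extends (mapLin f) (mapLin f) (vecTransv (A := A) x) (vecTransv (Extn.map f x)) := by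
  rintro ⟨p, a⟩
  change vecTransv (Extn.map f x) (Extn.map f p, ringMapHom A f a) = mapLin f (vecTransv x (p, a))
  rw [vecTransv_apply, vecTransv_apply, ← Extn.map_smul, ← Extn.map_add]
  rfl

theorem extends_dualTransv (f : B →ₐ[R] B') {ψ : Extn R B P →ₗ[B ⊗[R] A] B ⊗[R] A}
    {ψ' : Extn R B' P →ₗ[B' ⊗[R] A] B' ⊗[R] A}
    (h : ∀ p, ψ' (Extn.map f p) = ringMapHom A f (ψ p)) :
    Extends (mapLin f) (mapLin f) (dualTransv ψ) (dualTransv ψ') := by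
  rintro ⟨p, a⟩
  change dualTransv ψ' (Extn.map f p, ringMapHom A f a) = mapLin f (dualTransv ψ (p, a))
  rw [dualTransv_apply, dualTransv_apply, h, ← map_add]
  rfl

theorem exists_extends_eTrans (f : B →ₐ[R] B') {τ : QLin R A P B ≃ₗ[B ⊗[R] A] QLin R A P B}
    (hτ : τ ∈ eTrans (B ⊗[R] A) (Extn R B P)) :
    ∃ τ' ∈ eTrans (B' ⊗[R] A) (Extn R B' P), Extends (mapLin f) (mapLin f) τ τ' := by
  refine exists_extends_of_closure ?_ hτ
  rintro τ (⟨x, hx⟩ | ⟨ψ, hψ⟩)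
  · have h : τ = vecTransv x := LinearEquiv.ext fun ⟨p, a⟩ => by rw [hx, vecTransv_apply]
    rw [h]
    exact ⟨_, vecTransv_mem _, extends_vecTransv f x⟩
  · have h : τ = dualTransv ψ := LinearEquiv.ext fun ⟨p, a⟩ => by rw [hψ, dualTransv_apply]
    rw [h]
    obtain ⟨ψ', hψ'⟩ := Extn.exists_lift (A := A) f (fun x => ringMapHom A f (ψ x))
      (fun x y => by rw [map_add, map_add]) (fun a x => by rw [map_smul, smul_eq_mul, map_mul]; rfl)
    exact ⟨_, dualTransv_mem _, extends_dualTransv f hψ'⟩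

/-- A linear form on `P_s` becomes extended from a linear form on `P` after multiplication with a
power of `s`. -/
theorem exists_dual_lift [Module.Finite A P] [Module.Projective A P] (s : R)
    (ψ : Extn R (Localization.Away s) P →ₗ[Localization.Away s ⊗[R] A] Localization.Away s ⊗[R] A) :
    ∃ N, ∀ n, N ≤ n → ∃ φ : P →ₗ[A] A, ∀ p,
      algebraMap R (Localization.Away s ⊗[R] A) (s ^ n) * ψ (Extn.tmul 1 p) = 1 ⊗ₜ φ p := by
  obtain ⟨k, f, hf⟩ := Module.Finite.exists_fin' A P
  obtain ⟨g, hg⟩ := Module.projective_lifting_property f LinearMap.id hf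
  have hR : ∀ d : R ⊗[R] A, ∃ a : A, d = 1 ⊗ₜ a := fun d =>
    ⟨TensorProduct.lid R A d, ((TensorProduct.lid R A).symm_apply_apply d).symm⟩
  have hψ : ∀ i, ∃ N, ∀ n, N ≤ n → ∃ a : A, algebraMap R (Localization.Away s ⊗[R] A) (s ^ n) *
      ψ (Extn.tmul 1 (f (Pi.single i 1))) = 1 ⊗ₜ a := by
    intro i
    obtain ⟨N, d, hd⟩ := exists_ringMap_eq (isLocalizedModule_ofId s)
      (ψ (Extn.tmul 1 (f (Pi.single i 1))))
    refine ⟨N, fun n hn => ?_⟩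
    obtain ⟨a, ha⟩ := hR (algebraMap R (R ⊗[R] A) (s ^ (n - N)) * d)
    refine ⟨a, ?_⟩
    rw [← Nat.sub_add_cancel hn, pow_add, map_mul, mul_assoc, hd, ← ringMapHom_algebraMap
      (Algebra.ofId R _), ← map_mul, ha, ringMapHom_tmul, map_one]
  choose N hN using hψ
  refine ⟨Finset.univ.sup N, fun n hn => ?_⟩
  choose a ha using fun i => hN i n ((Finset.le_sup (Finset.mem_univ i)).trans hn)
  refine ⟨(∑ i, (LinearMap.toSpanSingleton A A (a i)) ∘ₗ LinearMap.proj i) ∘ₗ g, fun p => ?_⟩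
  have hp : p = ∑ i, g p i • f (Pi.single i 1) := by
    conv_lhs => rw [← LinearMap.id_apply (R := A) p, ← hg, LinearMap.comp_apply]
    conv_lhs => rw [← Finset.univ_sum_single (g p)]
    rw [map_sum]
    refine Finset.sum_congr rfl fun i _ => ?_
    rw [← map_smul, ← Pi.single_smul', smul_eq_mul, mul_one]
  have hsum : ∀ (S : Finset (Fin k)) (y : Fin k → P), (Extn.tmul 1 (∑ i ∈ S, y i) :
      Extn R (Localization.Away s) P) = ∑ i ∈ S, Extn.tmul 1 (y i) := fun S y =>
    TensorProduct.tmul_sum _ _ _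
  have hsm : ∀ (c : A) (y : P), (Extn.tmul 1 (c • y) : Extn R (Localization.Away s) P) =
      ((1 : Localization.Away s) ⊗ₜ[R] c) • Extn.tmul 1 y := fun c y => by
    rw [Extn.tmul_smul_tmul, one_mul]
  conv_lhs => rw [hp, hsum]
  simp only [hsm, map_sum, map_smul, smul_eq_mul, Finset.mul_sum]
  simp only [LinearMap.comp_apply, LinearMap.sum_apply, LinearMap.proj_apply,
    LinearMap.toSpanSingleton_apply, smul_eq_mul, TensorProduct.tmul_sum]
  refine Finset.sum_congr rfl fun i _ => ?_
  rw [← mul_assoc, algebraMap_mul_comm, mul_assoc, ha, Algebra.TensorProduct.tmul_mul_tmul, one_mul]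

/-- The extension of a linear form on `P` to `P_B`. -/
def dualExt (B : Type*) [CommRing B] [Algebra R B] (φ : P →ₗ[A] A) :
    Extn R B P →ₗ[B ⊗[R] A] B ⊗[R] A :=
  let L : Extn R B P →+ B ⊗[R] A := ((φ.restrictScalars R).lTensor B).toAddMonoidHom
  { toFun := L
    map_add' := L.map_add
    map_smul' := fun a x => by
      induction x using Extn.induction_on with
      | zero => simp
      | add x y hx hy => rw [smul_add, L.map_add, L.map_add, hx, hy, smul_add]
      | tmul c p =>
        induction a using TensorProduct.induction_on with
        | zero => simp
        | add a a' h h' => rw [add_smul, L.map_add, h, h', map_add, add_smul]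
        | tmul b a =>
          rw [Extn.tmul_smul_tmul]
          change (b * c) ⊗ₜ[R] φ (a • p) = (b ⊗ₜ[R] a) * (c ⊗ₜ[R] φ p)
          rw [map_smul, smul_eq_mul, Algebra.TensorProduct.tmul_mul_tmul] }

theorem dualExt_tmul (φ : P →ₗ[A] A) (b : B) (p : P) :
    dualExt B φ (Extn.tmul b p) = b ⊗ₜ[R] φ p := rfl

end LinearCase

section LinearLift

variable {R A P : Type*} [CommRing R] [Ring A] [Algebra R A] [AddCommGroup P] [Module R P]
  [Module A P] [IsScalarTower R A P]

variable {s : R} {n : ℕ} {e : Extn R (Localization.Away s) P ≃ₗ[Localization.Away s ⊗[R] A]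
      (Fin n → Localization.Away s ⊗[R] A)}
  {θ : QLin R A P (Localization.Away s)[X] ≃ₗ[(Localization.Away s)[X] ⊗[R] A]
      (Fin (n + 1) → (Localization.Away s)[X] ⊗[R] A)}

/-- The comparison isomorphism `θ` is the extension of scalars of the identification of `Q_s` with
`A_s^{n+1}` given by `e`. -/
abbrev IsCoordExt (e : Extn R (Localization.Away s) P ≃ₗ[Localization.Away s ⊗[R] A]
      (Fin n → Localization.Away s ⊗[R] A))
    (θ : QLin R A P (Localization.Away s)[X] ≃ₗ[(Localization.Away s)[X] ⊗[R] A]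
      (Fin (n + 1) → (Localization.Away s)[X] ⊗[R] A)) : Prop :=
  Extends (mapLin (const s)) (fun v k => ringMap (const s) (v k))
    (fun x => (Fin.snoc (e x.1) x.2 : Fin (n + 1) → Localization.Away s ⊗[R] A)) θ

theorem IsCoordExt.apply_last (hθ : IsCoordExt e θ) (x : QLin R A P (Localization.Away s)[X]) :
    θ x (Fin.last n) = x.2 := by
  have : LinearMap.proj (Fin.last n) ∘ₗ θ.toLinearMap =
      LinearMap.snd ((Localization.Away s)[X] ⊗[R] A) (Extn R (Localization.Away s)[X] P) _ := by
    refine IsScalarExt.linearMap_ext (N := (Localization.Away s)[X] ⊗[R] A)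
      (isScalarExt_mapLin (A := A) (P := P) (const s)) fun y => ?_
    change θ (mapLin (const s) y) (Fin.last n) = _
    rw [hθ y]
    simp [mapLin]
  exact LinearMap.congr_fun this x

/-- The first `n` coordinates of `θ` depend only on the component in `P`, and are extensions of the
coordinates of `e`. -/
theorem IsCoordExt.exists_coord (hθ : IsCoordExt e θ) (i : Fin n) :
    ∃ ψ : Extn R (Localization.Away s)[X] P →ₗ[(Localization.Away s)[X] ⊗[R] A]
        (Localization.Away s)[X] ⊗[R] A,
      (∀ x, θ x i.castSucc = ψ x.1) ∧
      ∀ b p, ψ (Extn.tmul b p) = (b ⊗ₜ 1) * ringMapHom A (const s) (e (Extn.tmul 1 p) i) := by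
  refine ⟨LinearMap.proj i.castSucc ∘ₗ θ.toLinearMap ∘ₗ LinearMap.inl _ _ _, fun x => ?_,
    fun b p => ?_⟩
  · have : LinearMap.proj i.castSucc ∘ₗ θ.toLinearMap = LinearMap.proj i.castSucc ∘ₗ
        θ.toLinearMap ∘ₗ LinearMap.inl _ _ _ ∘ₗ LinearMap.fst _ _ _ := by
      refine IsScalarExt.linearMap_ext (N := (Localization.Away s)[X] ⊗[R] A)
        (isScalarExt_mapLin (A := A) (P := P) (const s)) fun y => ?_
      change θ (mapLin (const s) y) i.castSucc = θ (Extn.map (const s) y.1, 0) i.castSucc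
      have : ((Extn.map (const s) y.1, 0) : QLin R A P (Localization.Away s)[X]) =
          mapLin (const s) (y.1, 0) := by simp [mapLin, ringMap_eq]
      rw [this, hθ, hθ]
      simp
    exact LinearMap.congr_fun this x
  · have : ((Extn.tmul b p, 0) : QLin R A P (Localization.Away s)[X]) =
        (b ⊗ₜ[R] (1 : A)) • mapLin (const s) (Extn.tmul 1 p, 0) := by
      simp [mapLin, ringMap_eq, Extn.tmul_smul_tmul]
    change θ (Extn.tmul b p, 0) i.castSucc = _
    rw [this, map_smul, hθ]
    simp [ringMap_eq]

theorem IsCoordExt.symm_single_last (hθ : IsCoordExt e θ)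
    (c : (Localization.Away s)[X] ⊗[R] A) : θ.symm (Pi.single (Fin.last n) c) = (0, c) := by
  have h1 : ((0, c) : QLin R A P (Localization.Away s)[X]) = c • mapLin (const s) (0, 1) := by
    simp [mapLin, ringMap_eq]
  rw [LinearEquiv.symm_apply_eq, h1, map_smul, hθ]
  ext k
  refine Fin.lastCases ?_ (fun i => ?_) k
  · simp [ringMap_eq]
  · simp [ringMap_eq]

theorem IsCoordExt.symm_single_castSucc (hθ : IsCoordExt e θ) (i : Fin n)
    (c : (Localization.Away s)[X] ⊗[R] A) : θ.symm (Pi.single i.castSucc c) =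
      (c • Extn.map (const s) (e.symm (Pi.single i 1)), 0) := by
  have h1 : ((c • Extn.map (const s) (e.symm (Pi.single i 1)), 0) :
      QLin R A P (Localization.Away s)[X]) =
        c • mapLin (const s) (e.symm (Pi.single i 1), 0) := by
    simp [mapLin, ringMap_eq]
  rw [LinearEquiv.symm_apply_eq, h1, map_smul, hθ]
  ext k
  refine Fin.lastCases ?_ (fun l => ?_) k
  · simp [ringMap_eq]
  · by_cases hl : l = i
    · subst hl
      simp [ringMap_eq]
    · simp [ringMap_eq, Pi.single_eq_of_ne hl,
        Pi.single_eq_of_ne (fun h => hl (Fin.castSucc_injective n h))]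

theorem IsCoordExt.map_apply (hθ : IsCoordExt e θ)
    {f : (Localization.Away s)[X] →ₐ[R] (Localization.Away s)[X]} (hf : f.comp (const s) = const s)
    (x : QLin R A P (Localization.Away s)[X]) :
    θ (mapLin f x) = fun k => ringMapHom A f (θ x k) := by
  ext k
  refine Fin.lastCases ?_ (fun i => ?_) k
  · rw [hθ.apply_last, hθ.apply_last]
    rfl
  · obtain ⟨ψ, h1, h2⟩ := hθ.exists_coord i
    rw [h1, h1]
    change ψ (Extn.map f x.1) = _
    induction x.1 using Extn.induction_on with
    | zero => simp
    | add x y hx hy => rw [Extn.map_add, map_add, map_add, map_add, hx, hy]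
    | tmul b p =>
      rw [Extn.map_tmul, h2, h2, map_mul, ringMapHom_comp, hf, ringMapHom_tmul]

/-- The automorphisms over `R_s[X]` that are extended from elementary transvections over
`R[X]`. -/
noncomputable abbrev liftableLin (R A P : Type*) [CommRing R] [Ring A] [Algebra R A]
    [AddCommGroup P] [Module R P] [Module A P] [IsScalarTower R A P] (u : R) :
    Subgroup (QLin R A P (Localization.Away u)[X] ≃ₗ[(Localization.Away u)[X] ⊗[R] A]
      QLin R A P (Localization.Away u)[X]) :=
  extendable (Λ := R[X] ⊗[R] A) (Λ' := (Localization.Away u)[X] ⊗[R] A) (mapLin (loc u))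
    (eTrans (R[X] ⊗[R] A) (Extn R R[X] P))

theorem autPullback_elem_apply
    (θ : QLin R A P (Localization.Away s)[X] ≃ₗ[(Localization.Away s)[X] ⊗[R] A]
      (Fin (n + 1) → (Localization.Away s)[X] ⊗[R] A)) {i k : Fin (n + 1)} (hik : i ≠ k)
    (c : (Localization.Away s)[X] ⊗[R] A) (x : QLin R A P (Localization.Away s)[X]) :
    autPullback θ (elem hik c) x = x + θ.symm (Pi.single k (θ x i * c)) := by
  change θ.symm (elem hik c (θ x)) = _
  rw [elem_apply, map_add, θ.symm_apply_apply]

/-- Elementary matrices that add a multiple of the last coordinate to another one are transvections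
with a vector of `P`. -/
theorem IsCoordExt.exists_elem_last_mem (hθ : IsCoordExt e θ) (i : Fin n) :
    ∃ N, ∀ c ∈ imageFiltration A (loc s) s N,
      autPullback θ (elem (Fin.castSucc_ne_last i).symm c) ∈ liftableLin R A P s := by
  obtain ⟨N, y, hy⟩ := Extn.exists_map_eq (A := A) (isLocalizedModule_ofId s)
    (e.symm (Pi.single i 1))
  refine ⟨N, fun c hc => ?_⟩
  obtain ⟨d, rfl⟩ := mem_imageFiltration.1 hc
  refine ⟨_, vecTransv_mem (d • Extn.map (Algebra.ofId R R[X]) y), ?_⟩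
  convert extends_vecTransv (loc s) (d • Extn.map (Algebra.ofId R R[X]) y) using 1
  refine congrArg _ (LinearEquiv.ext ?_)
  rintro ⟨p, a⟩
  rw [autPullback_elem_apply, hθ.apply_last, hθ.symm_single_castSucc, vecTransv_apply,
    Extn.map_smul, Extn.map_comp, ← const_comp_ofId, ← Extn.map_comp, ← hy, Extn.map_smul,
    ringMapHom_algebraMap, algebraMap_mul_comm, ← mul_assoc, mul_smul, mul_smul]
  simp

/-- Elementary matrices that add a multiple of a coordinate to the last one are transvections with a
linear form on `P`; the form lifts because `P` is finitely generated and projective. -/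
theorem IsCoordExt.exists_elem_castSucc_mem [Module.Finite A P] [Module.Projective A P]
    (hθ : IsCoordExt e θ) (i : Fin n) :
    ∃ N, ∀ c ∈ imageFiltration A (loc s) s N,
      autPullback θ (elem (Fin.castSucc_ne_last i) c) ∈ liftableLin R A P s := by
  obtain ⟨ψ, h1, h2⟩ := hθ.exists_coord i
  obtain ⟨N, hN⟩ := exists_dual_lift s (LinearMap.proj i ∘ₗ e.toLinearMap)
  obtain ⟨φ, hφ⟩ := hN N le_rfl
  refine ⟨N, fun c hc => ?_⟩
  obtain ⟨d, rfl⟩ := mem_imageFiltration.1 hc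
  refine ⟨_, dualTransv_mem (LinearMap.toSpanSingleton _ _ d ∘ₗ dualExt R[X] φ), ?_⟩
  have h3 : ∀ p : Extn R R[X] P, ψ (Extn.map (loc s) p) *
      (algebraMap R _ (s ^ N) * ringMapHom A (loc s) d) =
        ringMapHom A (loc s) (dualExt R[X] φ p * d) := by
    intro p
    rw [map_mul, ← mul_assoc]
    congr 1
    induction p using Extn.induction_on with
    | zero => simp
    | add x y hx hy => rw [Extn.map_add, map_add, map_add, map_add, add_mul, hx, hy]
    | tmul b p =>
      rw [Extn.map_tmul, h2, dualExt_tmul, ringMapHom_tmul, mul_assoc, ← algebraMap_mul_comm,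
        ← ringMapHom_algebraMap (const s), ← map_mul]
      have := hφ p
      simp only [LinearMap.comp_apply, LinearMap.proj_apply, LinearEquiv.coe_coe] at this
      rw [this, ringMapHom_tmul, map_one, Algebra.TensorProduct.tmul_mul_tmul, mul_one, one_mul]
  convert extends_dualTransv (loc s)
    (ψ' := LinearMap.toSpanSingleton _ _ (algebraMap R _ (s ^ N) * ringMapHom A (loc s) d) ∘ₗ ψ)
    (ψ := LinearMap.toSpanSingleton _ _ d ∘ₗ dualExt R[X] φ) h3 using 1
  refine congrArg _ (LinearEquiv.ext ?_)
  rintro ⟨p, a⟩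
  rw [autPullback_elem_apply, h1, hθ.symm_single_last, dualTransv_apply]
  simp

/-- All elementary matrices over `A_s[X]` with sufficiently small coefficients are extended from
elementary transvections over `A[X]`. -/
theorem IsCoordExt.exists_elemGroup_le [Module.Finite A P] [Module.Projective A P]
    (hθ : IsCoordExt e θ) : ∃ N, elemGroup (n + 1)
      (imageFiltration A (loc s) s N : Set ((Localization.Away s)[X] ⊗[R] A)) ≤
        (liftableLin R A P s).comap (autPullback θ) := by
  have hΦ := isFiltration_imageFiltration (A := A) (isLocalizedModule_loc s)
  choose N₁ h₁ using fun i => hθ.exists_elem_last_mem i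
  choose N₂ h₂ using fun i => hθ.exists_elem_castSucc_mem i
  set N := Finset.univ.sup N₁ ⊔ Finset.univ.sup N₂ with hN
  have le₁ : ∀ i, N₁ i ≤ N := fun i => (Finset.le_sup (Finset.mem_univ i)).trans le_sup_left
  have le₂ : ∀ i, N₂ i ≤ N := fun i => (Finset.le_sup (Finset.mem_univ i)).trans le_sup_right
  obtain ⟨N', hN'⟩ := hΦ.split N
  refine ⟨N ⊔ N', (Subgroup.closure_le _).2 ?_⟩
  rintro _ ⟨⟨⟨i, k⟩, hik⟩, c, hc, rfl⟩
  change autPullback θ (elem hik c) ∈ liftableLin R A P s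
  rw [SetLike.mem_coe] at hc
  have hcN := hΦ.anti (le_sup_left : N ≤ N ⊔ N') hc
  induction i using Fin.lastCases with
  | last =>
    induction k using Fin.lastCases with
    | last => exact absurd rfl hik
    | cast k => exact h₁ k c (hΦ.anti (le₁ k) hcN)
  | cast i =>
    induction k using Fin.lastCases with
    | last => exact h₂ i c (hΦ.anti (le₂ i) hcN)
    | cast k =>
      obtain ⟨d, hd, rfl⟩ := hN' c (hΦ.anti le_sup_right hc)
      have m₁ := h₁ k d (hΦ.anti (le₁ k) hd)
      have m₂ := h₂ i _ (hΦ.anti (le₂ i) (hΦ.sigma_mem N))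
      rw [← elem_commutator (Fin.castSucc_ne_last i) (Fin.castSucc_ne_last k).symm hik,
        commutatorElement_def, map_mul, map_mul, map_mul, map_inv, map_inv]
      exact mul_mem (mul_mem (mul_mem m₁ m₂) (inv_mem m₁)) (inv_mem m₂)

theorem extends_elem {Λ : Type*} [Ring Λ] {m : ℕ} (f : Λ →+* Λ) {i k : Fin m} (hik : i ≠ k)
    (c : Λ) : Extends (fun (v : Fin m → Λ) l => f (v l)) (fun v l => f (v l)) (elem hik c)
      (elem hik (f c)) := fun v => by
  rw [elem_apply, elem_apply]
  ext l
  by_cases hl : l = k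
  · subst hl
    simp
  · simp [Pi.single_eq_of_ne hl]

theorem IsCoordExt.extends_autPullback (hθ : IsCoordExt e θ)
    {f : (Localization.Away s)[X] →ₐ[R] (Localization.Away s)[X]} (hf : f.comp (const s) = const s)
    {g g' : (Fin (n + 1) → (Localization.Away s)[X] ⊗[R] A) ≃ₗ[(Localization.Away s)[X] ⊗[R] A]
      (Fin (n + 1) → (Localization.Away s)[X] ⊗[R] A)}
    (h : Extends (fun v k => ringMapHom A f (v k)) (fun v k => ringMapHom A f (v k)) g g') :
    Extends (mapLin f) (mapLin f) (autPullback θ g)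
      (autPullback θ g') := fun x => by
  change θ.symm (g' (θ (mapLin f x))) = mapLin f (θ.symm (g (θ x)))
  rw [hθ.map_apply hf, LinearEquiv.symm_apply_eq, hθ.map_apply hf, θ.apply_symm_apply]
  exact h (θ x)

theorem exists_eTrans_localizesToScale [Module.Finite A P] [Module.Projective A P] (s : R)
    {n : ℕ} (hn : 2 ≤ n) (e : Extn R (Localization.Away s) P ≃ₗ[Localization.Away s ⊗[R] A]
      (Fin n → Localization.Away s ⊗[R] A))
    (σ : QLin R A P R[X] ≃ₗ[R[X] ⊗[R] A] QLin R A P R[X]) (hσ : IsIdAtZeroLin σ)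
    (hσs : LocElementaryLin s n e σ) :
    ∃ l : ℕ, 0 < l ∧ ∀ b ∈ Ideal.span {s ^ l},
      ∃ τ ∈ eTrans (R[X] ⊗[R] A) (Extn R R[X] P),
        IsIdAtZeroLin τ ∧ LocalizesToScaleLin s b τ σ := by
  obtain ⟨σs, θ, ex, hθ, hmem⟩ := hσs
  have hθ' : IsCoordExt e θ := hθ
  rw [elementaryGroup_eq] at hmem
  have hΦ := isFiltration_imageFiltration (A := A) (isLocalizedModule_loc s)
  obtain ⟨N, hN⟩ := hθ'.exists_elemGroup_le
  obtain ⟨g₀, -, eg₀, hg₀⟩ := exists_extends_near (Φ := imageFiltration A (loc s) s)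
    (x := fun α : {p : Fin (n + 1) × Fin (n + 1) // p.1 ≠ p.2} => elem α.2)
    (V := fun l => (Ideal.span {s ^ l} : Set R))
    (f := fun b v k => ringMapHom A (scaleLoc s b) (v k))
    (ρ := fun b => ringMapHom A (scaleLoc s b))
    (f₀ := fun v k => ringMapHom A (constPart s) (v k)) (ρ₀ := ringMapHom A (constPart s))
    (fun l l' hl => Ideal.span_singleton_le_span_singleton.2 (pow_dvd_pow s hl))
    (fun α c c' => by rw [elem_inv, elem_mul, sub_eq_add_neg])
    (fun b α c => extends_elem (ringMapHom A (scaleLoc s b)).toRingHom α.2 c)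
    (fun α c => extends_elem (ringMapHom A (constPart s)).toRingHom α.2 c)
    (fun c N => exists_scaleLoc_sub_mem s c N)
    (fun γ hγ N => elemGroup_conj (by omega) hΦ hγ N) hmem
  have eg₀' := hθ'.extends_autPullback (constPart_comp_const s) eg₀
  rw [autPullback_conj] at eg₀'
  have hic := isScalarExt_mapLin (A := A) (P := P) ((loc s).comp (subst (0 : R[X])))
  have he : (mapLin ((loc s).comp (subst (0 : R[X]))) : QLin R A P R[X] → _) =
      fun x => mapLin (loc s) (mapLin (subst 0) x) := funext fun x => (mapLin_comp _ _ x).symm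
  rw [he] at hic
  have hci : ∀ x : QLin R A P R[X], mapLin (loc s) (mapLin (subst 0) x) =
      mapLin (constPart s) (mapLin (loc s) x) := fun x => by
    rw [mapLin_comp, mapLin_comp, loc_comp_subst_zero]
  have hσ0 : ∀ x, mapLin (subst 0) (σ x) = mapLin (subst 0) x := fun x => by
    have := congrArg (mapLin (Algebra.ofId R R[X])) (hσ x)
    rw [mapLin_comp, mapLin_comp, ofId_comp_evalZero] at this
    exact this.symm
  have hg₀1 : autPullback θ g₀ = 1 := extends_eq_one hic hci hσ0 ex eg₀'
  obtain ⟨l, hl⟩ := hg₀ N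
  refine ⟨l + 1, l.succ_pos, fun b hb => ?_⟩
  obtain ⟨g, eg, hg⟩ := hl b (Ideal.span_singleton_le_span_singleton.2 (pow_dvd_pow s l.le_succ) hb)
  have eg' := hθ'.extends_autPullback (scaleLoc_comp_const s b) eg
  rw [autPullback_conj] at eg'
  have hg' : autPullback θ g ∈ liftableLin R A P s := by
    have := hN hg
    rwa [Subgroup.mem_comap, map_mul, map_inv, hg₀1, inv_one, mul_one] at this
  have hif := isScalarExt_mapLin (A := A) (P := P) ((loc s).comp (scale b))
  have he' : (mapLin ((loc s).comp (scale b)) : QLin R A P R[X] → _) =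
      fun x => mapLin (loc s) (mapLin (scale b) x) := funext fun x => (mapLin_comp _ _ x).symm
  rw [he'] at hif
  obtain ⟨τ, hτ, hτ0, ρ, eρ, hρ⟩ := exists_reduction_eq_id_of_extends
    (isScalarExt_mapLin (subst 0)) (isScalarExt_mapLin (scale b))
    (isScalarExt_mapLin (loc s)) hic hif (isScalarExt_mapLin (constPart s))
    (fun x => by rw [mapLin_comp, subst_zero_comp]) hci
    (fun x => by rw [mapLin_comp, mapLin_comp, scaleLoc_comp_loc])
    (fun x => by rw [mapLin_comp, constPart_comp_scaleLoc])
    (fun τ hτ => exists_extends_eTrans (subst 0) hτ) hσ0 ex eg' hg'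
  refine ⟨τ, hτ, fun x => ?_, ρ, eρ, hρ⟩
  have := congrArg (mapLin (evalZero (R := R))) (hτ0 x)
  rw [mapLin_comp, mapLin_comp, evalZero_comp_subst_zero] at this
  exact this.symm

end LinearLift

end Dilation

theorem proposition3p1 {R A P : Type*} [CommRing R] [Ring A] [Algebra R A] [Module.Finite R A]
    [AddCommGroup P] [Module R P] [Module A P] [IsScalarTower R A P]
    [Module.Finite A P] [Module.Projective A P]
    (s : R) (hs : ¬ IsNilpotent s) :
    -- the linear case
    (∀ (n : ℕ), 2 ≤ n →
      ∀ (e : Extn R (Localization.Away s) P ≃ₗ[Localization.Away s ⊗[R] A]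
          (Fin n → Localization.Away s ⊗[R] A))
        (σ : QLin R A P R[X] ≃ₗ[R[X] ⊗[R] A] QLin R A P R[X]),
      IsIdAtZeroLin σ → LocElementaryLin s n e σ →
      ∃ l : ℕ, 0 < l ∧ ∀ b ∈ Ideal.span {s ^ l},
        ∃ τ ∈ eTrans (R[X] ⊗[R] A) (Extn R R[X] P),
          IsIdAtZeroLin τ ∧ LocalizesToScaleLin s b τ σ) ∧
    -- the symplectic and orthogonal cases
    (∀ (κ : Kind) (r : ℕ), 6 ≤ 2 * r → IsUnit (2 : R) →
      ∀ (j : A →ₗ[R] A), IsInvolution j →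
      ∀ (h : P →ₗ[R] P →ₗ[R] A), IsForm κ j h → H2 κ j h r →
      Nonempty (Extn R (Localization.Away s) P ≃ₗ[Localization.Away s ⊗[R] A]
          (Fin (2 * r) → Localization.Away s ⊗[R] A)) →
      ∀ (θ₀ : QForm R A P (Localization.Away s) ≃ₗ[Localization.Away s ⊗[R] A]
          (Fin (r + 1) ⊕ Fin (r + 1) → Localization.Away s ⊗[R] A)),
      IsHyperbolicIsometry κ j h (r + 1) θ₀ →
      ∀ (σ : QForm R A P R[X] ≃ₗ[R[X] ⊗[R] A] QForm R A P R[X]), IsIsometry κ j h σ →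
      IsIdAtZeroForm σ → LocElementaryForm κ j s r θ₀ σ →
      ∃ l : ℕ, 0 < l ∧ ∀ b ∈ Ideal.span {s ^ l},
        ∃ τ ∈ eTransForm (P := Extn R R[X] P) κ (extForm R[X] h),
          IsIdAtZeroForm τ ∧ LocalizesToScaleForm s b τ σ) := by
  refine ⟨fun n hn e σ hσ hσs => exists_eTrans_localizesToScale s hn e σ hσ hσs, ?_⟩
  intro κ r hr h2 j hj h hh _ _ θ₀ hθ₀ σ _ hσ hσs
  obtain ⟨t, ht⟩ := h2.exists_right_inv
  rw [two_mul] at ht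
  exact exists_eTransForm_localizesToScale s hj hh ht (by omega) θ₀ hθ₀ σ hσ hσs
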